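/- **Setting.** Let $D\subset\mathbb R^3$ be an open cuboid, $\mathbb H=L^2(D)^3\times L^2(D)^3$, $\sigma_0>0$, $\lambda_1\in\mathbb R$, $\boldsymbol\lambda_2\in\mathbb R^3$, $\widetilde{\boldsymbol\lambda}_2=(\boldsymbol\lambda_2^\top,\boldsymbol\lambda_2^\top)^\top$, and $J(\mathbf E,\mathbf H)=(-\mathbf H,\mathbf E)$. Let $\{q_k\}_{k\ge1}$ be an orthonormal basis of $L^2(D)$, and for $i=1,2$ let $Q_iq_k=\eta^{(i)}_kq_k$ with $\eta^{(i)}_k\ge0$. Assume $Q_1^{1/2}\in HS(L^2(D),H^{\gamma_1}(D))$ and $Q_2^{1/2}\in HS(L^2(D),H^{\gamma_2}_0(D))$ (Hilbert–Schmidt operators) for some real $\gamma_1,\gamma_2\ge1$, where $H_0^{\gamma}(D)$ is the closure of $C_c^\infty(D)$ in $H^\gamma(D)$. On a filtered probability space $(\Omega,\mathcal F,\{\mathcal F_t\}_{t\ge 0},\mathbb P)$ let $W_i(t)=\sum_k\sqrt{\eta^{(i)}_k}\,q_k\beta^{(i)}_k(t)$, where $\beta^{(i)}_k$ ($i=1,2$,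 $k\ge1$) are independent real Brownian motions with respect to $\{\mathcal F_t\}$. For a step size $\Delta t>0$ put $t_n=n\Delta t$, $\Delta W_2^n=W_2(t_{n+1})-W_2(t_n)$ and, for a fixed $b\ge4$, $$\Delta\overline W_1^n=\sqrt{\Delta t}\sum_k\zeta_k^nQ_1^{1/2}q_k,\qquad \zeta_k^n=\max\bigl(-A_{\Delta t},\min(A_{\Delta t},\xi_k^n)\bigr),$$ with $\xi_k^n=(\beta_k^{(1)}(t_{n+1})-\beta_k^{(1)}(t_n))/\sqrt{\Delta t}$ and $A_{\Delta t}=\sqrt{2b|\ln\Delta t|}$. Let $\mathcal T_h$ be a simplicial mesh of $D$, with sets of interior and exterior faces $\mathcal G_h^{\rm int}$ and $\mathcal G_h^{\rm ext}$. Let $\mathbb H_h\subset\mathbb H$ be the space of fields whose restriction to each $K\in\mathcal T_h$ is affine, and let $\pi_h:\mathbb H\to\mathbb H_h$ be the $L^2$-orthogonal projection. For $F\in\mathcal G_h^{\rm int}$ let $\mathbf n_F$ be a fixed unit normal, pointing from $K$ to $K_F$, and $[[v]]_F=v_{K_F}|_F-v_K|_F$; for $F\in\mathcal G_h^{\rm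 ext}$ let $\mathbf n_F$ be the outward unit normal. The discrete Maxwell operator $M_h:\mathbb H_h\to\mathbb H_h$ is given, for $u=(\mathbf E,\mathbf H)$ and $v=(\psi,\phi)$ in $\mathbb H_h$, by $$\begin{aligned}\langle M_hu,v\rangle_{\mathbb H}={}&\sum_{K\in\mathcal T_h}\bigl(\langle\nabla\times\mathbf H,\psi\rangle_{L^2(K)^3}-\langle\nabla\times\mathbf E,\phi\rangle_{L^2(K)^3}\bigr)\\&+\tfrac12\sum_{F\in\mathcal G_h^{\rm int}}\bigl(\langle\mathbf n_F\times[[\mathbf H]]_F,\psi_K+\psi_{K_F}\rangle_{L^2(F)^3}-\langle\mathbf n_F\times[[\mathbf E]]_F,\phi_K+\phi_{K_F}\rangle_{L^2(F)^3}\\&\qquad-\langle\mathbf n_F\times[[\mathbf E]]_F,\mathbf n_F\times[[\psi]]_F\rangle_{L^2(F)^3}-\langle\mathbf n_F\times[[\mathbf H]]_F,\mathbf n_F\times[[\phi]]_F\rangle_{L^2(F)^3}\bigr)\\&+\sum_{F\in\mathcal G_h^{\rm ext}}\bigl(\langle\mathbf n_F\times\mathbf E,\phi\rangle_{L^2(F)^3}-\langle\mathbf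 n_F\times\mathbf E,\mathbf n_F\times\psi\rangle_{L^2(F)^3}\bigr).\end{aligned}$$ The dG full discretization with initial value $u_0$ is the adapted $\mathbb H_h$-valued process with $u_h^0=\pi_hu_0$ and $$u_h^{n+1}-e^{-\sigma_0\Delta t}u_h^n=\tfrac{\Delta t}2\bigl(M_hu_h^{n+1}+e^{-\sigma_0\Delta t}M_hu_h^n\bigr)+\tfrac{\lambda_1}2\pi_h\bigl[J(u_h^{n+1}+e^{-\sigma_0\Delta t}u_h^n)\Delta\overline W_1^n\bigr]+\pi_h(\widetilde{\boldsymbol\lambda}_2\Delta W_2^n).$$ **Theorem.** There is $\Delta t_0>0$, independent of the mesh, such that for every $\Delta t\in(0,\Delta t_0)$ and every simplicial mesh $\mathcal T_h$ of $D$, the discretization has a solution, unique up to null sets, for every $\mathcal F_0$-measurable $u_0\in L^2(\Omega,\mathbb H)$. Let $P_h^n\varphi(x)=\mathbb E[\varphi(u_h^n)]$ for $u_0=x\in\mathbb H$ be its Markov transition semigroup, and $(P^n_h)^*\mu$ the law of $u_h^n$ when $u_0$ has law $\mu$. Then: (i) There is exactly one Borel probability measure $\pi^{\Delta t,h}$ on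 $\mathbb H$ that is invariant, i.e. $\int P_h^n\varphi\,d\pi^{\Delta t,h}=\int\varphi\,d\pi^{\Delta t,h}$ for all bounded Borel $\varphi$ and all $n\in\mathbb N$, and it has finite second moment ($\pi^{\Delta t,h}\in\mathcal P_2(\mathbb H)$). The discretization is ergodic: for all $\varphi\in L^2(\mathbb H,\pi^{\Delta t,h})$, $$\lim_{N\to\infty}\frac1N\sum_{n=0}^{N-1}P_h^n\varphi=\int\varphi\,d\pi^{\Delta t,h}\quad\text{in }L^2(\mathbb H,\pi^{\Delta t,h}).$$ It is exponentially mixing: there are $\rho>0$ and $C:\mathbb H\to(0,\infty)$ such that for every bounded Lipschitz $\varphi:\mathbb H\to\mathbb R$ with Lipschitz constant $L_\varphi$, all $n\in\mathbb N$ and all $x\in\mathbb H$, $$\Bigl|P_h^n\varphi(x)-\int\varphi\,d\pi^{\Delta t,h}\Bigr|\le C(x)L_\varphi e^{-\rho t_n}.$$ (ii) For every $\mu\in\mathcal P_2(\mathbb H)$ and $n\in\mathbb N$, with $\mathcal W_2$ the $L^2$-Wasserstein distance, $$\mathcal W_2\bigl((P_h^n)^*\mu,\pi^{\Delta t,h}\bigr)\le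 e^{-\sigma_0t_n}\,\mathcal W_2\bigl(\mu,\pi^{\Delta t,h}\bigr).$$ -/

import Mathlib

open MeasureTheory ProbabilityTheory Filter Topology
open scoped ENNReal NNReal

noncomputable section

namespace StochMaxwell

/-! ### Vectors, cuboid, function spaces -/

/-- Euclidean three-space. -/
abbrev E3 : Type := EuclideanSpace ℝ (Fin 3)

/-- Values `(E, H) = (E_1, E_2, E_3, H_1, H_2, H_3)` of an electromagnetic field. -/
abbrev E6 : Type := EuclideanSpace ℝ (Fin 6)

/-- An open cuboid in `ℝ³`. -/
structure Cuboid where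
  lo : Fin 3 → ℝ
  hi : Fin 3 → ℝ
  lo_lt_hi : ∀ i, lo i < hi i

/-- The point set of an open cuboid. -/
def Cuboid.toSet (D : Cuboid) : Set E3 := {x | ∀ i, D.lo i < x i ∧ x i < D.hi i}

/-- Lebesgue measure on the cuboid. -/
abbrev Cuboid.vol (D : Cuboid) : Measure E3 := volume.restrict D.toSet

/-- The scalar space `L²(D)`. -/
abbrev L2 (D : Cuboid) : Type := Lp ℝ 2 D.vol

/-- The space `ℍ = L²(D)³ × L²(D)³`, as square integrable fields with values in `ℝ⁶`. -/
abbrev HH (D : Cuboid) : Type := Lp E6 2 D.vol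

instance (D : Cuboid) : MeasurableSpace (HH D) := borel _
instance (D : Cuboid) : BorelSpace (HH D) := ⟨rfl⟩

/-- The cross product of `ℝ³`. -/
def cross (a b : E3) : E3 := WithLp.toLp 2 (crossProduct a.ofLp b.ofLp)

/-- The `i`-th partial derivative. -/
def pderiv (i : Fin 3) (f : E3 → ℝ) (x : E3) : ℝ := fderiv ℝ f x (EuclideanSpace.single i 1)

/-- The curl of a vector field. -/
def curl (f : E3 → E3) (x : E3) : E3 :=
  !₂[pderiv 1 (fun y => f y 2) x - pderiv 2 (fun y => f y 1) x,
     pderiv 2 (fun y => f y 0) x - pderiv 0 (fun y => f y 2) x,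
     pderiv 0 (fun y => f y 1) x - pderiv 1 (fun y => f y 0) x]

/-- The matrix `J = [[0, -I], [I, 0]]`, that is `J (E, H) = (-H, E)`. -/
def rotJ (v : E6) : E6 := !₂[-v 3, -v 4, -v 5, v 0, v 1, v 2]

/-- The vector `(v, v)`. -/
def dup (v : E3) : E6 := !₂[v 0, v 1, v 2, v 0, v 1, v 2]

/-! ### Sobolev spaces `H^γ(D)` and `H_0^γ(D)` -/

/-- The partial derivative `∂^α` of a smooth function. -/
def multiDeriv (α : Fin 3 → ℕ) (φ : E3 → ℝ) : E3 → ℝ :=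
  (pderiv 0)^[α 0] ((pderiv 1)^[α 1] ((pderiv 2)^[α 2] φ))

/-- Test functions: smooth with compact support inside the open cuboid. -/
def IsTestFunction (D : Cuboid) (φ : E3 → ℝ) : Prop :=
  ContDiff ℝ (⊤ : ℕ∞) φ ∧ HasCompactSupport φ ∧ tsupport φ ⊆ D.toSet

/-- `g ∈ L²(D)` is the weak derivative `∂^α f` of `f ∈ L²(D)`. -/
def HasWeakDeriv (D : Cuboid) (α : Fin 3 → ℕ) (f g : E3 → ℝ) : Prop :=
  MemLp f 2 D.vol ∧ MemLp g 2 D.vol ∧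
    ∀ φ, IsTestFunction D φ →
      (∫ x in D.toSet, f x * multiDeriv α φ x) = (-1) ^ (∑ i, α i) * (∫ x in D.toSet, g x * φ x)

/-- Multi-indices of order at most `m`. -/
def multiIndices (m : ℕ) : Finset (Fin 3 → ℕ) :=
  (Fintype.piFinset fun _ => Finset.range (m + 1)).filter fun α => ∑ i, α i ≤ m

/-- The squared Gagliardo (Slobodeckij) seminorm of order `s ∈ (0,1)`. -/
def gagliardoSq (D : Cuboid) (s : ℝ) (g : E3 → ℝ) : ℝ≥0∞ :=
  ∫⁻ x in D.toSet, ∫⁻ y in D.toSet, ENNReal.ofReal ((g x - g y) ^ 2 / ‖x - y‖ ^ (3 + 2 * s))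

open scoped Classical in
/-- The squared norm of `H^γ(D) = W^{γ,2}(D)` for real `γ ≥ 0`, equal to `⊤` when `f` is not in
`H^γ(D)`. The family `G` runs over the weak derivatives of `f` up to order `⌊γ⌋`; these are unique
up to null sets, so that the infimum is over a constant if they exist and over the empty family if
they do not. -/
def sobolevNormSq (D : Cuboid) (γ : ℝ) (f : E3 → ℝ) : ℝ≥0∞ :=
  ⨅ (G : (Fin 3 → ℕ) → E3 → ℝ) (_ : ∀ α ∈ multiIndices ⌊γ⌋₊, HasWeakDeriv D α f (G α)),
    (∑ α ∈ multiIndices ⌊γ⌋₊, eLpNorm (G α) 2 D.vol ^ 2) +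
      if γ = ⌊γ⌋₊ then 0
      else ∑ α ∈ (multiIndices ⌊γ⌋₊).filter (fun α => ∑ i, α i = ⌊γ⌋₊),
        gagliardoSq D (γ - ⌊γ⌋₊) (G α)

/-- `f ∈ H_0^γ(D)`: `f` is a limit of test functions in the norm of `H^γ(D)`. -/
def MemSobolevZero (D : Cuboid) (γ : ℝ) (f : E3 → ℝ) : Prop :=
  ∀ ε : ℝ≥0∞, 0 < ε → ∃ φ, IsTestFunction D φ ∧ sobolevNormSq D γ (fun x => f x - φ x) < ε

/-! ### Covariance operators and Wiener processes -/

/-- `Q^{1/2} q_k = √η_k q_k`, where `Q q_k = η_k q_k`. -/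
def sqrtQ {D : Cuboid} (q : HilbertBasis ℕ ℝ (L2 D)) (η : ℕ → ℝ) (k : ℕ) : L2 D := √(η k) • q k

/-- `Q^{1/2}` is Hilbert-Schmidt from `L²(D)` to `H^γ(D)`: `∑_k ‖Q^{1/2} q_k‖²_{H^γ} < ∞`. -/
def IsHSSobolev (D : Cuboid) (γ : ℝ) (q : HilbertBasis ℕ ℝ (L2 D)) (η : ℕ → ℝ) : Prop :=
  ∑' k, sobolevNormSq D γ (sqrtQ q η k) < ⊤

/-- `Q^{1/2}` is Hilbert-Schmidt from `L²(D)` to `H_0^γ(D)`. -/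
def IsHSSobolevZero (D : Cuboid) (γ : ℝ) (q : HilbertBasis ℕ ℝ (L2 D)) (η : ℕ → ℝ) : Prop :=
  (∀ k, MemSobolevZero D γ (sqrtQ q η k)) ∧ IsHSSobolev D γ q η

/-- A countable family of independent real Brownian motions on a filtered probability space
(Brownian motions with respect to the filtration). -/
structure IsBrownianFamily {ι Ω : Type*} {mΩ : MeasurableSpace Ω} (ℱ : Filtration ℝ≥0 mΩ)
    (β : ι → ℝ≥0 → Ω → ℝ) (P : Measure Ω) : Prop where
  adapted : ∀ j t, Measurable[ℱ t] (β j t)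
  brownian : ∀ j, IsBrownianReal (β j) P
  indep : iIndepFun (fun j ω t => β j t ω) P
  indep_past : ∀ s t, s ≤ t →
    Indep (⨆ j, MeasurableSpace.comap (fun ω => β j t ω - β j s ω) inferInstance) (ℱ s) P

/-- The `Q`-Wiener process `W(t) = ∑_k √η_k β_k(t) q_k`; for a trace class `Q` the series converges
in `L²(D)` almost surely. -/
def wiener {Ω : Type*} {D : Cuboid} (q : HilbertBasis ℕ ℝ (L2 D)) (η : ℕ → ℝ)
    (β : ℕ → ℝ≥0 → Ω → ℝ) (t : ℝ≥0) (ω : Ω) : L2 D :=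
  ∑' k, β k t ω • sqrtQ q η k

/-- The truncation level `A_{Δt} = √(2 b |ln Δt|)`. -/
def truncLevel (b : ℝ) (dt : ℝ≥0) : ℝ := √(2 * b * |Real.log dt|)

/-- The normalized increment `ξ_k^n = (β_k(t_{n+1}) - β_k(t_n)) / √Δt`, with `t_n = n Δt`. -/
def normIncr {Ω : Type*} (β : ℕ → ℝ≥0 → Ω → ℝ) (dt : ℝ≥0) (n k : ℕ) (ω : Ω) : ℝ :=
  (β k ((n + 1 : ℕ) * dt) ω - β k (n * dt) ω) / √(dt : ℝ)

/-- The truncated increment `√Δt ∑_k ζ_k^n Q^{1/2} q_k`, where `ζ_k^n` is `ξ_k^n` truncated to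
`[-A_{Δt}, A_{Δt}]`. -/
def truncIncr {Ω : Type*} {D : Cuboid} (q : HilbertBasis ℕ ℝ (L2 D)) (η : ℕ → ℝ)
    (β : ℕ → ℝ≥0 → Ω → ℝ) (b : ℝ) (dt : ℝ≥0) (n : ℕ) (ω : Ω) : L2 D :=
  √(dt : ℝ) • ∑' k,
    max (-truncLevel b dt) (min (truncLevel b dt) (normIncr β dt n k ω)) • sqrtQ q η k

/-! ### Simplicial meshes -/

/-- A simplicial mesh of the cuboid: finitely many nondegenerate tetrahedra with disjoint interiors
covering the closed cuboid (hanging nodes are allowed), with an orientation of each interior face.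
`fwd i j` means that the normal of the face between the elements `i` and `j` points from `i` to
`j`. -/
structure SimplicialMesh (D : Cuboid) where
  card : ℕ
  vert : Fin card → Fin 4 → E3
  affineIndependent : ∀ i, AffineIndependent ℝ (vert i)
  disjoint_interior : ∀ i j, i ≠ j →
    Disjoint (interior (convexHull ℝ (Set.range (vert i))))
      (interior (convexHull ℝ (Set.range (vert j))))
  iUnion_eq : ⋃ i, convexHull ℝ (Set.range (vert i)) = closure D.toSet
  fwd : Fin card → Fin card → Prop
  fwd_iff : ∀ i j, i ≠ j → (fwd i j ↔ ¬ fwd j i)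

namespace SimplicialMesh

variable {D : Cuboid} (T : SimplicialMesh D)

/-- The closed element `K_i`. -/
def elem (i : Fin T.card) : Set E3 := convexHull ℝ (Set.range (T.vert i))

/-- The facet of `K_i` opposite to its `k`-th vertex. -/
def facet (i : Fin T.card) (k : Fin 4) : Set E3 :=
  convexHull ℝ (Set.range (T.vert i ∘ k.succAbove))

/-- A normal vector of the facet of `K_i` opposite to its `k`-th vertex. -/
def facetCross (i : Fin T.card) (k : Fin 4) : E3 :=
  cross (T.vert i (k.succAbove 1) - T.vert i (k.succAbove 0))
    (T.vert i (k.succAbove 2) - T.vert i (k.succAbove 0))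

/-- The unit normal of the `k`-th facet of `K_i`, pointing out of `K_i`. -/
def normal (i : Fin T.card) (k : Fin 4) : E3 :=
  (Real.sign (inner ℝ (T.facetCross i k) (T.vert i (k.succAbove 0) - T.vert i k)) /
    ‖T.facetCross i k‖) • T.facetCross i k

/-- The part of the `k`-th facet of `K_i` shared with `K_j`. -/
def face (i : Fin T.card) (k : Fin 4) (j : Fin T.card) : Set E3 := T.facet i k ∩ T.elem j

/-- `face i k j` is an interior face (it has positive area), oriented from `K_i` to `K_j`. -/
def IsIntFace (i : Fin T.card) (k : Fin 4) (j : Fin T.card) : Prop :=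
  i ≠ j ∧ T.fwd i j ∧ 0 < μHE[2] (T.face i k j)

/-- The `k`-th facet of `K_i` is an exterior face. -/
def IsExtFace (i : Fin T.card) (k : Fin 4) : Prop := T.facet i k ⊆ frontier D.toSet

end SimplicialMesh

/-! ### The dG space -/

variable {D : Cuboid}

lemma Cuboid.isOpen (D : Cuboid) : IsOpen D.toSet := by
  have : D.toSet = ⋂ i, {x : E3 | D.lo i < x i} ∩ {x : E3 | x i < D.hi i} := by
    ext x; simp [Cuboid.toSet]
  rw [this]
  refine isOpen_iInter_of_finite fun i => ?_
  have hc : Continuous fun x : E3 => x i := by fun_prop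
  exact (isOpen_lt continuous_const hc).inter (isOpen_lt hc continuous_const)

/-- The dG space `ℍ_h`: fields in `ℍ` that are affine on every element. -/
def dgSpace (T : SimplicialMesh D) : Submodule ℝ (HH D) where
  carrier := {u | ∀ i, ∃ p : E3 →ᵃ[ℝ] E6, ∀ᵐ x ∂D.vol, x ∈ T.elem i → u x = p x}
  zero_mem' i := ⟨0, by
    filter_upwards [Lp.coeFn_zero E6 2 D.vol] with x hx _
    exact hx⟩
  add_mem' {u v} hu hv i := by
    obtain ⟨p, hp⟩ := hu i
    obtain ⟨r, hr⟩ := hv i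
    refine ⟨p + r, ?_⟩
    filter_upwards [hp, hr, Lp.coeFn_add u v] with x h1 h2 h3 hx
    rw [h3, Pi.add_apply, h1 hx, h2 hx, AffineMap.coe_add, Pi.add_apply]
  smul_mem' c u hu i := by
    obtain ⟨p, hp⟩ := hu i
    refine ⟨c • p, ?_⟩
    filter_upwards [hp, Lp.coeFn_smul c u] with x h1 h3 hx
    rw [h3, Pi.smul_apply, h1 hx, AffineMap.coe_smul, Pi.smul_apply]

lemma affine_unique (T : SimplicialMesh D) (i : Fin T.card) {p r : E3 →ᵃ[ℝ] E6}
    (h : ∀ᵐ x ∂D.vol, x ∈ T.elem i → p x = r x) : p = r := by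
  have hne : (interior (T.elem i)).Nonempty := by
    unfold SimplicialMesh.elem
    rw [interior_convexHull_nonempty_iff_affineSpan_eq_top,
      (T.affineIndependent i).affineSpan_eq_top_iff_card_eq_finrank_add_one]
    simp
  have hU : (interior (T.elem i) ∩ D.toSet).Nonempty := by
    obtain ⟨x, hx⟩ := hne
    have hx' : x ∈ closure D.toSet := by
      rw [← T.iUnion_eq]
      exact Set.mem_iUnion.2 ⟨i, interior_subset hx⟩
    exact mem_closure_iff.1 hx' _ isOpen_interior hx
  have hO : IsOpen (interior (T.elem i) ∩ D.toSet) := isOpen_interior.inter D.isOpen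
  have hae : (p : E3 → E6) =ᵐ[volume.restrict (interior (T.elem i) ∩ D.toSet)] r := by
    have h' := ae_restrict_of_ae_restrict_of_subset
      (Set.inter_subset_right (s := interior (T.elem i)) (t := D.toSet)) h
    filter_upwards [h', ae_restrict_mem hO.measurableSet] with x hx hx2
    exact hx (interior_subset hx2.1)
  have heq := Measure.eqOn_open_of_ae_eq hae hO
    p.continuous_of_finiteDimensional.continuousOn r.continuous_of_finiteDimensional.continuousOn
  exact AffineMap.ext_on (hO.affineSpan_eq_top hU) heq

/-- The restriction `u_K` of `u ∈ ℍ_h` to an element, as an affine map (so that it has values on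
the faces). -/
def trace (T : SimplicialMesh D) (i : Fin T.card) : dgSpace T →ₗ[ℝ] (E3 →ᵃ[ℝ] E6) where
  toFun u := (u.2 i).choose
  map_add' u v := by
    apply affine_unique T i
    filter_upwards [(u.2 i).choose_spec, (v.2 i).choose_spec, ((u + v).2 i).choose_spec,
      Lp.coeFn_add (u : HH D) (v : HH D)] with x h1 h2 h3 h4 hx
    rw [← h3 hx, AffineMap.coe_add, Pi.add_apply, ← h1 hx, ← h2 hx, Submodule.coe_add, h4,
      Pi.add_apply]
  map_smul' c u := by
    apply affine_unique T i
    filter_upwards [(u.2 i).choose_spec, ((c • u).2 i).choose_spec,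
      Lp.coeFn_smul c (u : HH D)] with x h1 h3 h4 hx
    rw [← h3 hx, RingHom.id_apply, AffineMap.coe_smul, Pi.smul_apply, ← h1 hx, Submodule.coe_smul,
      h4, Pi.smul_apply]

lemma trace_spec (T : SimplicialMesh D) (i : Fin T.card) (u : dgSpace T) :
    ∀ᵐ x ∂D.vol, x ∈ T.elem i → (u : HH D) x = trace T i u x := (u.2 i).choose_spec

lemma exists_mem_elem (T : SimplicialMesh D) {x : E3} (hx : x ∈ D.toSet) : ∃ i, x ∈ T.elem i := by
  have : x ∈ ⋃ i, convexHull ℝ (Set.range (T.vert i)) := by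
    rw [T.iUnion_eq]; exact subset_closure hx
  exact Set.mem_iUnion.1 this

instance (T : SimplicialMesh D) : FiniteDimensional ℝ (dgSpace T) := by
  refine FiniteDimensional.of_injective (LinearMap.pi fun i => trace T i) ?_
  rw [← LinearMap.ker_eq_bot, LinearMap.ker_eq_bot']
  intro u hu
  have h0 : ∀ i, trace T i u = 0 := fun i => congrFun hu i
  apply Subtype.ext
  apply Lp.ext
  filter_upwards [ae_all_iff.2 fun i => trace_spec T i u, ae_restrict_mem D.isOpen.measurableSet,
    Lp.coeFn_zero E6 2 D.vol] with x hx hxD hz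
  obtain ⟨i, hi⟩ := exists_mem_elem T hxD
  rw [hx i hi, h0 i]
  exact hz.symm

lemma isCompact_elem (T : SimplicialMesh D) (i : Fin T.card) : IsCompact (T.elem i) :=
  Set.Finite.isCompact_convexHull ℝ (Set.finite_range _)

lemma isCompact_facet (T : SimplicialMesh D) (i : Fin T.card) (k : Fin 4) :
    IsCompact (T.facet i k) :=
  Set.Finite.isCompact_convexHull ℝ (Set.finite_range _)

/-- The `L²`-orthogonal projection `π_h : ℍ → ℍ_h`. -/
def proj (T : SimplicialMesh D) : HH D →L[ℝ] dgSpace T := (dgSpace T).orthogonalProjectionOnto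

lemma dg_bounded (T : SimplicialMesh D) (u : dgSpace T) :
    ∃ C : ℝ, ∀ᵐ x ∂D.vol, ‖(u : HH D) x‖ ≤ C := by
  have hb : ∀ i, ∃ C : ℝ, ∀ x ∈ T.elem i, ‖trace T i u x‖ ≤ C := fun i =>
    (isCompact_elem T i).exists_bound_of_continuousOn
      (trace T i u).continuous_of_finiteDimensional.continuousOn
  choose C hC using hb
  refine ⟨∑ i, |C i|, ?_⟩
  filter_upwards [ae_all_iff.2 fun i => trace_spec T i u,
    ae_restrict_mem D.isOpen.measurableSet] with x hx hxD
  obtain ⟨i, hi⟩ := exists_mem_elem T hxD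
  rw [hx i hi]
  exact (hC i x hi).trans ((le_abs_self _).trans
    (Finset.single_le_sum (f := fun i => |C i|) (fun _ _ => abs_nonneg _) (Finset.mem_univ i)))

lemma norm_rotJ (v : E6) : ‖rotJ v‖ = ‖v‖ := by
  simp only [rotJ, EuclideanSpace.norm_eq, Fin.sum_univ_succ]
  simp
  ring_nf

lemma continuous_rotJ : Continuous rotJ := by
  unfold rotJ
  fun_prop

lemma memLp_mulJ (T : SimplicialMesh D) (w : L2 D) (u : dgSpace T) :
    MemLp (fun x => w x • rotJ ((u : HH D) x)) 2 D.vol := by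
  obtain ⟨C, hC⟩ := dg_bounded T u
  refine MemLp.of_le_mul (c := C) (Lp.memLp w)
    ((Lp.aestronglyMeasurable w).smul
      (continuous_rotJ.comp_aestronglyMeasurable (Lp.aestronglyMeasurable (u : HH D)))) ?_
  filter_upwards [hC] with x hx
  rw [norm_smul, norm_rotJ, mul_comm]
  exact mul_le_mul_of_nonneg_right hx (norm_nonneg _)

/-- The field `x ↦ w(x) J u(x)` for a scalar `w ∈ L²(D)` and `u ∈ ℍ_h`. -/
def mulJ (T : SimplicialMesh D) (w : L2 D) (u : dgSpace T) : HH D := (memLp_mulJ T w u).toLp _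

/-- The field `x ↦ w(x) v` for a scalar `w ∈ L²(D)` and a constant vector `v ∈ ℝ⁶`. -/
def mulConst (w : L2 D) (v : E6) : HH D := (ContinuousLinearMap.toSpanSingleton ℝ v).compLp w

/-! ### The discrete Maxwell operator -/

/-- Electric component. -/
def elec (p : E3 →ᵃ[ℝ] E6) (x : E3) : E3 := !₂[p x 0, p x 1, p x 2]

/-- Magnetic component. -/
def magn (p : E3 →ᵃ[ℝ] E6) (x : E3) : E3 := !₂[p x 3, p x 4, p x 5]

/-- Integrand on an element. -/
def volTerm (p q : E3 →ᵃ[ℝ] E6) (x : E3) : ℝ :=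
  inner ℝ (curl (magn p) x) (elec q x) - inner ℝ (curl (elec p) x) (magn q x)

/-- Integrand on an interior face with normal `n` pointing from an element `K`, with traces `p, q`
of the two fields, to its neighbour, with traces `p', q'`. -/
def intTerm (n : E3) (p p' q q' : E3 →ᵃ[ℝ] E6) (x : E3) : ℝ :=
  inner ℝ (cross n (magn p' x - magn p x)) (elec q x + elec q' x)
    - inner ℝ (cross n (elec p' x - elec p x)) (magn q x + magn q' x)
    - inner ℝ (cross n (elec p' x - elec p x)) (cross n (elec q' x - elec q x))
    - inner ℝ (cross n (magn p' x - magn p x)) (cross n (magn q' x - magn q x))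

/-- Integrand on an exterior face with outward normal `n`. -/
def extTerm (n : E3) (p q : E3 →ᵃ[ℝ] E6) (x : E3) : ℝ :=
  inner ℝ (cross n (elec p x)) (magn q x) - inner ℝ (cross n (elec p x)) (cross n (elec q x))

lemma pderiv_affine (p : E3 →ᵃ[ℝ] E6) (i : Fin 3) (j : Fin 6) (x : E3) :
    pderiv i (fun y => p y j) x = p.linear (EuclideanSpace.single i 1) j := by
  have h : HasFDerivAt (fun y => p y j)
      ((EuclideanSpace.proj j : E6 →L[ℝ] ℝ).comp (LinearMap.toContinuousLinearMap p.linear)) x := by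
    have h2 : (fun y => p y j) = fun y =>
        ((EuclideanSpace.proj j : E6 →L[ℝ] ℝ).comp (LinearMap.toContinuousLinearMap p.linear)) y
          + p 0 j := by
      funext y
      have := congrFun p.decomp y
      simp only [Pi.add_apply] at this
      rw [this]
      simp
    rw [h2]
    exact (ContinuousLinearMap.hasFDerivAt _).add_const _
  rw [pderiv, h.fderiv]
  simp

lemma curl_elec (p : E3 →ᵃ[ℝ] E6) (x : E3) : curl (elec p) x =
    !₂[p.linear (EuclideanSpace.single 1 1) 2 - p.linear (EuclideanSpace.single 2 1) 1,
       p.linear (EuclideanSpace.single 2 1) 0 - p.linear (EuclideanSpace.single 0 1) 2,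
       p.linear (EuclideanSpace.single 0 1) 1 - p.linear (EuclideanSpace.single 1 1) 0] := by
  simp only [← pderiv_affine p _ _ x]
  rfl

lemma curl_magn (p : E3 →ᵃ[ℝ] E6) (x : E3) : curl (magn p) x =
    !₂[p.linear (EuclideanSpace.single 1 1) 5 - p.linear (EuclideanSpace.single 2 1) 4,
       p.linear (EuclideanSpace.single 2 1) 3 - p.linear (EuclideanSpace.single 0 1) 5,
       p.linear (EuclideanSpace.single 0 1) 4 - p.linear (EuclideanSpace.single 1 1) 3] := by
  simp only [← pderiv_affine p _ _ x]
  rfl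

lemma continuous_elec (p : E3 →ᵃ[ℝ] E6) : Continuous (elec p) := by
  have := p.continuous_of_finiteDimensional
  unfold elec
  fun_prop

lemma continuous_magn (p : E3 →ᵃ[ℝ] E6) : Continuous (magn p) := by
  have := p.continuous_of_finiteDimensional
  unfold magn
  fun_prop

lemma continuous_cross (n : E3) {f : E3 → E3} (hf : Continuous f) :
    Continuous fun x => cross n (f x) := by
  have h : ∀ v : E3, cross n v = !₂[n 1 * v 2 - n 2 * v 1, n 2 * v 0 - n 0 * v 2,
      n 0 * v 1 - n 1 * v 0] := fun v => by simp [cross, cross_apply]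
  simp only [h]
  fun_prop

lemma continuous_volTerm (p q : E3 →ᵃ[ℝ] E6) : Continuous (volTerm p q) := by
  have h1 := continuous_elec q
  have h2 := continuous_magn q
  unfold volTerm
  simp only [curl_elec, curl_magn]
  fun_prop

lemma continuous_intTerm (n : E3) (p p' q q' : E3 →ᵃ[ℝ] E6) :
    Continuous (intTerm n p p' q q') := by
  have a1 := continuous_elec p
  have a2 := continuous_elec p'
  have a3 := continuous_elec q
  have a4 := continuous_elec q'
  have b1 := continuous_magn p
  have b2 := continuous_magn p'
  have b3 := continuous_magn q
  have b4 := continuous_magn q'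
  have c1 := continuous_cross n (b2.sub b1)
  have c2 := continuous_cross n (a2.sub a1)
  have c3 := continuous_cross n (b4.sub b3)
  have c4 := continuous_cross n (a4.sub a3)
  unfold intTerm
  fun_prop

lemma continuous_extTerm (n : E3) (p q : E3 →ᵃ[ℝ] E6) : Continuous (extTerm n p q) := by
  have a1 := continuous_elec p
  have a3 := continuous_elec q
  have b3 := continuous_magn q
  have c1 := continuous_cross n a1
  have c2 := continuous_cross n a3
  unfold extTerm
  fun_prop

lemma volTerm_bilin (p r q : E3 →ᵃ[ℝ] E6) (c : ℝ) (x : E3) :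
    volTerm (c • p + r) q x = c * volTerm p q x + volTerm r q x ∧
    volTerm q (c • p + r) x = c * volTerm q p x + volTerm q r x := by
  constructor <;>
  · simp only [volTerm, curl_elec, curl_magn, PiLp.inner_apply, Fin.sum_univ_three]
    simp [elec, magn]
    ring

lemma intTerm_bilin (n : E3) (p p' r r' q q' : E3 →ᵃ[ℝ] E6) (c : ℝ) (x : E3) :
    intTerm n (c • p + r) (c • p' + r') q q' x =
      c * intTerm n p p' q q' x + intTerm n r r' q q' x ∧
    intTerm n q q' (c • p + r) (c • p' + r') x =
      c * intTerm n q q' p p' x + intTerm n q q' r r' x := by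
  constructor <;>
  · simp only [intTerm, cross, cross_apply, PiLp.inner_apply, Fin.sum_univ_three]
    simp [elec, magn]
    ring

lemma extTerm_bilin (n : E3) (p r q : E3 →ᵃ[ℝ] E6) (c : ℝ) (x : E3) :
    extTerm n (c • p + r) q x = c * extTerm n p q x + extTerm n r q x ∧
    extTerm n q (c • p + r) x = c * extTerm n q p x + extTerm n q r x := by
  constructor <;>
  · simp only [extTerm, cross, cross_apply, PiLp.inner_apply, Fin.sum_univ_three]
    simp [elec, magn]
    ring

lemma facet_area_lt_top (T : SimplicialMesh D) (i : Fin T.card) (k : Fin 4) :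
    (μHE[2] : Measure E3) (T.facet i k) < ⊤ := by
  set a : Fin 3 → E3 := T.vert i ∘ k.succAbove with ha
  let L : EuclideanSpace ℝ (Fin 2) →L[ℝ] E3 :=
    (EuclideanSpace.proj 0 : EuclideanSpace ℝ (Fin 2) →L[ℝ] ℝ).smulRight (a 1 - a 0)
      + (EuclideanSpace.proj 1 : EuclideanSpace ℝ (Fin 2) →L[ℝ] ℝ).smulRight (a 2 - a 0)
  let g : EuclideanSpace ℝ (Fin 2) →ᵃ[ℝ] E3 :=
    L.toLinearMap.toAffineMap + AffineMap.const ℝ _ (a 0)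
  have hg : ∀ y, g y = L y + a 0 := fun y => by simp [g]
  have hlip : LipschitzWith ‖L‖₊ g := by
    refine LipschitzWith.of_dist_le_mul fun y z => ?_
    rw [hg, hg, dist_add_right]
    exact L.lipschitz.dist_le_mul y z
  have hsub : T.facet i k ⊆ g '' Metric.closedBall 0 1 := by
    refine convexHull_min ?_ ((convex_closedBall _ _).affine_image g)
    rintro _ ⟨m, rfl⟩
    fin_cases m
    · exact ⟨0, by simp, by simp [hg, ha]⟩
    · exact ⟨EuclideanSpace.single 0 1, by simp, by simp [hg, L, ha]⟩
    · exact ⟨EuclideanSpace.single 1 1, by simp, by simp [hg, L, ha]⟩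
  have hfin : (μH[(2 : ℕ)] : Measure E3) (T.facet i k) < ⊤ := by
    refine (measure_mono hsub).trans_lt
      ((hlip.hausdorffMeasure_image_le (by simp) _).trans_lt ?_)
    refine ENNReal.mul_lt_top (ENNReal.rpow_lt_top_of_nonneg (by simp) (by simp)) ?_
    exact (isCompact_closedBall _ _).measure_lt_top
  rw [Measure.euclideanHausdorffMeasure_def]
  exact ENNReal.mul_lt_top ENNReal.coe_lt_top hfin

lemma isCompact_face (T : SimplicialMesh D) (i : Fin T.card) (k : Fin 4) (j : Fin T.card) :
    IsCompact (T.face i k j) :=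
  (isCompact_facet T i k).inter (isCompact_elem T j)

lemma integrableOn_of_compact {μ : Measure E3} {K : Set E3} (hK : IsCompact K) (hμ : μ K < ⊤)
    {f : E3 → ℝ} (hf : Continuous f) : IntegrableOn f K μ := by
  obtain ⟨C, hC⟩ := hK.exists_bound_of_continuousOn hf.continuousOn
  exact Measure.integrableOn_of_bounded hμ.ne hf.aestronglyMeasurable
    ((ae_restrict_iff' hK.measurableSet).2 (Eventually.of_forall hC))

lemma setIntegral_bilin {μ : Measure E3} {K : Set E3} (hK : IsCompact K) (hμ : μ K < ⊤) (c : ℝ)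
    {f g h : E3 → ℝ} (hf : Continuous f) (hg : Continuous g) (hh : ∀ x, h x = c * f x + g x) :
    ∫ x in K, h x ∂μ = c * ∫ x in K, f x ∂μ + ∫ x in K, g x ∂μ := by
  simp only [hh]
  rw [integral_add ((integrableOn_of_compact hK hμ hf).const_mul c)
    (integrableOn_of_compact hK hμ hg), integral_const_mul]

open scoped Classical in
/-- The bilinear form of the discrete Maxwell operator with upwind fluxes. -/
def dgForm (T : SimplicialMesh D) (u v : dgSpace T) : ℝ :=
  (∑ i, ∫ x in T.elem i, volTerm (trace T i u) (trace T i v) x)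
    + 1 / 2 * (∑ i, ∑ k, ∑ j, if T.IsIntFace i k j then
        ∫ x in T.face i k j, intTerm (T.normal i k) (trace T i u) (trace T j u)
          (trace T i v) (trace T j v) x ∂μHE[2] else 0)
    + ∑ i, ∑ k, if T.IsExtFace i k then
        ∫ x in T.facet i k, extTerm (T.normal i k) (trace T i u) (trace T i v) x ∂μHE[2] else 0


lemma ite_bilin (P : Prop) [Decidable P] (c x y z : ℝ) (h : z = c * x + y) :
    (if P then z else 0) = c * (if P then x else 0) + (if P then y else 0) := by
  split_ifs <;> simp [h]

lemma dgForm_bilin (T : SimplicialMesh D) (c : ℝ) (u v w : dgSpace T) :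
    dgForm T (c • u + v) w = c * dgForm T u w + dgForm T v w ∧
    dgForm T w (c • u + v) = c * dgForm T w u + dgForm T w v := by
  classical
  have hface : ∀ i k j, (μHE[2] : Measure E3) (T.face i k j) < ⊤ := fun i k j =>
    (measure_mono Set.inter_subset_left).trans_lt (facet_area_lt_top T i k)
  constructor
  · have h1 : ∀ i, ∫ x in T.elem i, volTerm (trace T i (c • u + v)) (trace T i w) x =
        c * (∫ x in T.elem i, volTerm (trace T i u) (trace T i w) x) +
          ∫ x in T.elem i, volTerm (trace T i v) (trace T i w) x := fun i =>
      setIntegral_bilin (isCompact_elem T i) (isCompact_elem T i).measure_lt_top c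
        (continuous_volTerm _ _) (continuous_volTerm _ _) fun x => by
          rw [map_add, map_smul]; exact (volTerm_bilin _ _ _ c x).1
    have h2 : ∀ i k j, ∫ x in T.face i k j, intTerm (T.normal i k) (trace T i (c • u + v))
          (trace T j (c • u + v)) (trace T i w) (trace T j w) x ∂μHE[2] =
        c * ∫ x in T.face i k j, intTerm (T.normal i k) (trace T i u)
          (trace T j u) (trace T i w) (trace T j w) x ∂μHE[2] +
        ∫ x in T.face i k j, intTerm (T.normal i k) (trace T i v)
          (trace T j v) (trace T i w) (trace T j w) x ∂μHE[2] := fun i k j =>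
      setIntegral_bilin (isCompact_face T i k j) (hface i k j) c
        (continuous_intTerm _ _ _ _ _) (continuous_intTerm _ _ _ _ _) fun x => by
          rw [map_add, map_smul, map_add, map_smul]
          exact (intTerm_bilin _ _ _ _ _ _ _ c x).1
    have h3 : ∀ i k, ∫ x in T.facet i k, extTerm (T.normal i k) (trace T i (c • u + v))
          (trace T i w) x ∂μHE[2] =
        c * ∫ x in T.facet i k, extTerm (T.normal i k) (trace T i u) (trace T i w) x ∂μHE[2] +
        ∫ x in T.facet i k, extTerm (T.normal i k) (trace T i v) (trace T i w) x ∂μHE[2] :=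
      fun i k => setIntegral_bilin (isCompact_facet T i k) (facet_area_lt_top T i k) c
        (continuous_extTerm _ _ _) (continuous_extTerm _ _ _) fun x => by
          rw [map_add, map_smul]; exact (extTerm_bilin _ _ _ _ c x).1
    unfold dgForm
    simp only [h1, fun i k j => ite_bilin (T.IsIntFace i k j) c _ _ _ (h2 i k j),
      fun i k => ite_bilin (T.IsExtFace i k) c _ _ _ (h3 i k), Finset.sum_add_distrib,
      ← Finset.mul_sum]
    ring
  · have h1 : ∀ i, ∫ x in T.elem i, volTerm (trace T i w) (trace T i (c • u + v)) x =
        c * (∫ x in T.elem i, volTerm (trace T i w) (trace T i u) x) +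
          ∫ x in T.elem i, volTerm (trace T i w) (trace T i v) x := fun i =>
      setIntegral_bilin (isCompact_elem T i) (isCompact_elem T i).measure_lt_top c
        (continuous_volTerm _ _) (continuous_volTerm _ _) fun x => by
          rw [map_add, map_smul]; exact (volTerm_bilin _ _ _ c x).2
    have h2 : ∀ i k j, ∫ x in T.face i k j, intTerm (T.normal i k) (trace T i w) (trace T j w)
          (trace T i (c • u + v)) (trace T j (c • u + v)) x ∂μHE[2] =
        c * ∫ x in T.face i k j, intTerm (T.normal i k) (trace T i w) (trace T j w)
          (trace T i u) (trace T j u) x ∂μHE[2] +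
        ∫ x in T.face i k j, intTerm (T.normal i k) (trace T i w) (trace T j w)
          (trace T i v) (trace T j v) x ∂μHE[2] := fun i k j =>
      setIntegral_bilin (isCompact_face T i k j) (hface i k j) c
        (continuous_intTerm _ _ _ _ _) (continuous_intTerm _ _ _ _ _) fun x => by
          rw [map_add, map_smul, map_add, map_smul]
          exact (intTerm_bilin _ _ _ _ _ _ _ c x).2
    have h3 : ∀ i k, ∫ x in T.facet i k, extTerm (T.normal i k) (trace T i w)
          (trace T i (c • u + v)) x ∂μHE[2] =
        c * ∫ x in T.facet i k, extTerm (T.normal i k) (trace T i w) (trace T i u) x ∂μHE[2] +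
        ∫ x in T.facet i k, extTerm (T.normal i k) (trace T i w) (trace T i v) x ∂μHE[2] :=
      fun i k => setIntegral_bilin (isCompact_facet T i k) (facet_area_lt_top T i k) c
        (continuous_extTerm _ _ _) (continuous_extTerm _ _ _) fun x => by
          rw [map_add, map_smul]; exact (extTerm_bilin _ _ _ _ c x).2
    unfold dgForm
    simp only [h1, fun i k j => ite_bilin (T.IsIntFace i k j) c _ _ _ (h2 i k j),
      fun i k => ite_bilin (T.IsExtFace i k) c _ _ _ (h3 i k), Finset.sum_add_distrib,
      ← Finset.mul_sum]
    ring

/-- `dgForm` as a bilinear map. -/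
def dgBilin (T : SimplicialMesh D) : dgSpace T →ₗ[ℝ] dgSpace T →ₗ[ℝ] ℝ :=
  LinearMap.mk₂ ℝ (dgForm T)
    (fun u v w => by simpa using (dgForm_bilin T 1 u v w).1)
    (fun c u w => by
      have h0 := (dgForm_bilin T 1 0 0 w).1
      have := (dgForm_bilin T c u 0 w).1
      simp only [smul_zero, add_zero, one_mul] at h0 this
      simp only [smul_eq_mul]
      linarith)
    (fun w u v => by simpa using (dgForm_bilin T 1 u v w).2)
    (fun c w u => by
      have h0 := (dgForm_bilin T 1 0 0 w).2
      have := (dgForm_bilin T c u 0 w).2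
      simp only [smul_zero, add_zero, one_mul] at h0 this
      simp only [smul_eq_mul]
      linarith)

/-- The discrete Maxwell operator `M_h : ℍ_h → ℍ_h`, given by `⟨M_h u, v⟩ = dgForm u v`. -/
def maxwell (T : SimplicialMesh D) : dgSpace T →ₗ[ℝ] dgSpace T where
  toFun u := (InnerProductSpace.toDual ℝ (dgSpace T)).symm
    (LinearMap.toContinuousLinearMap (dgBilin T u))
  map_add' u v := by simp
  map_smul' c u := by simp

lemma inner_maxwell (T : SimplicialMesh D) (u v : dgSpace T) :
    inner ℝ (maxwell T u) v = dgForm T u v := by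
  simp [maxwell, InnerProductSpace.toDual_symm_apply, dgBilin]

/-! ### The full discretization and its long-time behaviour -/

/-- `U` solves one step of the full discretization from `u`, with noise increments `w₁, w₂`. -/
def IsDGStep (T : SimplicialMesh D) (σ₀ lam1 : ℝ) (lam2 : E3) (dt : ℝ≥0) (w₁ w₂ : L2 D)
    (u U : dgSpace T) : Prop :=
  U - Real.exp (-σ₀ * dt) • u =
    ((dt : ℝ) / 2) • (maxwell T U + Real.exp (-σ₀ * dt) • maxwell T u)
      + (lam1 / 2) • proj T (mulJ T w₁ (U + Real.exp (-σ₀ * dt) • u))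
      + proj T (mulConst w₂ (dup lam2))

/-- `u` is a solution of the full discretization with initial value `u₀` (a random element of `ℍ`,
so that `u_h^0 = π_h u₀`): it is adapted and satisfies every step almost surely. The Brownian
motions `β (0, ·)` drive `W_1` and `β (1, ·)` drive `W_2`. -/
structure IsDGSolution {Ω : Type*} {mΩ : MeasurableSpace Ω} (P : Measure Ω)
    (ℱ : Filtration ℝ≥0 mΩ) (β : Fin 2 × ℕ → ℝ≥0 → Ω → ℝ)
    (q : HilbertBasis ℕ ℝ (L2 D)) (η : Fin 2 → ℕ → ℝ) (σ₀ lam1 : ℝ) (lam2 : E3) (b : ℝ)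
    (dt : ℝ≥0) (T : SimplicialMesh D) (u₀ : Ω → HH D) (u : ℕ → Ω → dgSpace T) : Prop where
  adapted : ∀ n : ℕ, Measurable[ℱ (n * dt)] (fun ω => (u n ω : HH D))
  init : ∀ᵐ ω ∂P, u 0 ω = proj T (u₀ ω)
  step : ∀ n : ℕ, ∀ᵐ ω ∂P, IsDGStep T σ₀ lam1 lam2 dt
    (truncIncr q (η 0) (fun k => β (0, k)) b dt n ω)
    (wiener q (η 1) (fun k => β (1, k)) ((n + 1 : ℕ) * dt) ω -
      wiener q (η 1) (fun k => β (1, k)) (n * dt) ω)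
    (u n ω) (u (n + 1) ω)

/-- The set of probability measures with finite second moment. -/
def P2 (X : Type*) [NormedAddCommGroup X] [MeasurableSpace X] : Set (Measure X) :=
  {μ | IsProbabilityMeasure μ ∧ ∫⁻ x, ‖x‖ₑ ^ 2 ∂μ < ⊤}

/-- The `L²`-Wasserstein distance. -/
def W2 {X : Type*} [PseudoEMetricSpace X] [MeasurableSpace X] (μ ν : Measure X) : ℝ≥0∞ :=
  (⨅ (γ : Measure (X × X)) (_ : γ.map Prod.fst = μ ∧ γ.map Prod.snd = ν),
    ∫⁻ z, edist z.1 z.2 ^ 2 ∂γ) ^ (1 / 2 : ℝ)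

section Ergodic

variable {X : Type*} [NormedAddCommGroup X] [MeasurableSpace X]

/-- `π` is invariant: `∫ P_n φ dπ = ∫ φ dπ` for all bounded Borel `φ` and all `n`. -/
def IsInvariantMeasure (P : ℕ → Kernel X X) (π : Measure X) : Prop :=
  ∀ φ : X → ℝ, Measurable φ → (∃ C, ∀ x, |φ x| ≤ C) →
    ∀ n, ∫ x, (∫ y, φ y ∂(P n x)) ∂π = ∫ x, φ x ∂π

/-- Ergodicity: for all `φ ∈ L²(π)`, the time averages of `P_n φ` converge to `π(φ)` in `L²(π)`. -/
def IsErgodicFor (P : ℕ → Kernel X X) (π : Measure X) : Prop :=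
  ∀ φ : X → ℝ, MemLp φ 2 π →
    (∀ n, ∀ᵐ x ∂π, Integrable φ (P n x)) ∧
    Tendsto (fun N : ℕ => eLpNorm (fun x =>
      (N : ℝ)⁻¹ * (∑ n ∈ Finset.range N, ∫ y, φ y ∂(P n x)) - (∫ y, φ y ∂π)) 2 π) atTop (𝓝 0)

/-- Exponential mixing, with `t_n = n Δt`. -/
def IsExpMixing (P : ℕ → Kernel X X) (π : Measure X) (dt : ℝ≥0) : Prop :=
  ∃ ρ : ℝ, 0 < ρ ∧ ∃ C : X → ℝ, (∀ x, 0 < C x) ∧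
    ∀ (φ : X → ℝ) (L : ℝ≥0), LipschitzWith L φ → (∃ B, ∀ x, |φ x| ≤ B) →
      ∀ (n : ℕ) (x : X),
        |(∫ y, φ y ∂(P n x)) - (∫ y, φ y ∂π)| ≤ C x * L * Real.exp (-ρ * (n * dt))

end Ergodic

end StochMaxwell

end

open MeasureTheory ProbabilityTheory StochMaxwell
open scoped ENNReal NNReal

noncomputable section

namespace StochMaxwell

/-! ### Contractive random iterations -/

section Iteration

variable {W : Type*} [MeasurableSpace W]

/-! The scheme is a random recursion that contracts along every noise path. Put `A = (Δt/2) M_h +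
(λ₁/2) π_h (w J ·)`, where `w` is the truncated increment, and `e = exp(-σ₀ Δt)`. One step reads `U
- e u = A (U + e u) + c`, with `c` the additive noise. For every `w` the operator `A` is
dissipative, `⟨A u, u⟩ ≤ 0`: the noise part contributes nothing because `J` is skew at each point,
and `M_h` is dissipative. Hence `1 - A` is injective, so invertible on the finite-dimensional space
`ℍ_h`, and the step is uniquely solvable. For two solutions with the same noise `c` cancels, and
pairing `d - z = A (d + z)` with `d + z` gives `‖d‖ ≤ ‖z‖ = e ‖u - v‖` (`norm_le_of_midpoint`). This
is the exact rate in the Wasserstein bound.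

Dissipativity of `M_h` (`dgForm_self_nonpos`) is a discrete Poynting theorem. Since `div (E × H) = H
· curl E - E · curl H`, the divergence theorem turns the volume term into minus the flux of `E × H`
out of each element. The centred face terms compensate these fluxes, and the remaining upwind and
exterior terms are minus squares of tangential jumps and traces. With hanging nodes the facets of
neighbours need not match one to one, so the cancellation is proved for each pair of elements, by
means of a separating plane (`sum_flux_face_comm`).

The long-time statements hold for any iteration `x ↦ S w x` with i.i.d. noise, contraction factor `κ
< 1` and `S w 0` square integrable. A stationary solution is a fixed point of `Y ↦ S (w 0) (Y
(seqShift w))` in `L²` of the noise sequences, and its law is invariant (`exists_invariant`).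
Driving two initial values by the same noise gives mixing, weak convergence, uniqueness and the
bound in `W2`. Convergence in `L²(π)` follows by density of bounded continuous functions, because
the semigroup is a contraction there; ergodicity is its Cesàro consequence.

The moment condition needs only that `Q₂` is of trace class, which the Sobolev assumption implies.
Finally `IsDGSolution.map_eq` identifies the laws of solutions with the abstract semigroup: the
increments of a step are independent of the past. -/

lemma prod_map_right {α β γ : Type*} [MeasurableSpace α] [MeasurableSpace β] [MeasurableSpace γ]
    (μ : Measure α) [SFinite μ] (m : Measure β) [SFinite m] {f : β → γ} (hf : Measurable f) :
    μ.prod (m.map f) = (μ.prod m).map (Prod.map id f) := by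
  simpa using Measure.map_prod_map μ m measurable_id hf

/-- The shift on sequences. -/
def seqShift (w : ℕ → W) : ℕ → W := fun n => w (n + 1)

/-- Prepend an element to a sequence. -/
def seqCons (z : W × (ℕ → W)) : ℕ → W := fun n => Nat.casesOn n z.1 z.2

lemma measurable_seqShift : Measurable (seqShift : (ℕ → W) → ℕ → W) :=
  measurable_pi_lambda _ fun _ => measurable_pi_apply _

lemma measurable_seqCons : Measurable (seqCons : W × (ℕ → W) → ℕ → W) := by
  refine measurable_pi_lambda _ fun n => ?_
  cases n with
  | zero => exact measurable_fst
  | succ n => exact (measurable_pi_apply n).comp measurable_snd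

variable (ν : Measure W) [IsProbabilityMeasure ν]

/-- The law of an i.i.d. sequence. -/
abbrev iidSeq : Measure (ℕ → W) := Measure.infinitePi fun _ : ℕ => ν

/-- An infinite product measure is determined by finite cylinders. This form of "the first entry is
independent of an i.i.d. tail" is what yields the Markov recursion. -/
lemma map_seqCons : (ν.prod (iidSeq ν)).map seqCons = iidSeq ν := by
  refine Measure.eq_infinitePi _ fun s t ht => ?_
  rw [Measure.map_apply measurable_seqCons (.pi s.countable_toSet fun i _ => ht i)]
  classical
  set s' : Finset ℕ := s.preimage Nat.succ Nat.succ_injective.injOn with hs'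
  -- A cylinder pulls back to a rectangle; it restricts the head only if the index 0 belongs to `s`.
  have h1 : seqCons ⁻¹' (Set.pi s t) =
      (if 0 ∈ s then t 0 else Set.univ) ×ˢ (Set.pi s' fun i => t (i + 1)) := by
    ext ⟨a, w⟩
    simp only [Set.mem_preimage, Set.mem_pi, Finset.mem_coe, Set.mem_prod, hs', Finset.mem_preimage]
    constructor
    · intro h
      refine ⟨?_, fun i hi => h (i + 1) hi⟩
      split_ifs with h0
      · exact h 0 h0
      · trivial
    · rintro ⟨h0, h1⟩ i hi
      cases i with
      | zero => rwa [if_pos hi] at h0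
      | succ i => exact h1 i hi
  rw [h1, Measure.prod_prod, Measure.infinitePi_pi _ (fun i _ => ht _)]
  have h2 : ∏ i ∈ s', ν (t (i + 1)) = ∏ i ∈ s.erase 0, ν (t i) := by
    refine Finset.prod_bij (fun i _ => i + 1) ?_ ?_ ?_ ?_
    · intro i hi; simpa [hs'] using hi
    · intro i _ j _ h; simpa using h
    · intro j hj
      rw [Finset.mem_erase] at hj
      obtain ⟨k, rfl⟩ := Nat.exists_eq_succ_of_ne_zero hj.1
      exact ⟨k, by simpa [hs'] using hj.2, rfl⟩
    · intro i _; rfl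
  rw [h2]
  split_ifs with h0
  · exact Finset.mul_prod_erase s (fun i => ν (t i)) h0
  · rw [measure_univ, one_mul, Finset.erase_eq_of_notMem h0]

lemma measurePreserving_seqShift : MeasurePreserving seqShift (iidSeq ν) (iidSeq ν) :=
  ⟨measurable_seqShift, Measure.map_infinitePi_infinitePi_of_inj (f := Nat.succ)
    (P := fun _ : ℕ => ν) Nat.succ_injective⟩

variable {X : Type*} [NormedAddCommGroup X] [MeasurableSpace X]

/-- A random Lipschitz iteration `x ↦ S w x` with contraction constant `κ < 1`, taking values in the
range of the 1-Lipschitz retraction `p`. -/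
structure IsContractiveIteration (ν : Measure W) (κ : ℝ≥0) (p : X → X) (S : W → X → X) : Prop where
  lt_one : κ < 1
  measurable : Measurable (Function.uncurry S)
  lipschitz : ∀ w, LipschitzWith κ (S w)
  moment : ∫⁻ w, ‖S w 0‖ₑ ^ 2 ∂ν < ⊤
  lipschitz_proj : LipschitzWith 1 p
  proj_step : ∀ w x, p (S w x) = S w x

/-- The `n`-fold iteration, started from `p x`, with the last step driven by `w 0`. -/
def iterFlow (p : X → X) (S : W → X → X) : ℕ → (ℕ → W) → X → X
  | 0, _, x => p x
  | n + 1, w, x => S (w 0) (iterFlow p S n (seqShift w) x)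

variable {ν : Measure W} {κ : ℝ≥0} {p : X → X} {S : W → X → X}

namespace IsContractiveIteration

lemma lipschitz_iterFlow (h : IsContractiveIteration ν κ p S) (n : ℕ) (w : ℕ → W) :
    LipschitzWith (κ ^ n) (iterFlow p S n w) := by
  induction n generalizing w with
  | zero => rw [pow_zero]; exact h.lipschitz_proj
  | succ n ih =>
    rw [pow_succ']
    exact (h.lipschitz (w 0)).comp (ih _)

lemma measurable_step_left (h : IsContractiveIteration ν κ p S) (x : X) :
    Measurable fun w => S w x :=
  h.measurable.comp (measurable_id.prodMk measurable_const)

/-- The entry `w 0` is independent of the shifted sequence. `Y` is only a.e. measurable because it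
will be an `L²` class; replacing it by a measurable version is harmless after the shift, which
preserves the measure. -/
lemma map_step [IsProbabilityMeasure ν] (h : IsContractiveIteration ν κ p S) {Y : (ℕ → W) → X}
    (hY : AEMeasurable Y (iidSeq ν)) :
    (iidSeq ν).map (fun w => S (w 0) (Y (seqShift w))) =
      (ν.prod ((iidSeq ν).map Y)).map (Function.uncurry S) := by
  obtain ⟨Z, hZ, hYZ⟩ := hY
  have h1 : (fun w => S (w 0) (Y (seqShift w))) =ᵐ[iidSeq ν]
      fun w => S (w 0) (Z (seqShift w)) := by
    filter_upwards [(measurePreserving_seqShift ν).quasiMeasurePreserving.ae hYZ] with w hw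
    rw [hw]
  rw [Measure.map_congr h1, Measure.map_congr hYZ]
  have h3 : Measurable fun w : ℕ → W => S (w 0) (Z (seqShift w)) :=
    h.measurable.comp ((measurable_pi_apply 0).prodMk (hZ.comp measurable_seqShift))
  conv_lhs => rw [← map_seqCons ν]
  rw [prod_map_right _ _ hZ, Measure.map_map h.measurable (measurable_id.prodMap hZ),
    Measure.map_map h3 measurable_seqCons]
  rfl

variable [BorelSpace X]

lemma measurable_iterFlow (h : IsContractiveIteration ν κ p S) (n : ℕ) :
    Measurable (Function.uncurry (iterFlow p S n)) := by
  induction n with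
  | zero => exact h.lipschitz_proj.continuous.measurable.comp measurable_snd
  | succ n ih =>
    exact h.measurable.comp (((measurable_pi_apply 0).comp measurable_fst).prodMk
      (ih.comp ((measurable_seqShift.comp measurable_fst).prodMk measurable_snd)))

lemma measurable_iterFlow_left (h : IsContractiveIteration ν κ p S) (n : ℕ) (x : X) :
    Measurable fun w => iterFlow p S n w x :=
  (h.measurable_iterFlow n).comp (measurable_id.prodMk measurable_const)

variable [IsProbabilityMeasure ν]

/-- The transition semigroup of the iteration: the law of the `n`-th iterate. -/
def semigroup (h : IsContractiveIteration ν κ p S) (n : ℕ) : Kernel X X where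
  toFun x := (iidSeq ν).map fun w => iterFlow p S n w x
  measurable' := by
    refine Measure.measurable_of_measurable_coe _ fun s hs => ?_
    simp_rw [Measure.map_apply (h.measurable_iterFlow_left n _) hs]
    exact measurable_measure_prodMk_right (h.measurable_iterFlow n hs)

lemma semigroup_apply (h : IsContractiveIteration ν κ p S) (n : ℕ) (x : X) :
    h.semigroup n x = (iidSeq ν).map fun w => iterFlow p S n w x := rfl

instance (h : IsContractiveIteration ν κ p S) (n : ℕ) : IsMarkovKernel (h.semigroup n) :=
  ⟨fun x => Measure.isProbabilityMeasure_map (h.measurable_iterFlow_left n x).aemeasurable⟩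

/-- Fubini: sampling the initial value and the noise independently and applying the flow gives the
law at time `n`. -/
lemma bind_semigroup (h : IsContractiveIteration ν κ p S) (n : ℕ) (μ : Measure X) [SFinite μ] :
    μ.bind (h.semigroup n) = ((iidSeq ν).prod μ).map (Function.uncurry (iterFlow p S n)) := by
  ext s hs
  rw [Measure.bind_apply hs (h.semigroup n).aemeasurable,
    Measure.map_apply (h.measurable_iterFlow n) hs,
    Measure.prod_apply_symm (h.measurable_iterFlow n hs)]
  refine lintegral_congr fun x => ?_
  rw [semigroup_apply, Measure.map_apply (h.measurable_iterFlow_left n _) hs]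
  rfl

lemma bind_semigroup_zero (h : IsContractiveIteration ν κ p S) (μ : Measure X) [SFinite μ] :
    μ.bind (h.semigroup 0) = μ.map p := by
  rw [h.bind_semigroup]
  have : Function.uncurry (iterFlow p S 0) = p ∘ (Prod.snd : (ℕ → W) × X → X) := rfl
  rw [this, ← Measure.map_map h.lipschitz_proj.continuous.measurable measurable_snd,
    Measure.map_snd_prod, measure_univ, one_smul]

/-- The Markov property in one-step form. As `w 0` drives the last step, splitting off the head of
the sequence separates the newest noise from the state at time `n`. -/
lemma bind_semigroup_succ (h : IsContractiveIteration ν κ p S) (n : ℕ) (μ : Measure X)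
    [SFinite μ] :
    μ.bind (h.semigroup (n + 1)) =
      (ν.prod (μ.bind (h.semigroup n))).map (Function.uncurry S) := by
  rw [h.bind_semigroup, h.bind_semigroup]
  conv_lhs => rw [← map_seqCons ν]
  have h1 : (((ν.prod (iidSeq ν)).map seqCons).prod μ) =
      ((ν.prod (iidSeq ν)).prod μ).map (Prod.map seqCons id) := by
    conv_lhs => rw [← Measure.map_id (μ := μ)]
    rw [Measure.map_prod_map _ _ measurable_seqCons measurable_id]
  have h2 : ν.prod (((iidSeq ν).prod μ).map (Function.uncurry (iterFlow p S n))) =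
      (ν.prod ((iidSeq ν).prod μ)).map
        (Prod.map id (Function.uncurry (iterFlow p S n))) :=
    prod_map_right _ _ (h.measurable_iterFlow n)
  rw [h1, h2, ← Measure.prodAssoc_prod,
    Measure.map_map (h.measurable_iterFlow _) (measurable_seqCons.prodMap measurable_id),
    Measure.map_map (measurable_id.prodMap (h.measurable_iterFlow n)) (by fun_prop),
    Measure.map_map h.measurable
      ((measurable_id.prodMap (h.measurable_iterFlow n)).comp (by fun_prop))]
  rfl

lemma integral_semigroup (h : IsContractiveIteration ν κ p S) (n : ℕ) (x : X) {φ : X → ℝ}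
    (hφ : StronglyMeasurable φ) :
    ∫ y, φ y ∂(h.semigroup n x) = ∫ w, φ (iterFlow p S n w x) ∂(iidSeq ν) := by
  rw [semigroup_apply, integral_map (h.measurable_iterFlow_left n x).aemeasurable
    hφ.aestronglyMeasurable]

/-! #### Existence of an invariant law -/

variable [SecondCountableTopology X]

/-- The Lipschitz property gives `‖S w y‖ ≤ κ ‖y‖ + ‖S w 0‖`, and both terms are square integrable.
-/
lemma memLp_step (h : IsContractiveIteration ν κ p S) {Y : (ℕ → W) → X}
    (hY : MemLp Y 2 (iidSeq ν)) :
    MemLp (fun w => S (w 0) (Y (seqShift w))) 2 (iidSeq ν) := by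
  have hYs : MemLp (fun w => Y (seqShift w)) 2 (iidSeq ν) :=
    hY.comp_measurePreserving (measurePreserving_seqShift ν)
  have h0 : MemLp (fun w => S w 0) 2 ν := by
    refine ⟨(h.measurable_step_left 0).aestronglyMeasurable, ?_⟩
    rw [eLpNorm_lt_top_iff_lintegral_rpow_enorm_lt_top (by simp) (by simp)]
    simpa using h.moment
  have h0' : MemLp (fun w : ℕ → W => S (w 0) 0) 2 (iidSeq ν) :=
    h0.comp_measurePreserving (measurePreserving_eval_infinitePi (fun _ : ℕ => ν) 0)
  have hm : AEStronglyMeasurable (fun w => S (w 0) (Y (seqShift w))) (iidSeq ν) :=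
    (h.measurable.comp_aemeasurable ((measurable_pi_apply 0).aemeasurable.prodMk
      hYs.1.aemeasurable)).aestronglyMeasurable
  refine ((hYs.norm.const_mul (κ : ℝ)).add h0'.norm).mono hm (ae_of_all _ fun w => ?_)
  have h1 := (h.lipschitz (w 0)).norm_sub_le (Y (seqShift w)) 0
  rw [sub_zero] at h1
  calc ‖S (w 0) (Y (seqShift w))‖ ≤ κ * ‖Y (seqShift w)‖ + ‖S (w 0) 0‖ := by
        have := norm_le_norm_sub_add (S (w 0) (Y (seqShift w))) (S (w 0) 0)
        linarith
    _ ≤ _ := le_abs_self _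

/-- The fixed point equation of the stationary solution, as a self-map of `L²`. -/
def stationaryMap (h : IsContractiveIteration ν κ p S) (Y : Lp X 2 (iidSeq ν)) :
    Lp X 2 (iidSeq ν) :=
  (h.memLp_step (Lp.memLp Y)).toLp _

/-- The shift does not change `L²` norms, so the factor `κ` of a single step survives. -/
lemma contracting_stationaryMap (h : IsContractiveIteration ν κ p S) :
    ContractingWith κ h.stationaryMap := by
  refine ⟨h.lt_one, fun Y Z => ?_⟩
  rw [stationaryMap, stationaryMap, Lp.edist_toLp_toLp, Lp.edist_def]
  have hc : eLpNorm (⇑Y - ⇑Z) 2 (iidSeq ν) =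
      eLpNorm ((⇑Y - ⇑Z) ∘ seqShift) 2 (iidSeq ν) :=
    (eLpNorm_comp_measurePreserving ((Lp.aestronglyMeasurable Y).sub (Lp.aestronglyMeasurable Z))
      (measurePreserving_seqShift ν)).symm
  rw [hc]
  refine eLpNorm_le_nnreal_smul_eLpNorm_of_ae_le_mul (ae_of_all _ fun w => ?_) 2
  exact_mod_cast (h.lipschitz (w 0)).norm_sub_le (Y (seqShift w)) (Z (seqShift w))

variable [CompleteSpace X]

/-- By Banach's theorem there is a stationary solution `Y`, driven by the whole noise sequence. Its
law reproduces itself under one step, since `Y (seqShift w)` has the law of `Y` and is independent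
of `w 0`. -/
lemma exists_invariant (h : IsContractiveIteration ν κ p S) :
    ∃ π : Measure X, π ∈ P2 X ∧ ∀ n, π.bind (h.semigroup n) = π := by
  obtain ⟨Y, hY, -⟩ := h.contracting_stationaryMap.exists_fixedPoint 0 (edist_ne_top _ _)
  have hae : (Y : (ℕ → W) → X) =ᵐ[iidSeq ν] fun w => S (w 0) (Y (seqShift w)) := by
    have := (h.memLp_step (Lp.memLp Y)).coeFn_toLp
    have hfix : (h.memLp_step (Lp.memLp Y)).toLp _ = Y := hY
    rwa [hfix] at this
  have hYm : AEMeasurable Y (iidSeq ν) := (Lp.aestronglyMeasurable Y).aemeasurable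
  have hprob : IsProbabilityMeasure ((iidSeq ν).map Y) := Measure.isProbabilityMeasure_map hYm
  refine ⟨(iidSeq ν).map Y, ⟨hprob, ?_⟩, ?_⟩
  · rw [lintegral_map' (by fun_prop) hYm]
    have := (Lp.memLp Y).2
    rw [eLpNorm_lt_top_iff_lintegral_rpow_enorm_lt_top (by simp) (by simp)] at this
    simpa using this
  intro n
  induction n with
  | zero =>
    -- The kernel at time 0 is the pushforward by `p` and not the identity. It fixes the law of `Y`
    -- because a.e. value of `Y` is a value of `S`.
    rw [h.bind_semigroup_zero, AEMeasurable.map_map_of_aemeasurable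
      h.lipschitz_proj.continuous.measurable.aemeasurable hYm]
    refine Measure.map_congr ?_
    filter_upwards [hae] with w hw
    rw [Function.comp_apply, hw]
    exact h.proj_step _ _
  | succ n ih =>
    rw [h.bind_semigroup_succ, ih, ← h.map_step hYm]
    exact Measure.map_congr hae.symm

end IsContractiveIteration

end Iteration

/-! ### Consequences of contraction: uniqueness, mixing and the Wasserstein bound -/

lemma integrable_of_bounded {X : Type*} [MeasurableSpace X] {μ : Measure X} [IsFiniteMeasure μ]
    {φ : X → ℝ} (hφ : StronglyMeasurable φ) {C : ℝ} (hC : ∀ x, |φ x| ≤ C) : Integrable φ μ :=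
  Integrable.of_bound hφ.aestronglyMeasurable C (ae_of_all _ hC)

lemma abs_integral_le_of_bounded {X : Type*} [MeasurableSpace X] {μ : Measure X}
    [IsProbabilityMeasure μ] {φ : X → ℝ} {C : ℝ} (hC : ∀ x, |φ x| ≤ C) : |∫ x, φ x ∂μ| ≤ C := by
  have := norm_integral_le_of_norm_le_const (μ := μ) (f := φ) (ae_of_all _ hC)
  simpa using this

lemma bounded_of_dist_le {X : Type*} {f : X → ℝ} {C : ℝ} (hC : ∀ x y, dist (f x) (f y) ≤ C)
    (x₀ x : X) : |f x| ≤ |f x₀| + C := by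
  have h1 : |f x - f x₀| ≤ C := hC x x₀
  have h2 := abs_sub_abs_le_abs_sub (f x) (f x₀)
  linarith

namespace IsContractiveIteration

variable {W : Type*} [MeasurableSpace W] {ν : Measure W} [IsProbabilityMeasure ν]
  {X : Type*} [NormedAddCommGroup X] [MeasurableSpace X] [BorelSpace X]
  {κ : ℝ≥0} {p : X → X} {S : W → X → X}

lemma stronglyMeasurable_semigroup (h : IsContractiveIteration ν κ p S) (n : ℕ) {φ : X → ℝ}
    (hφ : StronglyMeasurable φ) :
    StronglyMeasurable fun x => ∫ y, φ y ∂(h.semigroup n x) :=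
  hφ.integral_kernel

lemma integral_bind_semigroup (h : IsContractiveIteration ν κ p S) (n : ℕ) (μ : Measure X)
    [SFinite μ] {φ : X → ℝ} (hφ : StronglyMeasurable φ)
    (hi : Integrable φ (μ.bind (h.semigroup n))) :
    ∫ x, (∫ y, φ y ∂(h.semigroup n x)) ∂μ = ∫ y, φ y ∂(μ.bind (h.semigroup n)) := by
  have hm := h.measurable_iterFlow n
  rw [h.bind_semigroup] at hi ⊢
  rw [integrable_map_measure hφ.aestronglyMeasurable hm.aemeasurable] at hi
  rw [integral_map hm.aemeasurable hφ.aestronglyMeasurable]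
  have := integral_prod_symm _ hi
  simp only [Function.comp_apply, Function.uncurry_apply_pair] at this
  simp_rw [h.integral_semigroup n _ hφ]
  rw [← this]

lemma isInvariant_of_bind_eq (h : IsContractiveIteration ν κ p S) {π : Measure X}
    [IsProbabilityMeasure π] (hπ : ∀ n, π.bind (h.semigroup n) = π) :
    IsInvariantMeasure h.semigroup π := by
  rintro φ hφ ⟨C, hC⟩ n
  rw [h.integral_bind_semigroup n π hφ.stronglyMeasurable
    (by rw [hπ]; exact integrable_of_bounded hφ.stronglyMeasurable hC), hπ]

/-- Synchronous coupling: both trajectories use the same noise, so they approach each other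
pathwise. -/
lemma abs_sub_semigroup_le (h : IsContractiveIteration ν κ p S) (n : ℕ) (x y : X) {φ : X → ℝ}
    {L : ℝ≥0} (hL : LipschitzWith L φ) (hφ : StronglyMeasurable φ) {C : ℝ}
    (hC : ∀ x, |φ x| ≤ C) :
    |(∫ z, φ z ∂(h.semigroup n x)) - ∫ z, φ z ∂(h.semigroup n y)| ≤ L * κ ^ n * ‖x - y‖ := by
  have hi : ∀ x, Integrable (fun w => φ (iterFlow p S n w x)) (iidSeq ν) := fun x =>
    Integrable.of_bound (hφ.comp_measurable (h.measurable_iterFlow_left n x)).aestronglyMeasurable C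
      (ae_of_all _ fun w => hC _)
  rw [h.integral_semigroup n x hφ, h.integral_semigroup n y hφ, ← integral_sub (hi x) (hi y)]
  have := norm_integral_le_of_norm_le_const (μ := iidSeq ν) (C := L * κ ^ n * ‖x - y‖)
    (f := fun w => φ (iterFlow p S n w x) - φ (iterFlow p S n w y)) (ae_of_all _ fun w => by
      have h1 := (hL.comp (h.lipschitz_iterFlow n w)).norm_sub_le x y
      simpa using h1)
  simpa using this

lemma integrable_norm_of_mem_P2 {π : Measure X} (hπ : π ∈ P2 X) [SecondCountableTopology X] :
    Integrable (fun x => ‖x‖) π := by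
  have := hπ.1
  have h2 : MemLp (id : X → X) 2 π := by
    refine ⟨measurable_id.aestronglyMeasurable, ?_⟩
    rw [eLpNorm_lt_top_iff_lintegral_rpow_enorm_lt_top (by simp) (by simp)]
    simpa using hπ.2
  exact (h2.integrable (by norm_num)).norm

/-- Invariance gives `∫∫ |φ|² dP_n(x,·) dπ(x) = ∫ |φ|² dπ < ∞`, hence finiteness of the inner
integral for a.e. `x`. A measurable version of `φ` agrees with it `P_n(x,·)`-a.e. for `π`-a.e. `x`,
again by invariance. -/
lemma ae_memLp_semigroup (h : IsContractiveIteration ν κ p S) {π : Measure X}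
    (hπ : ∀ n, π.bind (h.semigroup n) = π) (n : ℕ) {φ : X → ℝ} (hφ : MemLp φ 2 π) :
    ∀ᵐ x ∂π, MemLp φ 2 (h.semigroup n x) := by
  have h1 : ∫⁻ x, ∫⁻ y, ‖φ y‖ₑ ^ (2 : ℝ) ∂(h.semigroup n x) ∂π < ⊤ := by
    rw [← Measure.lintegral_bind (h.semigroup n).aemeasurable
      (by rw [hπ]; exact hφ.1.enorm.pow_const _), hπ]
    have := hφ.2
    rw [eLpNorm_lt_top_iff_lintegral_rpow_enorm_lt_top (by simp) (by simp)] at this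
    simpa using this
  have hme : ∀ᵐ x ∂π, ∀ᵐ y ∂(h.semigroup n x), φ y = hφ.1.mk φ y :=
    Measure.ae_ae_of_ae_bind (h.semigroup n).aemeasurable (by rw [hπ]; exact hφ.1.ae_eq_mk)
  have hms : StronglyMeasurable (hφ.1.mk φ) := hφ.1.stronglyMeasurable_mk
  have hae : (fun x => ∫⁻ y, ‖φ y‖ₑ ^ (2 : ℝ) ∂(h.semigroup n x)) =ᵐ[π]
      fun x => ∫⁻ y, ‖hφ.1.mk φ y‖ₑ ^ (2 : ℝ) ∂(h.semigroup n x) := by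
    filter_upwards [hme] with x hx
    refine lintegral_congr_ae ?_
    filter_upwards [hx] with y hy
    rw [hy]
  have hmeas : AEMeasurable (fun x => ∫⁻ y, ‖φ y‖ₑ ^ (2 : ℝ) ∂(h.semigroup n x)) π :=
    ((hms.enorm.pow_const _).lintegral_kernel.aemeasurable).congr hae.symm
  filter_upwards [hme, ae_lt_top' hmeas h1.ne] with x hx hx2
  refine ⟨⟨_, hms, hx⟩, ?_⟩
  rw [eLpNorm_lt_top_iff_lintegral_rpow_enorm_lt_top (by simp) (by simp)]
  simpa using hx2

lemma aestronglyMeasurable_semigroup (h : IsContractiveIteration ν κ p S) {π : Measure X}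
    (hπ : ∀ n, π.bind (h.semigroup n) = π) (n : ℕ) {φ : X → ℝ} (hφ : AEStronglyMeasurable φ π) :
    AEStronglyMeasurable (fun x => ∫ y, φ y ∂(h.semigroup n x)) π := by
  refine ⟨fun x => ∫ y, hφ.mk φ y ∂(h.semigroup n x),
    h.stronglyMeasurable_semigroup n hφ.stronglyMeasurable_mk, ?_⟩
  have : ∀ᵐ x ∂π, ∀ᵐ y ∂(h.semigroup n x), φ y = hφ.mk φ y :=
    Measure.ae_ae_of_ae_bind (h.semigroup n).aemeasurable (by rw [hπ]; exact hφ.ae_eq_mk)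
  filter_upwards [this] with x hx
  exact integral_congr_ae hx

/-- Jensen's inequality for the probability measure `P_n(x,·)`, in the form that the `L¹` norm is at
most the `L²` norm, followed by integration against the invariant measure. -/
lemma eLpNorm_semigroup_le (h : IsContractiveIteration ν κ p S) {π : Measure X}
    (hπ : ∀ n, π.bind (h.semigroup n) = π) (n : ℕ) {φ : X → ℝ} (hφ : MemLp φ 2 π) :
    eLpNorm (fun x => ∫ y, φ y ∂(h.semigroup n x)) 2 π ≤ eLpNorm φ 2 π := by
  rw [eLpNorm_eq_lintegral_rpow_enorm_toReal (by simp) (by simp),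
    eLpNorm_eq_lintegral_rpow_enorm_toReal (by simp) (by simp)]
  refine ENNReal.rpow_le_rpow ?_ (by simp)
  conv_rhs => rw [← hπ n]
  rw [Measure.lintegral_bind (h.semigroup n).aemeasurable
      (by rw [hπ]; exact hφ.1.enorm.pow_const _)]
  refine lintegral_mono_ae ?_
  filter_upwards [h.ae_memLp_semigroup hπ n hφ] with x hx
  have h1 : ‖∫ y, φ y ∂(h.semigroup n x)‖ₑ ≤ eLpNorm φ 2 (h.semigroup n x) :=
    (enorm_integral_le_lintegral_enorm _).trans (by
      rw [← eLpNorm_one_eq_lintegral_enorm]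
      exact eLpNorm_le_eLpNorm_of_exponent_le (by norm_num) hx.1)
  rw [eLpNorm_eq_lintegral_rpow_enorm_toReal (by simp) (by simp)] at h1
  refine (ENNReal.rpow_le_rpow h1 (by simp)).trans ?_
  rw [← ENNReal.rpow_mul]
  simp

variable [SecondCountableTopology X]

/-- By invariance `π(φ)` is the `π`-average over `y` of `P_n φ(y)`; the coupling estimate is then
averaged over `y`, which uses the finite first moment of `π`. -/
lemma abs_semigroup_sub_le (h : IsContractiveIteration ν κ p S) {π : Measure X} (hP : π ∈ P2 X)
    (hπ : ∀ n, π.bind (h.semigroup n) = π) (n : ℕ) (x : X) {φ : X → ℝ}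
    {L : ℝ≥0} (hL : LipschitzWith L φ) {B : ℝ} (hB : ∀ x, |φ x| ≤ B) :
    |(∫ z, φ z ∂(h.semigroup n x)) - ∫ z, φ z ∂π| ≤ (‖x‖ + ∫ y, ‖y‖ ∂π) * L * κ ^ n := by
  have := hP.1
  have hφ : StronglyMeasurable φ := hL.continuous.measurable.stronglyMeasurable
  have hin := integrable_norm_of_mem_P2 hP
  have h1 : ∫ z, φ z ∂π = ∫ y, (∫ z, φ z ∂(h.semigroup n y)) ∂π := by
    rw [h.integral_bind_semigroup n π hφ (by rw [hπ]; exact integrable_of_bounded hφ hB), hπ]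
  have hi2 : Integrable (fun y => ∫ z, φ z ∂(h.semigroup n y)) π := by
    refine integrable_of_bounded (h.stronglyMeasurable_semigroup n hφ) (C := B) fun y => ?_
    exact abs_integral_le_of_bounded hB
  have h2 : (∫ z, φ z ∂(h.semigroup n x)) - ∫ z, φ z ∂π =
      ∫ y, ((∫ z, φ z ∂(h.semigroup n x)) - ∫ z, φ z ∂(h.semigroup n y)) ∂π := by
    rw [integral_sub (integrable_const _) hi2, h1]; simp
  rw [h2]
  rw [← Real.norm_eq_abs]
  refine (norm_integral_le_of_norm_le (g := fun y => L * κ ^ n * (‖x‖ + ‖y‖))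
    (((integrable_const _).add hin).const_mul _) (ae_of_all _ fun y => ?_)).trans ?_
  · refine (h.abs_sub_semigroup_le n x y hL hφ hB).trans ?_
    gcongr
    exact norm_sub_le x y
  · rw [integral_const_mul, integral_add (integrable_const _) hin]
    simp only [integral_const, probReal_univ, one_smul]
    exact (by ring : _ = _).le

lemma tendsto_semigroup_of_lipschitz (h : IsContractiveIteration ν κ p S) {π : Measure X}
    (hP : π ∈ P2 X) (hπ : ∀ n, π.bind (h.semigroup n) = π) (x : X) {φ : X → ℝ}
    {L : ℝ≥0} (hL : LipschitzWith L φ) {B : ℝ} (hB : ∀ x, |φ x| ≤ B) :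
    Tendsto (fun n => ∫ z, φ z ∂(h.semigroup n x)) atTop (𝓝 (∫ z, φ z ∂π)) := by
  rw [tendsto_iff_norm_sub_tendsto_zero]
  refine squeeze_zero (fun _ => norm_nonneg _) (fun n => h.abs_semigroup_sub_le hP hπ n x hL hB) ?_
  have := tendsto_pow_atTop_nhds_zero_of_lt_one κ.2 (by exact_mod_cast h.lt_one : (κ : ℝ) < 1)
  simpa using this.const_mul ((‖x‖ + ∫ y, ‖y‖ ∂π) * L)

/-- Bounded Lipschitz functions suffice to test weak convergence of probability measures. -/
lemma tendsto_semigroup_of_continuous (h : IsContractiveIteration ν κ p S) {π : Measure X}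
    (hP : π ∈ P2 X) (hπ : ∀ n, π.bind (h.semigroup n) = π) (x : X)
    (φ : BoundedContinuousFunction X ℝ) :
    Tendsto (fun n => ∫ z, φ z ∂(h.semigroup n x)) atTop (𝓝 (∫ z, φ z ∂π)) := by
  have := hP.1
  let Q : ℕ → ProbabilityMeasure X := fun n => ⟨h.semigroup n x, inferInstance⟩
  let Q' : ProbabilityMeasure X := ⟨π, this⟩
  have hw : Tendsto Q atTop (𝓝 Q') := by
    rw [tendsto_iff_forall_lipschitz_integral_tendsto]
    rintro f ⟨C, hC⟩ ⟨L, hL⟩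
    exact h.tendsto_semigroup_of_lipschitz hP hπ x hL (bounded_of_dist_le hC 0)
  exact (ProbabilityMeasure.tendsto_iff_forall_integral_tendsto.1 hw) φ

/-- The competitor `μ` need not have moments: `P_n φ → π(φ)` holds at every point, and dominated
convergence with the bound `‖φ‖` passes to the `μ`-integral, which does not depend on `n`. -/
lemma eq_of_isInvariant (h : IsContractiveIteration ν κ p S) {π : Measure X}
    (hP : π ∈ P2 X) (hπ : ∀ n, π.bind (h.semigroup n) = π) {μ : Measure X}
    [hμp : IsProbabilityMeasure μ] (hμ : IsInvariantMeasure h.semigroup μ) : μ = π := by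
  have := hP.1
  refine ext_of_forall_integral_eq_of_IsFiniteMeasure fun φ => ?_
  have hφ : StronglyMeasurable φ := φ.continuous.measurable.stronglyMeasurable
  have hB : ∀ x, |φ x| ≤ ‖φ‖ := fun x => φ.norm_coe_le_norm x
  have h1 : Tendsto (fun n => ∫ x, (∫ z, φ z ∂(h.semigroup n x)) ∂μ) atTop
      (𝓝 (∫ _, (∫ z, φ z ∂π) ∂μ)) := by
    refine tendsto_integral_of_dominated_convergence (fun _ => ‖φ‖)
      (fun n => (h.stronglyMeasurable_semigroup n hφ).aestronglyMeasurable)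
      (integrable_const _) (fun n => ae_of_all _ fun x => ?_)
      (ae_of_all _ fun x => h.tendsto_semigroup_of_continuous hP hπ x φ)
    exact abs_integral_le_of_bounded hB
  simp_rw [hμ φ hφ.measurable ⟨_, hB⟩] at h1
  simpa using tendsto_nhds_unique tendsto_const_nhds h1

lemma isExpMixing (h : IsContractiveIteration ν κ p S) {π : Measure X}
    (hP : π ∈ P2 X) (hπ : ∀ n, π.bind (h.semigroup n) = π) {σ : ℝ} (hσ : 0 < σ) {dt : ℝ≥0}
    (hκ : (κ : ℝ) = Real.exp (-σ * dt)) : IsExpMixing h.semigroup π dt := by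
  have h0 : 0 ≤ ∫ y, ‖y‖ ∂π := integral_nonneg fun _ => norm_nonneg _
  -- The summand 1 only serves to make the constant strictly positive.
  refine ⟨σ, hσ, fun x => ‖x‖ + (∫ y, ‖y‖ ∂π) + 1, fun x => by positivity, ?_⟩
  rintro φ L hL ⟨B, hB⟩ n x
  refine (h.abs_semigroup_sub_le hP hπ n x hL hB).trans ?_
  have : (κ : ℝ) ^ n = Real.exp (-σ * (n * dt)) := by
    rw [hκ, ← Real.exp_nat_mul]; ring_nf
  rw [this]
  gcongr
  linarith

/-- Any coupling of `μ` and `π`, moved by the flow with a common independent noise, becomes a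
coupling of the laws at time `n`, and its cost shrinks by `κ ^ (2 n)`. -/
lemma W2_bind_le (h : IsContractiveIteration ν κ p S) (hκ : κ ≠ 0) {π : Measure X}
    [IsProbabilityMeasure π] (hπ : ∀ n, π.bind (h.semigroup n) = π) (μ : Measure X)
    [IsProbabilityMeasure μ] (n : ℕ) :
    W2 (μ.bind (h.semigroup n)) π ≤ (κ : ℝ≥0∞) ^ n * W2 μ π := by
  have hpow : (κ : ℝ≥0∞) ^ n = (((κ : ℝ≥0∞) ^ n) ^ 2) ^ (1 / 2 : ℝ) := by
    rw [← ENNReal.rpow_natCast _ 2, ← ENNReal.rpow_mul]; norm_num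
  unfold W2
  rw [hpow, ← ENNReal.mul_rpow_of_nonneg _ _ (by norm_num)]
  refine ENNReal.rpow_le_rpow ?_ (by norm_num)
  have hK : ((κ : ℝ≥0∞) ^ n) ^ 2 ≠ ⊤ := by finiteness
  -- Needed to move the factor inside the infima: an infimum over an empty family is `⊤`, and `0 * ⊤
  -- = 0`.
  have hK0 : ((κ : ℝ≥0∞) ^ n) ^ 2 ≠ 0 := by simp [hκ]
  rw [ENNReal.mul_iInf_of_ne hK0 hK]
  refine le_iInf fun γ => ?_
  rw [ENNReal.mul_iInf_of_ne hK0 hK]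
  refine le_iInf fun hγ => ?_
  -- The infimum in `W2` runs over all measures; the total mass is read off from the first marginal.
  have hγp : IsProbabilityMeasure γ :=
    by
    refine ⟨?_⟩
    have := congrArg (fun m : Measure X => m Set.univ) hγ.1
    simpa [Measure.map_apply measurable_fst MeasurableSet.univ] using this
  have hm := h.measurable_iterFlow n
  have hmm : Measurable fun z : (ℕ → W) × (X × X) =>
      (iterFlow p S n z.1 z.2.1, iterFlow p S n z.1 z.2.2) :=
    (hm.comp (measurable_fst.prodMk measurable_snd.fst)).prodMk
      (hm.comp (measurable_fst.prodMk measurable_snd.snd))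
  have hmarg : ∀ f : X × X → X, Measurable f →
      ((iidSeq ν).prod γ).map (fun z => iterFlow p S n z.1 (f z.2)) =
        (γ.map f).bind (h.semigroup n) := by
    intro f hf
    rw [h.bind_semigroup, prod_map_right _ _ hf, Measure.map_map hm (measurable_id.prodMap hf)]
    rfl
  refine (iInf₂_le (((iidSeq ν).prod γ).map fun z =>
      (iterFlow p S n z.1 z.2.1, iterFlow p S n z.1 z.2.2)) (And.intro ?_ ?_)).trans ?_
  · rw [Measure.map_map measurable_fst hmm, ← hγ.1]
    exact hmarg _ measurable_fst
  · rw [Measure.map_map measurable_snd hmm]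
    refine (hmarg _ measurable_snd).trans ?_
    rw [hγ.2, hπ]
  · have hd : Measurable fun z : X × X => edist z.1 z.2 ^ 2 := by fun_prop
    rw [lintegral_map hd hmm, ← lintegral_const_mul _ hd]
    calc ∫⁻ z, edist (iterFlow p S n z.1 z.2.1) (iterFlow p S n z.1 z.2.2) ^ 2
          ∂((iidSeq ν).prod γ)
        ≤ ∫⁻ z, ((κ : ℝ≥0∞) ^ n) ^ 2 * edist z.2.1 z.2.2 ^ 2 ∂((iidSeq ν).prod γ) := by
          refine lintegral_mono fun z => ?_
          rw [← mul_pow]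
          gcongr
          have := h.lipschitz_iterFlow n z.1 z.2.1 z.2.2
          rwa [ENNReal.coe_pow] at this
      _ = ∫⁻ z, ((κ : ℝ≥0∞) ^ n) ^ 2 * edist z.1 z.2 ^ 2 ∂(((iidSeq ν).prod γ).map Prod.snd) := by
          rw [lintegral_map (hd.const_mul _) measurable_snd]
      _ = _ := by rw [Measure.map_snd_prod, measure_univ, one_smul]

/-! #### Ergodicity -/

/-- Pointwise convergence together with the constant bound `2 ‖g‖` permits dominated convergence in
`L²(π)`. -/
lemma tendsto_eLpNorm_semigroup_of_continuous (h : IsContractiveIteration ν κ p S) {π : Measure X}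
    (hP : π ∈ P2 X) (hπ : ∀ n, π.bind (h.semigroup n) = π) (g : BoundedContinuousFunction X ℝ) :
    Tendsto (fun n => eLpNorm (fun x => (∫ y, g y ∂(h.semigroup n x)) - ∫ y, g y ∂π) 2 π)
      atTop (𝓝 0) := by
  have := hP.1
  have hg : StronglyMeasurable g := g.continuous.measurable.stronglyMeasurable
  have hB : ∀ x, |g x| ≤ ‖g‖ := fun x => g.norm_coe_le_norm x
  have h1 : Tendsto (fun n => ∫⁻ x, ‖(∫ y, g y ∂(h.semigroup n x)) - ∫ y, g y ∂π‖ₑ ^ (2 : ℝ) ∂π)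
      atTop (𝓝 (∫⁻ _, 0 ∂π)) := by
    refine tendsto_lintegral_of_dominated_convergence
      (fun _ => ENNReal.ofReal (2 * ‖g‖) ^ (2 : ℝ)) (fun n =>
        (((h.stronglyMeasurable_semigroup n hg).sub stronglyMeasurable_const).enorm.pow_const _))
      (fun n => ae_of_all _ fun x => ?_) 
      (by rw [lintegral_const, measure_univ, mul_one]; finiteness) (ae_of_all _ fun x => ?_)
    · refine ENNReal.rpow_le_rpow ?_ (by norm_num)
      rw [← ofReal_norm]
      refine ENNReal.ofReal_le_ofReal ((norm_sub_le _ _).trans ?_)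
      have a1 : |∫ y, g y ∂(h.semigroup n x)| ≤ ‖g‖ := abs_integral_le_of_bounded hB
      have a2 : |∫ y, g y ∂π| ≤ ‖g‖ := abs_integral_le_of_bounded hB
      rw [Real.norm_eq_abs, Real.norm_eq_abs]
      linarith
    · have h2 := (h.tendsto_semigroup_of_continuous hP hπ x g).sub_const (∫ y, g y ∂π)
      rw [sub_self] at h2
      have h3 := (ENNReal.continuous_rpow_const (y := 2)).continuousAt.tendsto.comp
        ((continuous_enorm.tendsto (0 : ℝ)).comp h2)
      simpa [Function.comp_def] using h3
  have h2 := (ENNReal.continuous_rpow_const (y := 1 / 2)).continuousAt.tendsto.comp h1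
  have h3 : ((∫⁻ _ : X, 0 ∂π : ℝ≥0∞) ^ (1 / 2 : ℝ)) = 0 := by simp
  rw [h3] at h2
  refine h2.congr fun n => ?_
  rw [eLpNorm_eq_lintegral_rpow_enorm_toReal (by simp) (by simp)]
  simp

/-- An `ε/3` argument: `φ` is replaced by a bounded continuous `g`, at a cost controlled by `‖φ -
g‖` twice, once since `P_n` contracts `L²(π)` and once since the mean is bounded by the `L²` norm.
-/
lemma tendsto_eLpNorm_semigroup (h : IsContractiveIteration ν κ p S) {π : Measure X}
    (hP : π ∈ P2 X) (hπ : ∀ n, π.bind (h.semigroup n) = π) {φ : X → ℝ} (hφ : MemLp φ 2 π) :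
    Tendsto (fun n => eLpNorm (fun x => (∫ y, φ y ∂(h.semigroup n x)) - ∫ y, φ y ∂π) 2 π)
      atTop (𝓝 0) := by
  have := hP.1
  rw [ENNReal.tendsto_nhds_zero]
  intro ε hε
  have hε3 : ε / 3 ≠ 0 := (ENNReal.div_pos hε.ne' (by norm_num)).ne'
  obtain ⟨g, hg, hgm⟩ := hφ.exists_boundedContinuous_eLpNorm_sub_le (by simp) hε3
  filter_upwards [(ENNReal.tendsto_nhds_zero.1 (h.tendsto_eLpNorm_semigroup_of_continuous hP hπ g))
    (ε / 3) (pos_iff_ne_zero.2 hε3)] with n hn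
  have hd : MemLp (φ - ⇑g) 2 π := hφ.sub hgm
  have hsplit : (fun x => (∫ y, φ y ∂(h.semigroup n x)) - ∫ y, φ y ∂π) =ᵐ[π]
      ((fun x => ∫ y, (φ - ⇑g) y ∂(h.semigroup n x)) +
        fun x => (∫ y, g y ∂(h.semigroup n x)) - ∫ y, g y ∂π) +
        fun _ => -∫ y, (φ - ⇑g) y ∂π := by
    filter_upwards [h.ae_memLp_semigroup hπ n hφ, h.ae_memLp_semigroup hπ n hgm] with x h1 h2
    have e1 := integral_sub (h1.integrable (by norm_num)) (h2.integrable (by norm_num))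
    have e2 := integral_sub (hφ.integrable (by norm_num)) (hgm.integrable (by norm_num))
    simp only [Pi.add_apply, Pi.sub_apply]
    rw [e1, e2]
    ring
  have m1 := h.aestronglyMeasurable_semigroup hπ n hd.1
  have m2 := (h.aestronglyMeasurable_semigroup hπ n hgm.1).sub
    (aestronglyMeasurable_const (b := ∫ y, g y ∂π))
  rw [eLpNorm_congr_ae hsplit]
  have hc : eLpNorm (fun _ : X => -∫ y, (φ - ⇑g) y ∂π) 2 π ≤ ε / 3 := by
    rw [eLpNorm_const _ (by simp) (IsProbabilityMeasure.ne_zero π), measure_univ,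
      ENNReal.one_rpow, mul_one, enorm_neg]
    refine (enorm_integral_le_lintegral_enorm _).trans ?_
    rw [← eLpNorm_one_eq_lintegral_enorm]
    exact (eLpNorm_le_eLpNorm_of_exponent_le (by norm_num) hd.1).trans hg
  calc _ ≤ ε / 3 + ε / 3 + ε / 3 := by
        refine (eLpNorm_add_le (m1.add m2) aestronglyMeasurable_const (by norm_num)).trans ?_
        gcongr
        refine (eLpNorm_add_le m1 m2 (by norm_num)).trans ?_
        exact add_le_add ((h.eLpNorm_semigroup_le hπ n hd).trans hg) hn
    _ = ε := ENNReal.add_thirds ε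

/-- `P_n φ` itself converges in `L²(π)`, so its Cesàro means do, by the triangle inequality. -/
lemma isErgodicFor (h : IsContractiveIteration ν κ p S) {π : Measure X}
    (hP : π ∈ P2 X) (hπ : ∀ n, π.bind (h.semigroup n) = π) : IsErgodicFor h.semigroup π := by
  have := hP.1
  intro φ hφ
  refine ⟨fun n => (h.ae_memLp_semigroup hπ n hφ).mono fun x hx => hx.integrable (by norm_num), ?_⟩
  set c := ∫ y, φ y ∂π
  set a : ℕ → ℝ≥0∞ := fun n => eLpNorm (fun x => (∫ y, φ y ∂(h.semigroup n x)) - c) 2 π with ha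
  have hm : ∀ n, AEStronglyMeasurable (fun x => (∫ y, φ y ∂(h.semigroup n x)) - c) π := fun n =>
    (h.aestronglyMeasurable_semigroup hπ n hφ.1).sub aestronglyMeasurable_const
  -- Finiteness lets the Cesàro theorem be applied to the real numbers `(a n).toReal`.
  have hfin : ∀ n, a n ≠ ⊤ := fun n => by
    have hn : MemLp (fun x => ∫ y, φ y ∂(h.semigroup n x)) 2 π :=
      ⟨h.aestronglyMeasurable_semigroup hπ n hφ.1, (h.eLpNorm_semigroup_le hπ n hφ).trans_lt hφ.2⟩
    exact (hn.sub (memLp_const c)).2.ne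
  have hlim : Tendsto (fun N : ℕ => ENNReal.ofReal ((N : ℝ)⁻¹ * ∑ n ∈ Finset.range N, (a n).toReal))
      atTop (𝓝 0) := by
    have h1 := (ENNReal.tendsto_toReal (by simp)).comp (h.tendsto_eLpNorm_semigroup hP hπ hφ)
    have h2 := ENNReal.tendsto_ofReal h1.cesaro
    simpa using h2
  refine tendsto_of_tendsto_of_tendsto_of_le_of_le' tendsto_const_nhds hlim
    (Eventually.of_forall fun _ => bot_le) ?_
  -- For `N = 0` the constant `c` is not the mean of `N` copies of itself.
  filter_upwards [eventually_gt_atTop 0] with N hN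
  have hN' : (N : ℝ) ≠ 0 := by positivity
  have e1 : (fun x => (N : ℝ)⁻¹ * (∑ n ∈ Finset.range N, ∫ y, φ y ∂(h.semigroup n x)) - c) =
      (N : ℝ)⁻¹ • ∑ n ∈ Finset.range N, fun x => (∫ y, φ y ∂(h.semigroup n x)) - c := by
    funext x
    simp only [Pi.smul_apply, Finset.sum_apply, Finset.sum_sub_distrib, Finset.sum_const,
      Finset.card_range, smul_eq_mul, nsmul_eq_mul]
    field_simp
  rw [e1, eLpNorm_const_smul, ENNReal.ofReal_mul (by positivity),
    ENNReal.ofReal_sum_of_nonneg fun _ _ => ENNReal.toReal_nonneg]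
  simp_rw [ENNReal.ofReal_toReal (hfin _)]
  rw [Real.enorm_eq_ofReal (by positivity)]
  gcongr
  exact eLpNorm_sum_le (fun n _ => hm n) (by norm_num)

end IsContractiveIteration

/-! ### Vector algebra in three dimensions -/

lemma inner_E3 (a b : E3) : inner ℝ a b = a 0 * b 0 + a 1 * b 1 + a 2 * b 2 := by
  simp [PiLp.inner_apply, Fin.sum_univ_three, mul_comm]

lemma cross_eq (a b : E3) : cross a b =
    !₂[a 1 * b 2 - a 2 * b 1, a 2 * b 0 - a 0 * b 2, a 0 * b 1 - a 1 * b 0] := by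
  simp [cross, cross_apply]

lemma ext_E3 {a b : E3} (h0 : a 0 = b 0) (h1 : a 1 = b 1) (h2 : a 2 = b 2) : a = b := by
  ext i; fin_cases i <;> assumption

lemma norm_sq_E3 (a : E3) : ‖a‖ ^ 2 = a 0 * a 0 + a 1 * a 1 + a 2 * a 2 := by
  rw [← real_inner_self_eq_norm_sq, inner_E3]

lemma inner_cross_left (a b : E3) : inner ℝ (cross a b) a = 0 := by
  simp [inner_E3, cross_eq]; ring

lemma inner_cross_right (a b : E3) : inner ℝ (cross a b) b = 0 := by
  simp [inner_E3, cross_eq]; ring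

lemma norm_cross_sq (a b : E3) : ‖cross a b‖ ^ 2 = ‖a‖ ^ 2 * ‖b‖ ^ 2 - inner ℝ a b ^ 2 := by
  simp only [norm_sq_E3, inner_E3, cross_eq]; simp; ring

/-- The double cross product `v × (m × n)`. -/
lemma cross_cross (v m n : E3) :
    cross v (cross m n) = (inner ℝ v n : ℝ) • m - (inner ℝ v m : ℝ) • n := by
  simp only [inner_E3, cross_eq]; refine ext_E3 ?_ ?_ ?_ <;> simp <;> ring

/-- A vector with vanishing cross product with `d` is parallel to `d`. -/
lemma norm_sq_smul_eq_of_cross_eq_zero {v d : E3} (h : cross v d = 0) :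
    ‖d‖ ^ 2 • v = (inner ℝ v d : ℝ) • d := by
  have h0 := congrArg (fun w : E3 => w 0) h
  have h1 := congrArg (fun w : E3 => w 1) h
  have h2 := congrArg (fun w : E3 => w 2) h
  simp [cross_eq] at h0 h1 h2
  simp only [inner_E3, norm_sq_E3]
  refine ext_E3 ?_ ?_ ?_ <;> simp
  · linear_combination d 1 * h2 - d 2 * h1
  · linear_combination d 2 * h0 - d 0 * h2
  · linear_combination d 0 * h1 - d 1 * h0

lemma eq_smul_of_cross_eq_zero {v d : E3} (hd : d ≠ 0) (h : cross v d = 0) :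
    v = ((inner ℝ v d : ℝ) / ‖d‖ ^ 2) • d := by
  have hd' : ‖d‖ ^ 2 ≠ 0 := by simpa using hd
  rw [div_eq_inv_mul, ← smul_smul, ← norm_sq_smul_eq_of_cross_eq_zero h, smul_smul,
    inv_mul_cancel₀ hd', one_smul]

/-- By the double cross product formula `n × (u × v)` vanishes, so `u × v` is parallel to the unit
vector `n`. -/
lemma norm_cross_eq_abs_inner {u v n : E3} (hn : ‖n‖ = 1) (hu : inner ℝ n u = (0 : ℝ))
    (hv : inner ℝ n v = (0 : ℝ)) : cross u v = (inner ℝ (cross u v) n : ℝ) • n := by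
  have h : cross n (cross u v) = 0 := by rw [cross_cross, hu, hv]; simp
  have h' : cross (cross u v) n = 0 := by
    have h0 := congrArg (fun w : E3 => w 0) h
    have h1 := congrArg (fun w : E3 => w 1) h
    have h2 := congrArg (fun w : E3 => w 2) h
    rw [cross_eq n] at h0 h1 h2
    rw [cross_eq (cross u v)]
    simp only [Matrix.cons_val] at h0 h1 h2
    refine ext_E3 ?_ ?_ ?_ <;> simp
    all_goals simp at h0 h1 h2; linarith
  have := norm_sq_smul_eq_of_cross_eq_zero h'
  rwa [hn, one_pow, one_smul] at this

/-! ### Area and volume of affine images -/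

/-- The linear map sending the standard basis to `v`. -/
def spanMap {n : ℕ} (v : Fin n → E3) : EuclideanSpace ℝ (Fin n) →ₗ[ℝ] E3 where
  toFun s := ∑ i, s i • v i
  map_add' s t := by simp [add_smul, Finset.sum_add_distrib]
  map_smul' c s := by simp [Finset.smul_sum, smul_smul]

lemma spanMap_apply {n : ℕ} (v : Fin n → E3) (s : EuclideanSpace ℝ (Fin n)) :
    spanMap v s = ∑ i, s i • v i := rfl

lemma spanMap_single {n : ℕ} (v : Fin n → E3) (i : Fin n) :
    spanMap v (EuclideanSpace.single i 1) = v i := by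
  simp [spanMap_apply]

lemma normDet_spanMap_sq {n : ℕ} (v : Fin n → E3) :
    (spanMap v).normDet ^ 2 = (Matrix.of fun i j => (inner ℝ (v i) (v j) : ℝ)).det := by
  have h := (spanMap v).normDet_sq_eq_det_gram (EuclideanSpace.basisFun (Fin n) ℝ)
  simp only [RCLike.ofReal_real_eq_id, id] at h
  rw [h]
  congr 1
  ext i j
  simp [Matrix.gram, spanMap_single]

/-- Both sides are nonnegative, and their squares agree by Lagrange's identity: the Gram determinant
of two vectors is `‖v 0 × v 1‖²`. -/
lemma normDet_spanMap_two (v : Fin 2 → E3) : (spanMap v).normDet = ‖cross (v 0) (v 1)‖ := by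
  rw [← sq_eq_sq₀ (LinearMap.normDet_nonneg _) (norm_nonneg _), normDet_spanMap_sq, norm_cross_sq,
    Matrix.det_fin_two]
  simp only [Matrix.of_apply, real_inner_self_eq_norm_sq, real_inner_comm (v 0) (v 1)]
  ring

/-- The Gram determinant of three vectors is the square of their triple product. -/
lemma normDet_spanMap_three (v : Fin 3 → E3) :
    (spanMap v).normDet = |inner ℝ (cross (v 1) (v 2)) (v 0)| := by
  rw [← sq_eq_sq₀ (LinearMap.normDet_nonneg _) (abs_nonneg _), normDet_spanMap_sq, sq_abs,
    Matrix.det_fin_three]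
  simp only [Matrix.of_apply, inner_E3, cross_eq]
  simp
  ring

/-- The area formula for an injective affine parametrization. -/
lemma setIntegral_image_spanMap {n : ℕ} (v : Fin n → E3) (hv : (spanMap v).normDet ≠ 0) (x₀ : E3)
    {T : Set (EuclideanSpace ℝ (Fin n))} (hT : MeasurableSet T) (g : E3 → ℝ) :
    ∫ x in (fun s => x₀ + spanMap v s) '' T, g x ∂μHE[n] =
      (spanMap v).normDet * ∫ s in T, g (x₀ + spanMap v s) := by
  have hinj : Function.Injective (spanMap v) := by
    rw [← LinearMap.ker_eq_bot]
    by_contra hker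
    exact hv (LinearMap.normDet_eq_zero_iff_ker_ne_bot.2 hker)
  set φ : EuclideanSpace ℝ (Fin n) → E3 := fun s => x₀ + spanMap v s with hφ
  have hemb : MeasurableEmbedding φ := by
    have h1 : Topology.IsClosedEmbedding (spanMap v) :=
      LinearMap.isClosedEmbedding_of_injective (LinearMap.ker_eq_bot.2 hinj)
    exact ((Homeomorph.addLeft x₀).isClosedEmbedding.comp h1).measurableEmbedding
  have himg : ∀ A, MeasurableSet A → (μHE[n] : Measure E3) (φ '' A) =
      ENNReal.ofReal (spanMap v).normDet * volume A := by
    intro A _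
    have h2 := (spanMap v).euclideanHausdorffMeasure_image_eq_normDet_mul_volume A
    rw [finrank_euclideanSpace_fin] at h2
    rw [← h2]
    have : φ '' A = (fun y => x₀ +ᵥ y) '' (spanMap v '' A) := by
      rw [Set.image_image]; rfl
    rw [this]
    exact (isometry_vadd E3 x₀).euclideanHausdorffMeasure_image _
  -- On the range of the parametrization the area is a constant multiple of the transported Lebesgue
  -- measure, so the integral formula reduces to the measure of images.
  have hmeas : (μHE[n] : Measure E3).restrict (Set.range φ) =
      ENNReal.ofReal (spanMap v).normDet • (volume.map φ) := by
    ext A hA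
    rw [Measure.restrict_apply hA, Measure.smul_apply, hemb.map_apply, smul_eq_mul,
      ← himg _ (hemb.measurable hA), Set.image_preimage_eq_inter_range]
  have hsub : φ '' T ⊆ Set.range φ := Set.image_subset_range _ _
  have : (μHE[n] : Measure E3).restrict (φ '' T) =
      ((μHE[n] : Measure E3).restrict (Set.range φ)).restrict (φ '' T) := by
    rw [Measure.restrict_restrict (hemb.measurableSet_image.2 hT), Set.inter_eq_left.2 hsub]
  rw [this, hmeas, Measure.restrict_smul, integral_smul_measure, hemb.setIntegral_map,
    Set.preimage_image_eq _ hemb.injective, ENNReal.toReal_ofReal (LinearMap.normDet_nonneg _),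
    smul_eq_mul]

/-! ### Planes -/

/-- The plane `{x | ⟨m, x⟩ = c}`. -/
def plane (m : E3) (c : ℝ) : Set E3 := {x | inner ℝ m x = c}

/-- A line has no area. -/
lemma area_line (x₀ d : E3) : (μHE[2] : Measure E3) (Set.range fun t : ℝ => x₀ + t • d) = 0 := by
  -- The line is contained in the image of a degenerate planar map, whose area factor `‖d × 0‖`
  -- vanishes.
  set v : Fin 2 → E3 := ![d, 0] with hv
  have hsub : (Set.range fun t : ℝ => x₀ + t • d) ⊆
      (fun y => x₀ +ᵥ y) '' (spanMap v '' Set.univ) := by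
    rintro _ ⟨t, rfl⟩
    exact ⟨t • d, ⟨EuclideanSpace.single 0 t, trivial, by simp [spanMap_apply, hv]⟩, rfl⟩
  refine measure_mono_null hsub ?_
  rw [(isometry_vadd E3 x₀).euclideanHausdorffMeasure_image]
  have h2 := (spanMap v).euclideanHausdorffMeasure_image_eq_normDet_mul_volume Set.univ
  rw [finrank_euclideanSpace_fin] at h2
  rw [h2, normDet_spanMap_two]
  have : cross (v 0) (v 1) = 0 := by
    simp only [hv, cross_eq]; refine ext_E3 ?_ ?_ ?_ <;> simp
  simp [this]

/-- Two planes whose intersection has positive area are equal. -/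
lemma plane_eq_of_area_pos {m m' : E3} {c c' : ℝ} (hm : ‖m‖ = 1) (hm' : ‖m'‖ = 1)
    (h : (μHE[2] : Measure E3) (plane m c ∩ plane m' c') ≠ 0) :
    (m' = m ∧ c' = c) ∨ (m' = -m ∧ c' = -c) := by
  obtain ⟨x₀, hx, hx'⟩ : (plane m c ∩ plane m' c').Nonempty := by
    by_contra hne
    rw [Set.not_nonempty_iff_eq_empty] at hne
    exact h (by rw [hne, measure_empty])
  have hx0 : inner ℝ m x₀ = c := hx
  have hx0' : inner ℝ m' x₀ = c' := hx'
  -- Planes with non-parallel normals meet in a line of direction `m × m'`, which has no area.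
  have hd : cross m m' = 0 := by
    by_contra hd
    refine h (measure_mono_null ?_ (area_line x₀ (cross m m')))
    rintro x ⟨h1, h2⟩
    have h1 : inner ℝ m x = c := h1
    have h2 : inner ℝ m' x = c' := h2
    have hc : cross (x - x₀) (cross m m') = 0 := by
      rw [cross_cross, real_inner_comm, inner_sub_right, h2, hx0', real_inner_comm,
        inner_sub_right, h1, hx0]
      simp
    exact ⟨_, (eq_sub_iff_add_eq'.1 (eq_smul_of_cross_eq_zero hd hc).symm)⟩
  have hpar := norm_sq_smul_eq_of_cross_eq_zero hd
  rw [hm', one_pow, one_smul] at hpar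
  set t := inner ℝ m m'
  have ht : |t| = 1 := by
    have := congrArg norm hpar
    rw [norm_smul, hm, hm', mul_one, Real.norm_eq_abs] at this
    exact this.symm
  rcases (abs_eq one_pos.le).1 ht with h1 | h1
  · left
    rw [h1, one_smul] at hpar
    exact ⟨hpar.symm, by rw [← hx0', ← hx0, hpar]⟩
  · right
    rw [h1, neg_one_smul] at hpar
    have : m' = -m := by rw [hpar, neg_neg]
    exact ⟨this, by rw [← hx0', ← hx0, this, inner_neg_left]⟩

/-! ### The divergence theorem on a tetrahedron -/

/-- The reference simplex `{s | s_i ≥ 0, ∑ s_i ≤ 1}`. -/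
def refSimplex (n : ℕ) : Set (Fin n → ℝ) := {s | (∀ i, 0 ≤ s i) ∧ ∑ i, s i ≤ 1}

lemma isClosed_refSimplex (n : ℕ) : IsClosed (refSimplex n) :=
  (isClosed_le continuous_const continuous_id).inter
    (isClosed_le (continuous_finsetSum _ fun i _ => continuous_apply i) continuous_const)

lemma isCompact_refSimplex (n : ℕ) : IsCompact (refSimplex n) := by
  refine (isCompact_Icc (a := (0 : Fin n → ℝ)) (b := 1)).of_isClosed_subset
    (isClosed_refSimplex n) fun s hs => ⟨hs.1, fun i => ?_⟩
  exact (Finset.single_le_sum (f := s) (fun j _ => hs.1 j) (Finset.mem_univ i)).trans hs.2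

/-- Fubini on the reference simplex. -/
lemma integral_refSimplex_succ (n : ℕ) {F : (Fin (n + 1) → ℝ) → ℝ} (hF : Continuous F) :
    ∫ s in refSimplex (n + 1), F s =
      ∫ y in refSimplex n, ∫ x in (0 : ℝ)..(1 - ∑ i, y i), F (Fin.cons x y) := by
  have hmp := volume_preserving_piFinSuccAbove (fun _ : Fin (n + 1) => ℝ) 0
  set G : (Fin (n + 1) → ℝ) → ℝ := (refSimplex (n + 1)).indicator F with hG
  have hcl := (isClosed_refSimplex (n + 1)).measurableSet
  have hGi : Integrable G := by
    rw [hG, integrable_indicator_iff hcl]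
    exact hF.continuousOn.integrableOn_compact (isCompact_refSimplex _)
  have hsymm : ∀ z : ℝ × (Fin n → ℝ),
      (MeasurableEquiv.piFinSuccAbove (fun _ : Fin (n + 1) => ℝ) 0).symm z =
        Fin.cons z.1 z.2 := fun z => by
    rw [← Fin.insertNth_zero']; rfl
  have e1 : ∫ s in refSimplex (n + 1), F s = ∫ s, G s := (integral_indicator hcl).symm
  have e2 : ∫ s, G s = ∫ z : ℝ × (Fin n → ℝ), G (Fin.cons z.1 z.2) := by
    rw [← hmp.symm.integral_comp' G]
    simp only [hsymm]
  have hGi2 : Integrable (fun z : ℝ × (Fin n → ℝ) => G (Fin.cons z.1 z.2)) := by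
    have := (hmp.symm.integrable_comp_emb (MeasurableEquiv.measurableEmbedding _)).2 hGi
    simpa only [Function.comp_def, hsymm] using this
  rw [e1, e2, Measure.volume_eq_prod, integral_prod_symm _ hGi2,
    ← integral_indicator (isClosed_refSimplex n).measurableSet]
  refine integral_congr_ae (ae_of_all _ fun y => ?_)
  have hmem : ∀ x : ℝ, (Fin.cons x y : Fin (n + 1) → ℝ) ∈ refSimplex (n + 1) ↔
      (∀ i, 0 ≤ y i) ∧ x ∈ Set.Icc 0 (1 - ∑ i, y i) := by
    intro x
    simp only [refSimplex, Set.mem_ofPred_eq, Fin.forall_fin_succ, Fin.cons_zero, Fin.cons_succ,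
      Fin.sum_univ_succ, Set.mem_Icc]
    constructor
    · rintro ⟨⟨h1, h2⟩, h3⟩; exact ⟨h2, h1, by linarith⟩
    · rintro ⟨h2, h1, h3⟩; exact ⟨⟨h1, h2⟩, by linarith⟩
  by_cases hy : y ∈ refSimplex n
  · rw [Set.indicator_of_mem hy, intervalIntegral.integral_of_le (by linarith [hy.2]),
      ← integral_Icc_eq_integral_Ioc, ← integral_indicator measurableSet_Icc]
    refine integral_congr_ae (ae_of_all _ fun x => ?_)
    show (refSimplex (n + 1)).indicator F (Fin.cons x y) = _
    by_cases hx : x ∈ Set.Icc 0 (1 - ∑ i, y i)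
    · rw [Set.indicator_of_mem ((hmem x).2 ⟨hy.1, hx⟩), Set.indicator_of_mem hx]
    · rw [Set.indicator_of_notMem fun h => hx ((hmem x).1 h).2, Set.indicator_of_notMem hx]
  · rw [Set.indicator_of_notMem hy]
    have : ∀ x : ℝ, G (Fin.cons x y) = 0 := by
      intro x
      refine Set.indicator_of_notMem ?_ _
      rw [hmem]
      rintro ⟨h1, h2⟩
      exact hy ⟨h1, by linarith [h2.1, h2.2]⟩
    simp [this]

/-- The coordinates `s i` are the barycentric weights of the vertices `x₀ + v i`, and `1 - ∑ s i` is
that of `x₀`. -/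
lemma convexHull_eq_image_refSimplex {n : ℕ} (x₀ : E3) (v : Fin n → E3) :
    convexHull ℝ (insert x₀ (Set.range fun i => x₀ + v i)) =
      (fun s => x₀ + spanMap v s) '' (WithLp.ofLp ⁻¹' refSimplex n) := by
  apply Set.Subset.antisymm
  · refine convexHull_min ?_ ?_
    · rintro _ (rfl | ⟨i, rfl⟩)
      · exact ⟨0, by simp [refSimplex], by simp⟩
      · refine ⟨EuclideanSpace.single i 1, ⟨fun j => ?_, ?_⟩, ?_⟩
        · show (0 : ℝ) ≤ (EuclideanSpace.single i (1 : ℝ) : EuclideanSpace ℝ (Fin n)) j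
          rw [PiLp.single_apply]
          split_ifs <;> norm_num
        · simp [EuclideanSpace.single]
        · simp [spanMap_single]
    · have hconv : Convex ℝ (refSimplex n) := by
        rintro s ⟨h1, h2⟩ t ⟨h3, h4⟩ a b ha hb hab
        refine ⟨fun i => ?_, ?_⟩
        · have := h1 i; have := h3 i
          simp only [Pi.add_apply, Pi.smul_apply, smul_eq_mul]; positivity
        · simp only [Pi.add_apply, Pi.smul_apply, smul_eq_mul, Finset.sum_add_distrib,
            ← Finset.mul_sum]
          nlinarith
      have h1 : Convex ℝ (WithLp.ofLp ⁻¹' refSimplex n : Set (EuclideanSpace ℝ (Fin n))) :=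
        hconv.linear_preimage (WithLp.linearEquiv 2 ℝ (Fin n → ℝ)).toLinearMap
      have h2 := (h1.linear_image (spanMap v)).translate x₀
      rwa [Set.image_image] at h2
  · rintro _ ⟨s, ⟨h1, h2⟩, rfl⟩
    have hc := convex_convexHull ℝ (insert x₀ (Set.range fun i => x₀ + v i))
    have hx : x₀ + spanMap v s = (1 - ∑ i, s i) • x₀ + ∑ i, s i • (x₀ + v i) := by
      rw [spanMap_apply, sub_smul, one_smul, Finset.sum_smul]
      simp only [smul_add, Finset.sum_add_distrib]
      abel
    -- The vertices are indexed by `Option (Fin n)`, where `none` stands for `x₀`.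
    have hsum := hc.sum_mem (t := Finset.univ) (w := fun o : Option (Fin n) =>
        o.elim (1 - ∑ i, s i) fun i => s i) (z := fun o => o.elim x₀ fun i => x₀ + v i)
      (by
        rintro (_ | i) _
        · simpa using h2
        · exact h1 i)
      (by simp [Fintype.sum_option])
      (by
        rintro (_ | i) _
        · exact subset_convexHull _ _ (Set.mem_insert _ _)
        · exact subset_convexHull _ _ (Set.mem_insert_of_mem _ ⟨i, rfl⟩))
    simp only [Fintype.sum_option, Option.elim] at hsum
    show x₀ + spanMap v s ∈ _
    rwa [hx]

/-- Integration over a simplex in coordinates. -/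
lemma setIntegral_convexHull {n : ℕ} (x₀ : E3) (v : Fin n → E3) (hv : (spanMap v).normDet ≠ 0)
    (g : E3 → ℝ) :
    ∫ x in convexHull ℝ (insert x₀ (Set.range fun i => x₀ + v i)), g x ∂μHE[n] =
      (spanMap v).normDet * ∫ s in refSimplex n, g (x₀ + ∑ i, s i • v i) := by
  have hm : MeasurableSet (WithLp.ofLp ⁻¹' refSimplex n : Set (EuclideanSpace ℝ (Fin n))) :=
    ((isClosed_refSimplex n).preimage (PiLp.continuous_ofLp 2 _)).measurableSet
  rw [convexHull_eq_image_refSimplex, setIntegral_image_spanMap v hv x₀ hm]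
  congr 1
  exact (PiLp.volume_preserving_ofLp (Fin n)).setIntegral_preimage_emb
    (MeasurableEquiv.toLp 2 (Fin n → ℝ)).symm.measurableEmbedding
    (fun s => g (x₀ + ∑ i, s i • v i)) (refSimplex n)

/-- The fundamental theorem of calculus along an edge of a tetrahedron. -/
lemma integral_fderiv_simplex (x₀ : E3) (v : Fin 3 → E3) (hv : (spanMap v).normDet ≠ 0)
    {g : E3 → ℝ} (hg : ContDiff ℝ 1 g) :
    ∫ x in convexHull ℝ (insert x₀ (Set.range fun i => x₀ + v i)), fderiv ℝ g x (v 0) =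
      (spanMap v).normDet *
        ((∫ y in refSimplex 2, g (x₀ + v 0 + ∑ i, y i • (v i.succ - v 0))) -
          ∫ y in refSimplex 2, g (x₀ + ∑ i, y i • v i.succ)) := by
  have hvol : (volume : Measure E3) = μHE[3] :=
    (EuclideanSpace.euclideanHausdorffMeasure_eq_volume 3).symm
  have hc1 : Continuous fun x => fderiv ℝ g x (v 0) :=
    (hg.continuous_fderiv one_ne_zero).clm_apply continuous_const
  have hgc := hg.continuous
  rw [hvol, setIntegral_convexHull x₀ v hv, integral_refSimplex_succ 2
    (F := fun s => fderiv ℝ g (x₀ + ∑ i, s i • v i) (v 0)) (hc1.comp (by fun_prop)),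
    ← integral_sub]
  rotate_left
  · exact (Continuous.continuousOn (by fun_prop)).integrableOn_compact (isCompact_refSimplex 2)
  · exact (Continuous.continuousOn (by fun_prop)).integrableOn_compact (isCompact_refSimplex 2)
  congr 1
  refine setIntegral_congr_fun (isClosed_refSimplex 2).measurableSet fun y _ => ?_
  set w : E3 := x₀ + ∑ i : Fin 2, y i • v i.succ
  have hline : ∀ x : ℝ, x₀ + ∑ i, (Fin.cons x y : Fin 3 → ℝ) i • v i = w + x • v 0 := by
    intro x
    rw [Fin.sum_univ_succ]
    simp only [Fin.cons_zero, Fin.cons_succ, w]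
    abel
  simp only [hline]
  -- The fibre over `y` in direction `v 0` starts on the facet opposite `x₀ + v 0` and ends on the
  -- facet opposite `x₀`; `y` parametrizes both facets.
  have hend : x₀ + v 0 + ∑ i : Fin 2, y i • (v i.succ - v 0) = w + (1 - ∑ i, y i) • v 0 := by
    simp only [smul_sub, Finset.sum_sub_distrib, ← Finset.sum_smul, w, sub_smul, one_smul]
    abel
  rw [hend]
  have hder : ∀ x : ℝ, HasDerivAt (fun x : ℝ => g (w + x • v 0)) (fderiv ℝ g (w + x • v 0) (v 0))
      x := by
    intro x
    have h1 : HasDerivAt (fun x : ℝ => w + x • v 0) (v 0) x := by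
      simpa using ((hasDerivAt_id x).smul_const (v 0)).const_add w
    exact ((hg.differentiable one_ne_zero) _).hasFDerivAt.comp_hasDerivAt x h1
  rw [intervalIntegral.integral_eq_sub_of_hasDerivAt (fun x _ => hder x)
    ((hc1.comp (by fun_prop)).intervalIntegrable _ _)]
  simp

lemma spanMap_edges_injective {p : Fin 4 → E3} (hp : AffineIndependent ℝ p) :
    Function.Injective (spanMap fun i : Fin 3 => p i.succ - p 0) := by
  rw [affineIndependent_iff_linearIndependent_vsub ℝ p 0] at hp
  have h1 := hp.comp (fun i : Fin 3 => (⟨i.succ, Fin.succ_ne_zero i⟩ : {x : Fin 4 // x ≠ 0}))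
    (fun i j h => by simpa using h)
  have h2 : LinearIndependent ℝ fun i : Fin 3 => p i.succ - p 0 := h1
  rw [← LinearMap.ker_eq_bot, LinearMap.ker_eq_bot']
  intro s hs
  rw [Fintype.linearIndependent_iff] at h2
  have := h2 s hs
  ext i
  exact this i

lemma normDet_edges_ne_zero {p : Fin 4 → E3} (hp : AffineIndependent ℝ p) :
    (spanMap fun i : Fin 3 => p i.succ - p 0).normDet ≠ 0 := by
  intro h
  exact LinearMap.normDet_eq_zero_iff_ker_ne_bot.1 h
    (LinearMap.ker_eq_bot.2 (spanMap_edges_injective hp))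

lemma affineIndependent_perm {p : Fin 4 → E3} (hp : AffineIndependent ℝ p) {σ : Fin 4 → Fin 4}
    (hσ : Function.Injective σ) : AffineIndependent ℝ (p ∘ σ) :=
  hp.comp_embedding ⟨σ, hσ⟩

lemma triple_ne_zero {p : Fin 4 → E3} (hp : AffineIndependent ℝ p) :
    (inner ℝ (cross (p 2 - p 0) (p 3 - p 0)) (p 1 - p 0) : ℝ) ≠ 0 := by
  have := normDet_edges_ne_zero hp
  rw [normDet_spanMap_three, abs_ne_zero] at this
  exact this

/-- `N` is the family of outward unit normals of the facets of the tetrahedron with vertices `p`. -/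
structure IsOutwardNormals (p N : Fin 4 → E3) : Prop where
  norm_eq : ∀ k, ‖N k‖ = 1
  inner_facet : ∀ k i j, i ≠ k → j ≠ k → inner ℝ (N k) (p i - p j) = (0 : ℝ)
  inner_pos : ∀ k i, i ≠ k → 0 < (inner ℝ (N k) (p i - p k) : ℝ)

/-- The cross product is orthogonal to the edges of the facet, and the sign factor orients it.
Nondegeneracy keeps the argument of the sign away from zero, so the vector really has length 1. -/
lemma isOutwardNormals_normal {D : Cuboid} (T : SimplicialMesh D) (i : Fin T.card) :
    IsOutwardNormals (T.vert i) (T.normal i) := by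
  have hp := T.affineIndependent i
  have hw : ∀ k, (inner ℝ (T.facetCross i k) (T.vert i (k.succAbove 0) - T.vert i k) : ℝ) ≠ 0 := by
    intro k h
    -- With this order of the vertices the nonvanishing triple product is that of `facetCross` with
    -- the edge from the facet to the opposite vertex `k`.
    have hσ : Function.Injective ![k.succAbove 0, k, k.succAbove 1, k.succAbove 2] := by
      clear h
      revert k; decide
    refine triple_ne_zero (affineIndependent_perm hp hσ) ?_
    simp only [Function.comp_apply, Matrix.cons_val]
    rw [← neg_sub (T.vert i (k.succAbove 0)) (T.vert i k), inner_neg_right, neg_eq_zero]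
    exact h
  have hc : ∀ k, ‖T.facetCross i k‖ ≠ 0 := fun k h => hw k (by
    rw [norm_eq_zero.1 h, inner_zero_left])
  have hedge : ∀ k j, j ≠ k →
      (inner ℝ (T.facetCross i k) (T.vert i j - T.vert i (k.succAbove 0)) : ℝ) = 0 := by
    intro k j hj
    obtain ⟨a, rfl⟩ := Fin.exists_succAbove_eq hj
    fin_cases a
    · simp
    · exact inner_cross_left _ _
    · exact inner_cross_right _ _
  refine ⟨fun k => ?_, fun k a b ha hb => ?_, fun k a ha => ?_⟩
  · rw [SimplicialMesh.normal, norm_smul, Real.norm_eq_abs, abs_div, abs_norm,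
      div_mul_cancel₀ _ (hc k)]
    rcases lt_or_gt_of_ne (hw k) with h | h
    · rw [Real.sign_of_neg h]; simp
    · rw [Real.sign_of_pos h]; simp
  · rw [SimplicialMesh.normal, real_inner_smul_left,
      ← sub_sub_sub_cancel_right (T.vert i a) _ (T.vert i (k.succAbove 0)),
      inner_sub_right _ (T.vert i a - T.vert i (k.succAbove 0)), hedge k a ha, hedge k b hb,
      sub_zero, mul_zero]
  · rw [SimplicialMesh.normal, real_inner_smul_left,
      ← sub_add_sub_cancel (T.vert i a) (T.vert i (k.succAbove 0)), inner_add_right,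
      hedge k a ha, zero_add, div_mul_eq_mul_div]
    have hcp : 0 < ‖T.facetCross i k‖ := lt_of_le_of_ne (norm_nonneg _) (hc k).symm
    refine div_pos ?_ hcp
    rcases lt_or_gt_of_ne (hw k) with h | h
    · rw [Real.sign_of_neg h]; linarith
    · rw [Real.sign_of_pos h]; linarith

/-- Names the endpoints `c, d` of the edge opposite to `ab`; the facets opposite `a` and `b` are
then `bcd` and `acd`. -/
lemma exists_complement_pair : ∀ a b : Fin 4, a ≠ b → ∃ c d : Fin 4,
    Function.Injective ![a, b, c, d] ∧ (∀ j, j ≠ a ↔ j = b ∨ j = c ∨ j = d) ∧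
      (∀ j, j ≠ b ↔ j = a ∨ j = c ∨ j = d) := by
  decide

/-- Volume as base area times height: `u × v` is a multiple of the unit normal `n`. -/
lemma abs_triple_eq {n u v w : E3} (hn : ‖n‖ = 1) (hu : inner ℝ n u = (0 : ℝ))
    (hv : inner ℝ n v = (0 : ℝ)) :
    |inner ℝ (cross u v) w| = ‖cross u v‖ * |inner ℝ n w| := by
  have h := norm_cross_eq_abs_inner hn hu hv
  set t : ℝ := inner ℝ (cross u v) n
  rw [h, real_inner_smul_left, norm_smul, hn, mul_one, abs_mul, Real.norm_eq_abs]

lemma range_succAbove_image {p : Fin 4 → E3} {a b c d : Fin 4}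
    (h : ∀ j, j ≠ a ↔ j = b ∨ j = c ∨ j = d) :
    Set.range (p ∘ a.succAbove) =
      insert (p b) (Set.range fun i : Fin 2 => p b + (![p c - p b, p d - p b] : Fin 2 → E3) i) := by
  rw [Set.range_comp, Fin.range_succAbove]
  have : ({a}ᶜ : Set (Fin 4)) = {b, c, d} := by
    ext j; simpa using h j
  rw [this]
  ext x
  simp [Fin.exists_fin_two, Set.image_insert_eq, eq_comm]

lemma setIntegral_facet {p : Fin 4 → E3} {a b c d : Fin 4}
    (h : ∀ j, j ≠ a ↔ j = b ∨ j = c ∨ j = d) (hne : ‖cross (p c - p b) (p d - p b)‖ ≠ 0)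
    (g : E3 → ℝ) :
    ∫ x in convexHull ℝ (Set.range (p ∘ a.succAbove)), g x ∂μHE[2] =
      ‖cross (p c - p b) (p d - p b)‖ *
        ∫ y in refSimplex 2, g (p b + ∑ i, y i • (![p c - p b, p d - p b] : Fin 2 → E3) i) := by
  rw [range_succAbove_image h, setIntegral_convexHull]
  · rw [normDet_spanMap_two]; rfl
  · rw [normDet_spanMap_two]; exact hne

lemma convexHull_range_perm {p : Fin 4 → E3} {σ : Fin 4 → Fin 4} (hσ : Function.Injective σ) :
    convexHull ℝ (Set.range p) = convexHull ℝ (insert (p (σ 0))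
      (Set.range fun i : Fin 3 => p (σ 0) + (p (σ i.succ) - p (σ 0)))) := by
  have hs : Function.Surjective σ := Finite.surjective_of_injective hσ
  congr 1
  rw [← hs.range_comp p]
  ext x
  simp only [Set.mem_range, Function.comp_apply, Set.mem_insert_iff, add_sub_cancel]
  rw [Fin.exists_fin_succ]
  simp [eq_comm]

/-- The divergence theorem on a tetrahedron in the direction of an edge. -/
lemma integral_fderiv_edge {p N : Fin 4 → E3} (hp : AffineIndependent ℝ p)
    (hN : IsOutwardNormals p N) {a b : Fin 4} (hab : a ≠ b) {g : E3 → ℝ} (hg : ContDiff ℝ 1 g) :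
    ∫ x in convexHull ℝ (Set.range p), fderiv ℝ g x (p b - p a) =
      ∑ k, inner ℝ (N k) (p b - p a) *
        ∫ x in convexHull ℝ (Set.range (p ∘ k.succAbove)), g x ∂μHE[2] := by
  obtain ⟨c, d, hσ, h1, h2⟩ := exists_complement_pair a b hab
  have hq := affineIndependent_perm hp hσ
  have hdet := normDet_edges_ne_zero hq
  have hca : c ≠ a := (h1 c).2 (by simp)
  have hda : d ≠ a := (h1 d).2 (by simp)
  have hcb : c ≠ b := (h2 c).2 (by simp)
  have hdb : d ≠ b := (h2 d).2 (by simp)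
  have hJ : (spanMap fun i : Fin 3 => (p ∘ ![a, b, c, d]) i.succ - (p ∘ ![a, b, c, d]) 0).normDet =
      |inner ℝ (cross (p c - p a) (p d - p a)) (p b - p a)| := normDet_spanMap_three _
  -- The same Jacobian is written twice as doubled facet area times height, over the facet opposite
  -- `b` here and over the one opposite `a` in `hJa`. The heights, up to sign, are the weights `⟨N,
  -- p b - p a⟩` of the flux formula.
  have hJb : |inner ℝ (cross (p c - p a) (p d - p a)) (p b - p a)| =
      ‖cross (p c - p a) (p d - p a)‖ * -inner ℝ (N b) (p b - p a) := by
    rw [abs_triple_eq (hN.norm_eq b) (hN.inner_facet b c a hcb hab)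
      (hN.inner_facet b d a hdb hab), abs_of_neg]
    have := hN.inner_pos b a hab
    rw [← neg_sub, inner_neg_right]
    linarith
  have hJa : |inner ℝ (cross (p c - p a) (p d - p a)) (p b - p a)| =
      ‖cross (p c - p b) (p d - p b)‖ * inner ℝ (N a) (p b - p a) := by
    have e : (inner ℝ (cross (p c - p a) (p d - p a)) (p b - p a) : ℝ) =
        inner ℝ (cross (p c - p b) (p d - p b)) (p b - p a) := by
      simp only [inner_E3, cross_eq]
      simp
      ring
    rw [e, abs_triple_eq (hN.norm_eq a) (hN.inner_facet a c b hca hab.symm)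
      (hN.inner_facet a d b hda hab.symm), abs_of_pos (hN.inner_pos a b hab.symm)]
  rw [hJ] at hdet
  have hca' : ‖cross (p c - p b) (p d - p b)‖ ≠ 0 := fun h0 => hdet (by rw [hJa, h0, zero_mul])
  have hcb' : ‖cross (p c - p a) (p d - p a)‖ ≠ 0 := fun h0 => hdet (by rw [hJb, h0, zero_mul])
  have hmain := integral_fderiv_simplex (p a)
    (fun i : Fin 3 => (p ∘ ![a, b, c, d]) i.succ - (p ∘ ![a, b, c, d]) 0)
    (by rw [hJ]; exact hdet) hg
  have hK := convexHull_range_perm (p := p) hσ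
  -- The edge `ab` lies in the two other facets, whose normals are orthogonal to it.
  rw [Fintype.sum_eq_add a b hab (fun k hk => by
    rw [hN.inner_facet k b a hk.2.symm hk.1.symm, zero_mul]), setIntegral_facet h1 hca' g,
    setIntegral_facet h2 hcb' g]
  have hlhs : ∫ x in convexHull ℝ (Set.range p), fderiv ℝ g x (p b - p a) =
      |inner ℝ (cross (p c - p a) (p d - p a)) (p b - p a)| *
        ((∫ y in refSimplex 2, g (p b + ∑ i, y i • (![p c - p b, p d - p b] : Fin 2 → E3) i)) -
          ∫ y in refSimplex 2, g (p a + ∑ i, y i • (![p c - p a, p d - p a] : Fin 2 → E3) i)) := by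
    rw [hK, ← hJ]
    refine hmain.trans ?_
    congr 1
    simp [Fin.sum_univ_two]
  rw [hlhs, mul_sub, ← mul_assoc, ← mul_assoc]
  nth_rewrite 1 [hJa]
  rw [hJb]
  ring

/-- The divergence theorem on a tetrahedron in a fixed direction. -/
lemma integral_fderiv_tetrahedron {p N : Fin 4 → E3} (hp : AffineIndependent ℝ p)
    (hN : IsOutwardNormals p N) (w : E3) {g : E3 → ℝ} (hg : ContDiff ℝ 1 g) :
    ∫ x in convexHull ℝ (Set.range p), fderiv ℝ g x w =
      ∑ k, inner ℝ (N k) w *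
        ∫ x in convexHull ℝ (Set.range (p ∘ k.succAbove)), g x ∂μHE[2] := by
  -- Both sides are linear in the direction `w`, and the three edges at `p 0` span the space.
  have hsurj : Function.Surjective (spanMap fun i : Fin 3 => p i.succ - p 0) :=
    (LinearMap.injective_iff_surjective_of_finrank_eq_finrank (by simp)).1
      (spanMap_edges_injective hp)
  obtain ⟨s, rfl⟩ := hsurj w
  have hK : IsCompact (convexHull ℝ (Set.range p)) :=
    Set.Finite.isCompact_convexHull ℝ (Set.finite_range _)
  have hint : ∀ v : E3, IntegrableOn (fun x => fderiv ℝ g x v) (convexHull ℝ (Set.range p)) :=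
    fun v => ((hg.continuous_fderiv one_ne_zero).clm_apply
      continuous_const).continuousOn.integrableOn_compact hK
  simp only [spanMap_apply, map_sum, map_smul, smul_eq_mul, inner_sum, real_inner_smul_right]
  rw [integral_finsetSum _ fun i _ => (hint _).const_mul _]
  simp only [integral_const_mul, Finset.sum_mul]
  rw [Finset.sum_comm]
  refine Finset.sum_congr rfl fun i _ => ?_
  rw [integral_fderiv_edge hp hN (Fin.succ_ne_zero i).symm hg, Finset.mul_sum]
  exact Finset.sum_congr rfl fun k _ => by ring

/-! ### Geometry of tetrahedra -/

lemma mem_convexHull_range {p : Fin 4 → E3} {x : E3} (hx : x ∈ convexHull ℝ (Set.range p)) :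
    ∃ w : Fin 4 → ℝ, (∀ i, 0 ≤ w i) ∧ ∑ i, w i = 1 ∧ ∑ i, w i • p i = x := by
  classical
  have hsub : convexHull ℝ (Set.range p) ⊆
      {x | ∃ w : Fin 4 → ℝ, (∀ i, 0 ≤ w i) ∧ ∑ i, w i = 1 ∧ ∑ i, w i • p i = x} := by
    refine convexHull_min ?_ ?_
    · rintro _ ⟨i, rfl⟩
      refine ⟨Pi.single i 1, fun j => ?_, by simp, by simp [Pi.single_apply]⟩
      by_cases h : j = i
      · subst h; simp
      · simp [h]
    · rintro x ⟨w, h1, h2, rfl⟩ y ⟨v, h3, h4, rfl⟩ a b ha hb hab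
      refine ⟨fun i => a * w i + b * v i, fun i => ?_, ?_, ?_⟩
      · have := h1 i; have := h3 i; positivity
      · rw [Finset.sum_add_distrib, ← Finset.mul_sum, ← Finset.mul_sum, h2, h4]; linarith
      · simp only [add_smul, Finset.sum_add_distrib, mul_smul, ← Finset.smul_sum]
  exact hsub hx

lemma mem_facet_of_weight_eq_zero {p : Fin 4 → E3} {w : Fin 4 → ℝ} (h0 : ∀ i, 0 ≤ w i)
    (h1 : ∑ i, w i = 1) {k : Fin 4} (hk : w k = 0) :
    ∑ i, w i • p i ∈ convexHull ℝ (Set.range (p ∘ k.succAbove)) := by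
  rw [Fin.sum_univ_succAbove _ k] at h1 ⊢
  rw [hk, zero_add] at h1
  rw [hk, zero_smul, zero_add]
  exact (convex_convexHull ℝ _).sum_mem (fun i _ => h0 _) h1
    fun i _ => subset_convexHull ℝ _ ⟨i, rfl⟩

lemma facet_subset {p : Fin 4 → E3} (k : Fin 4) :
    convexHull ℝ (Set.range (p ∘ k.succAbove)) ⊆ convexHull ℝ (Set.range p) :=
  convexHull_mono (Set.range_comp_subset_range _ _)

namespace IsOutwardNormals

variable {p N : Fin 4 → E3} (hN : IsOutwardNormals p N)

/-- The offset of the plane of the `k`-th facet. -/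
def offset (p N : Fin 4 → E3) (k : Fin 4) : ℝ := inner ℝ (N k) (p (k.succAbove 0))

include hN

lemma inner_vertex {k i : Fin 4} (hi : i ≠ k) : inner ℝ (N k) (p i) = offset p N k := by
  have := hN.inner_facet k i (k.succAbove 0) hi (Fin.succAbove_ne k 0)
  rw [inner_sub_right] at this
  unfold offset
  linarith

lemma inner_opposite_lt (k : Fin 4) : inner ℝ (N k) (p k) < offset p N k := by
  have := hN.inner_pos k (k.succAbove 0) (Fin.succAbove_ne k 0)
  rw [inner_sub_right] at this
  unfold offset
  linarith

lemma facet_subset_plane (k : Fin 4) :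
    convexHull ℝ (Set.range (p ∘ k.succAbove)) ⊆ plane (N k) (offset p N k) := by
  refine convexHull_min ?_ ?_
  · rintro _ ⟨i, rfl⟩
    exact hN.inner_vertex (Fin.succAbove_ne k i)
  · exact convex_hyperplane ((innerSL ℝ (N k)).toLinearMap.isLinear) _

lemma inner_le {k : Fin 4} {x : E3} (hx : x ∈ convexHull ℝ (Set.range p)) :
    inner ℝ (N k) x ≤ offset p N k := by
  have : convexHull ℝ (Set.range p) ⊆ {x | (innerSL ℝ (N k)) x ≤ offset p N k} := by
    refine convexHull_min ?_ ?_
    · rintro _ ⟨i, rfl⟩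
      by_cases h : i = k
      · subst h; exact (hN.inner_opposite_lt _).le
      · exact (hN.inner_vertex h).le
    · exact convex_halfSpace_le ((innerSL ℝ (N k)).toLinearMap.isLinear) _
  exact this hx

/-- Only the opposite vertex lies strictly below the plane of the facet, so its barycentric weight
must vanish. -/
lemma mem_facet_of_mem_plane {k : Fin 4} {x : E3} (hx : x ∈ convexHull ℝ (Set.range p))
    (hk : x ∈ plane (N k) (offset p N k)) : x ∈ convexHull ℝ (Set.range (p ∘ k.succAbove)) := by
  obtain ⟨w, h0, h1, rfl⟩ := mem_convexHull_range hx
  refine mem_facet_of_weight_eq_zero h0 h1 ?_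
  have h2 : inner ℝ (N k) (∑ i, w i • p i) = offset p N k := hk
  simp only [inner_sum, real_inner_smul_right] at h2
  rw [Fin.sum_univ_succAbove _ k] at h1 h2
  have h3 : ∀ i, w (k.succAbove i) * inner ℝ (N k) (p (k.succAbove i)) =
      w (k.succAbove i) * offset p N k := fun i => by
    rw [hN.inner_vertex (Fin.succAbove_ne k i)]
  simp only [h3, ← Finset.sum_mul] at h2
  have h4 := hN.inner_opposite_lt k
  have h5 : w k * (inner ℝ (N k) (p k) - offset p N k) = 0 := by
    linear_combination h2 - offset p N k * h1
  rcases mul_eq_zero.1 h5 with h | h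
  · exact h
  · linarith

/-- For a third vertex `j`, the edge from `l` to `j` lies in the facet opposite `k`, hence is
orthogonal to `N k`, whereas `N l` is positive on it. -/
lemma normal_injective {k l : Fin 4} (hkl : k ≠ l) : N k ≠ N l := by
  intro h
  obtain ⟨j, hjk, hjl⟩ : ∃ j : Fin 4, j ≠ k ∧ j ≠ l := by clear h; revert k l; decide
  have h1 := hN.inner_pos l j hjl
  have h2 := hN.inner_facet k j l hjk hkl.symm
  rw [h] at h2
  linarith

/-- A facet meeting a supporting plane in positive area spans this plane. -/
lemma eq_of_area_pos {k : Fin 4} {m : E3} {c : ℝ} (hm : ‖m‖ = 1)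
    (hsup : ∀ x ∈ convexHull ℝ (Set.range p), inner ℝ m x ≤ c)
    (h : (μHE[2] : Measure E3) (convexHull ℝ (Set.range (p ∘ k.succAbove)) ∩ plane m c) ≠ 0) :
    m = N k ∧ c = offset p N k := by
  have h' : (μHE[2] : Measure E3) (plane (N k) (offset p N k) ∩ plane m c) ≠ 0 := fun h0 =>
    h (measure_mono_null (Set.inter_subset_inter_left _ (hN.facet_subset_plane k)) h0)
  rcases plane_eq_of_area_pos (hN.norm_eq k) hm h' with h1 | ⟨h1, h2⟩
  · exact h1
  -- For `m = -N k` the vertex `p k` would violate the supporting inequality, as it lies strictly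
  -- below the plane of its opposite facet.
  · exfalso
    have h3 := hsup (p k) (subset_convexHull ℝ _ ⟨k, rfl⟩)
    rw [h1, h2, inner_neg_left] at h3
    linarith [hN.inner_opposite_lt k]

end IsOutwardNormals

/-- If all barycentric weights of a contact point were positive, every vertex would lie in the
supporting plane and the tetrahedron would be contained in it. -/
lemma exists_mem_facet_of_supporting {p : Fin 4 → E3} {m : E3} {c : ℝ}
    (hsup : ∀ x ∈ convexHull ℝ (Set.range p), inner ℝ m x ≤ c)
    (hflat : ¬ ∀ x ∈ convexHull ℝ (Set.range p), inner ℝ m x = c) {x : E3}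
    (hx : x ∈ convexHull ℝ (Set.range p)) (hxm : inner ℝ m x = c) :
    ∃ k : Fin 4, x ∈ convexHull ℝ (Set.range (p ∘ k.succAbove)) := by
  obtain ⟨w, h0, h1, rfl⟩ := mem_convexHull_range hx
  by_contra! hk
  have hpos : ∀ k, w k ≠ 0 := fun k h => hk k (mem_facet_of_weight_eq_zero h0 h1 h)
  refine hflat fun y hy => ?_
  have hv : ∀ i, c - inner ℝ m (p i) = 0 := by
    have hs : ∑ i, w i * (c - inner ℝ m (p i)) = 0 := by
      simp only [mul_sub, Finset.sum_sub_distrib, ← Finset.sum_mul, h1]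
      simp only [inner_sum, real_inner_smul_right] at hxm
      linarith
    have hnn : ∀ i ∈ Finset.univ, 0 ≤ w i * (c - inner ℝ m (p i)) := fun i _ =>
      mul_nonneg (h0 i) (sub_nonneg.2 (hsup _ (subset_convexHull ℝ _ ⟨i, rfl⟩)))
    intro i
    exact (mul_eq_zero.1 ((Finset.sum_eq_zero_iff_of_nonneg hnn).1 hs i
      (Finset.mem_univ i))).resolve_left (hpos i)
  obtain ⟨v, -, h4, rfl⟩ := mem_convexHull_range hy
  simp only [inner_sum, real_inner_smul_right]
  have : ∀ i, v i * inner ℝ m (p i) = v i * c := fun i => by rw [← sub_eq_zero.1 (hv i)]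
  simp only [this, ← Finset.sum_mul, h4, one_mul]

/-- The flux through the part of the boundary of a tetrahedron that lies in a supporting plane. -/
lemma sum_flux_inter_supporting {p N : Fin 4 → E3} (hN : IsOutwardNormals p N) {m : E3} {c : ℝ}
    (hm : ‖m‖ = 1) (hsup : ∀ x ∈ convexHull ℝ (Set.range p), inner ℝ m x ≤ c)
    (hflat : ¬ ∀ x ∈ convexHull ℝ (Set.range p), inner ℝ m x = c) {I : Set E3}
    (hI : I ⊆ convexHull ℝ (Set.range p)) (hIm : I ⊆ plane m c) (G : E3 → E3) :
    ∑ k, ∫ x in convexHull ℝ (Set.range (p ∘ k.succAbove)) ∩ I, inner ℝ (N k) (G x) ∂μHE[2] =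
      ∫ x in I, inner ℝ m (G x) ∂μHE[2] := by
  -- Either one facet spans the plane; then it contains `I`, and the others meet `I` in null sets.
  -- Or every facet meets the plane in a null set, and `I`, being covered by the facets, is null.
  by_cases h : ∃ k : Fin 4, (μHE[2] : Measure E3)
      (convexHull ℝ (Set.range (p ∘ k.succAbove)) ∩ plane m c) ≠ 0
  · obtain ⟨k, hk⟩ := h
    obtain ⟨h1, h2⟩ := hN.eq_of_area_pos hm hsup hk
    rw [Finset.sum_eq_single k]
    · rw [Set.inter_eq_right.2 fun x hx => hN.mem_facet_of_mem_plane (hI hx)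
        (by rw [← h1, ← h2]; exact hIm hx), h1]
    · intro l _ hl
      refine setIntegral_measure_zero _ ?_
      by_contra h0
      have h3 := hN.eq_of_area_pos (k := l) hm hsup fun h4 =>
        h0 (measure_mono_null (Set.inter_subset_inter_right _ hIm) h4)
      exact hN.normal_injective hl (h3.1.symm.trans h1)
    · intro hk'; exact absurd (Finset.mem_univ k) hk'
  · push Not at h
    rw [Finset.sum_eq_zero fun k _ => setIntegral_measure_zero _
      (measure_mono_null (Set.inter_subset_inter_right _ hIm) (h k)), setIntegral_measure_zero]
    refine measure_mono_null (fun x hx => ?_) (measure_iUnion_null h)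
    obtain ⟨k, hk⟩ := exists_mem_facet_of_supporting hsup hflat (hI hx) (hIm hx)
    exact Set.mem_iUnion.2 ⟨k, hk, hIm hx⟩

/-! ### Geometry of simplicial meshes -/

namespace SimplicialMesh

variable {D : Cuboid} (T : SimplicialMesh D)

lemma interior_elem_nonempty (i : Fin T.card) : (interior (T.elem i)).Nonempty := by
  unfold SimplicialMesh.elem
  rw [interior_convexHull_nonempty_iff_affineSpan_eq_top,
    (T.affineIndependent i).affineSpan_eq_top_iff_card_eq_finrank_add_one]
  simp

lemma isClosed_elem (i : Fin T.card) : IsClosed (T.elem i) := (isCompact_elem T i).isClosed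

/-- An interior point can be moved slightly in the direction `m` without leaving the element. -/
lemma not_flat (i : Fin T.card) {m : E3} (hm : ‖m‖ = 1) (c : ℝ) :
    ¬ ∀ x ∈ T.elem i, inner ℝ m x = c := by
  intro h
  obtain ⟨x, hx⟩ := T.interior_elem_nonempty i
  have hc : Continuous fun t : ℝ => x + t • m := by fun_prop
  have h1 : ∀ᶠ t : ℝ in 𝓝 0, x + t • m ∈ interior (T.elem i) :=
    hc.continuousAt.eventually (isOpen_interior.mem_nhds (by simpa using hx))
  obtain ⟨ε, hε, h2⟩ := Metric.eventually_nhds_iff.1 h1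
  have h3 := h _ (interior_subset (h2 (y := ε / 2) (by
    rw [Real.dist_eq, sub_zero, abs_of_pos (by positivity)]; linarith)))
  have h4 := h x (interior_subset hx)
  rw [inner_add_right, h4, real_inner_smul_right, real_inner_self_eq_norm_sq, hm] at h3
  linarith

/-- Two elements are separated by a plane. -/
lemma exists_separating {i j : Fin T.card} (hij : i ≠ j) :
    ∃ (m : E3) (c : ℝ), ‖m‖ = 1 ∧ (∀ x ∈ T.elem i, inner ℝ m x ≤ c) ∧
      ∀ x ∈ T.elem j, c ≤ inner ℝ m x := by
  have hci : Convex ℝ (T.elem i) := convex_convexHull ℝ _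
  have hcj : Convex ℝ (T.elem j) := convex_convexHull ℝ _
  obtain ⟨f, u, hf1, hf2⟩ := geometric_hahn_banach_open_open hci.interior isOpen_interior
    hcj.interior isOpen_interior (T.disjoint_interior i j hij)
  -- Separation is available for the open interiors; a convex set with nonempty interior lies in the
  -- closure of its interior, so the inequalities extend.
  have hcl : ∀ l, T.elem l ⊆ closure (interior (T.elem l)) := fun l => by
    have hcl : Convex ℝ (T.elem l) := convex_convexHull ℝ _
    rw [hcl.closure_interior_eq_closure_of_nonempty_interior (T.interior_elem_nonempty l)]
    exact subset_closure
  have h1 : ∀ x ∈ T.elem i, f x ≤ u := fun x hx =>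
    closure_minimal (fun y hy => (hf1 y hy).le) (isClosed_le f.continuous continuous_const)
      (hcl i hx)
  have h2 : ∀ x ∈ T.elem j, u ≤ f x := fun x hx =>
    closure_minimal (fun y hy => (hf2 y hy).le) (isClosed_le continuous_const f.continuous)
      (hcl j hx)
  set m₀ : E3 := (InnerProductSpace.toDual ℝ E3).symm f
  have hm₀ : ∀ x, inner ℝ m₀ x = f x := fun x => InnerProductSpace.toDual_symm_apply
  have hne : ‖m₀‖ ≠ 0 := by
    intro h0
    obtain ⟨x, hx⟩ := T.interior_elem_nonempty i
    obtain ⟨y, hy⟩ := T.interior_elem_nonempty j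
    have h3 := hf1 x hx
    have h4 := hf2 y hy
    rw [← hm₀, norm_eq_zero.1 h0, inner_zero_left] at h3 h4
    linarith
  have hpos : 0 < ‖m₀‖⁻¹ := inv_pos.2 (lt_of_le_of_ne (norm_nonneg _) hne.symm)
  refine ⟨‖m₀‖⁻¹ • m₀, ‖m₀‖⁻¹ * u, ?_, fun x hx => ?_, fun x hx => ?_⟩
  · rw [norm_smul, norm_inv, norm_norm, inv_mul_cancel₀ hne]
  · rw [real_inner_smul_left, hm₀]
    exact mul_le_mul_of_nonneg_left (h1 x hx) hpos.le
  · rw [real_inner_smul_left, hm₀]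
    exact mul_le_mul_of_nonneg_left (h2 x hx) hpos.le

lemma facet_subset_elem (i : Fin T.card) (k : Fin 4) : T.facet i k ⊆ T.elem i := facet_subset k

/-- The fluxes through the common boundary of two elements are opposite to each other. -/
lemma sum_flux_face_comm {i j : Fin T.card} (hij : i ≠ j) (G : E3 → E3) :
    ∑ k, ∫ x in T.face i k j, inner ℝ (T.normal i k) (G x) ∂μHE[2] =
      -∑ k, ∫ x in T.face j k i, inner ℝ (T.normal j k) (G x) ∂μHE[2] := by
  obtain ⟨m, c, hm, h1, h2⟩ := T.exists_separating hij
  -- The common part lies in the separating plane, which supports `K_i` with normal `m` and `K_j`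
  -- with normal `-m`. Summing over facets reduces both fluxes to one integral over `K_i ∩ K_j`.
  have hpl : T.elem i ∩ T.elem j ⊆ plane m c := fun x hx => le_antisymm (h1 x hx.1) (h2 x hx.2)
  have hface : ∀ a b k, T.face a k b =
      convexHull ℝ (Set.range (T.vert a ∘ k.succAbove)) ∩ (T.elem a ∩ T.elem b) := by
    intro a b k
    show T.facet a k ∩ T.elem b = T.facet a k ∩ (T.elem a ∩ T.elem b)
    rw [← Set.inter_assoc, Set.inter_eq_left.2 (T.facet_subset_elem a k)]
  have e1 := sum_flux_inter_supporting (isOutwardNormals_normal T i) hm h1 (T.not_flat i hm c)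
    (Set.inter_subset_left : T.elem i ∩ T.elem j ⊆ _) hpl G
  have hm' : ‖-m‖ = 1 := by rw [norm_neg, hm]
  have hpl' : T.elem j ∩ T.elem i ⊆ plane (-m) (-c) := fun x hx => by
    show inner ℝ (-m) x = -c
    rw [inner_neg_left, hpl hx.symm]
  have e2 := sum_flux_inter_supporting (isOutwardNormals_normal T j) hm'
    (fun x hx => by rw [inner_neg_left]; exact neg_le_neg (h2 x hx)) (T.not_flat j hm' (-c))
    (Set.inter_subset_left : T.elem j ∩ T.elem i ⊆ _) hpl' G
  simp only [hface]
  rw [e1, e2, Set.inter_comm (T.elem j)]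
  simp only [inner_neg_left, integral_neg, neg_neg]

/-- Three elements have no common area. -/
lemma area_inter_three {i j l : Fin T.card} (hij : i ≠ j) (hil : i ≠ l) (hjl : j ≠ l) :
    (μHE[2] : Measure E3) (T.elem i ∩ T.elem j ∩ T.elem l) = 0 := by
  by_contra h
  obtain ⟨m, c, hm, h1, h2⟩ := T.exists_separating hij
  obtain ⟨m', c', hm', h1', h2'⟩ := T.exists_separating hil
  obtain ⟨n, d, hn, h3, h4⟩ := T.exists_separating hjl
  have hA : (μHE[2] : Measure E3) (plane m c ∩ plane m' c') ≠ 0 := fun h0 =>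
    h (measure_mono_null (fun x hx => by
      exact ⟨le_antisymm (h1 x hx.1.1) (h2 x hx.1.2),
        le_antisymm (h1' x hx.1.1) (h2' x hx.2)⟩) h0)
  have hB : (μHE[2] : Measure E3) (plane m c ∩ plane n d) ≠ 0 := fun h0 =>
    h (measure_mono_null (fun x hx => by
      exact ⟨le_antisymm (h1 x hx.1.1) (h2 x hx.1.2),
        le_antisymm (h3 x hx.1.2) (h4 x hx.2)⟩) h0)
  -- A common piece of positive area makes the three separating planes coincide; of three elements
  -- two then lie on the same side although the plane separates them, so one of them is flat.
  rcases plane_eq_of_area_pos hm hm' hA with ⟨rfl, rfl⟩ | ⟨rfl, rfl⟩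
  · rcases plane_eq_of_area_pos hm hn hB with ⟨rfl, rfl⟩ | ⟨rfl, rfl⟩
    · exact T.not_flat j hm _ fun x hx => le_antisymm (h3 x hx) (h2 x hx)
    · refine T.not_flat l hm _ fun x hx => le_antisymm ?_ (h2' x hx)
      have := h4 x hx
      rw [inner_neg_left] at this
      linarith
  · refine T.not_flat i hm _ fun x hx => le_antisymm (h1 x hx) ?_
    have := h1' x hx
    rw [inner_neg_left] at this
    linarith

end SimplicialMesh

/-- The outward unit normal of a face of a cuboid. -/
def Cuboid.sideNormal (r : Fin 3 × Bool) : E3 :=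
  if r.2 then EuclideanSpace.single r.1 1 else -EuclideanSpace.single r.1 1

/-- The offset of the plane of a face of a cuboid. -/
def Cuboid.sideOffset (D : Cuboid) (r : Fin 3 × Bool) : ℝ := if r.2 then D.hi r.1 else -D.lo r.1

lemma Cuboid.norm_sideNormal (r : Fin 3 × Bool) : ‖Cuboid.sideNormal r‖ = 1 := by
  unfold Cuboid.sideNormal
  split_ifs <;> simp

lemma Cuboid.inner_sideNormal (r : Fin 3 × Bool) (x : E3) :
    inner ℝ (Cuboid.sideNormal r) x = if r.2 then x r.1 else -x r.1 := by
  unfold Cuboid.sideNormal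
  split_ifs <;> simp [inner_neg_left, EuclideanSpace.inner_single_left]

lemma Cuboid.inner_le_of_mem_closure (D : Cuboid) (r : Fin 3 × Bool) {x : E3}
    (hx : x ∈ closure D.toSet) : inner ℝ (Cuboid.sideNormal r) x ≤ D.sideOffset r := by
  refine closure_minimal (fun y hy => ?_)
    (isClosed_le (by fun_prop : Continuous fun y : E3 => inner ℝ (Cuboid.sideNormal r) y)
      continuous_const) hx
  show inner ℝ (Cuboid.sideNormal r) y ≤ D.sideOffset r
  rw [Cuboid.inner_sideNormal, Cuboid.sideOffset]
  have := hy r.1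
  split_ifs <;> linarith

lemma Cuboid.exists_mem_side (D : Cuboid) {x : E3} (hx : x ∈ closure D.toSet) (hxD : x ∉ D.toSet) :
    ∃ r, x ∈ plane (Cuboid.sideNormal r) (D.sideOffset r) := by
  by_contra! h
  refine hxD fun i => ?_
  have h1 := lt_of_le_of_ne (D.inner_le_of_mem_closure (i, true) hx) (h (i, true))
  have h2 := lt_of_le_of_ne (D.inner_le_of_mem_closure (i, false) hx) (h (i, false))
  rw [Cuboid.inner_sideNormal, Cuboid.sideOffset] at h1 h2
  simp at h1 h2
  exact ⟨h2, h1⟩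

lemma Cuboid.notMem_of_mem_side (D : Cuboid) {x : E3} {r : Fin 3 × Bool}
    (hx : x ∈ plane (Cuboid.sideNormal r) (D.sideOffset r)) : x ∉ D.toSet := by
  intro hD
  have h1 : inner ℝ (Cuboid.sideNormal r) x = D.sideOffset r := hx
  rw [Cuboid.inner_sideNormal, Cuboid.sideOffset] at h1
  have := hD r.1
  split_ifs at h1 <;> linarith

/-! ### Exterior faces and the decomposition of a facet -/

namespace SimplicialMesh

variable {D : Cuboid} (T : SimplicialMesh D)

lemma elem_subset_closure (i : Fin T.card) : T.elem i ⊆ closure D.toSet := by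
  rw [← T.iUnion_eq]
  exact Set.subset_iUnion (fun i => convexHull ℝ (Set.range (T.vert i))) i

/-- A facet that meets a side of the cuboid in positive area is an exterior face. -/
lemma isExtFace_of_area_pos {i : Fin T.card} {k : Fin 4} {r : Fin 3 × Bool}
    (h : (μHE[2] : Measure E3)
      (T.facet i k ∩ plane (Cuboid.sideNormal r) (D.sideOffset r)) ≠ 0) : T.IsExtFace i k := by
  have hN := isOutwardNormals_normal T i
  obtain ⟨h1, h2⟩ := hN.eq_of_area_pos (Cuboid.norm_sideNormal r)
    (fun x hx => D.inner_le_of_mem_closure r (T.elem_subset_closure i hx)) h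
  intro x hx
  rw [D.isOpen.frontier_eq]
  refine ⟨T.elem_subset_closure i (T.facet_subset_elem i k hx), D.notMem_of_mem_side (r := r) ?_⟩
  rw [h1, h2]
  exact hN.facet_subset_plane k hx

/-- An exterior face shares no area with another element. -/
lemma area_face_of_isExtFace {i j : Fin T.card} (hij : i ≠ j) {k : Fin 4} (hk : T.IsExtFace i k) :
    (μHE[2] : Measure E3) (T.face i k j) = 0 := by
  obtain ⟨m, c, hm, h1, h2⟩ := T.exists_separating hij
  refine measure_mono_null (t := ⋃ r, T.face i k j ∩
    plane (Cuboid.sideNormal r) (D.sideOffset r)) (fun x hx => ?_) (measure_iUnion_null fun r => ?_)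
  · have hf := hk hx.1
    rw [D.isOpen.frontier_eq] at hf
    obtain ⟨r, hr⟩ := D.exists_mem_side hf.1 hf.2
    exact Set.mem_iUnion.2 ⟨r, hx, hr⟩
  · by_contra h
    have hA : (μHE[2] : Measure E3)
        (plane m c ∩ plane (Cuboid.sideNormal r) (D.sideOffset r)) ≠ 0 := fun h0 =>
      h (measure_mono_null (fun x hx => by
        exact ⟨le_antisymm (h1 x (T.facet_subset_elem i k hx.1.1)) (h2 x hx.1.2), hx.2⟩) h0)
    have hside := fun l x (hx : x ∈ T.elem l) =>
      D.inner_le_of_mem_closure r (T.elem_subset_closure l hx)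
    -- All elements lie on the inner side of a side plane of the cuboid; if that plane separated two
    -- of them, one would be flat.
    rcases plane_eq_of_area_pos hm (Cuboid.norm_sideNormal r) hA with ⟨h3, h4⟩ | ⟨h3, h4⟩
    · rw [h3, h4] at hside
      exact T.not_flat j hm c fun x hx => le_antisymm (hside j x hx) (h2 x hx)
    · rw [h3, h4] at hside
      refine T.not_flat i hm c fun x hx => le_antisymm (h1 x hx) ?_
      have := hside i x hx
      rw [inner_neg_left] at this
      linarith

/-- Points slightly beyond the facet in the direction of the outward normal are still in the cuboid
but not in `K_i`. They lie in the closed union of the other elements, and so does their limit `x`.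
-/
lemma mem_elem_of_mem_facet {i : Fin T.card} {k : Fin 4} {x : E3} (hx : x ∈ T.facet i k)
    (hxD : x ∈ D.toSet) : ∃ j, i ≠ j ∧ x ∈ T.elem j := by
  have hN := isOutwardNormals_normal T i
  have hcl : IsClosed (⋃ j : {j // i ≠ j}, T.elem j) :=
    isClosed_iUnion_of_finite fun j => T.isClosed_elem j
  have hc : Continuous fun t : ℝ => x + t • T.normal i k := by fun_prop
  have hlim : Tendsto (fun t : ℝ => x + t • T.normal i k) (𝓝[>] 0) (𝓝 x) := by
    have := hc.tendsto 0
    rw [zero_smul, add_zero] at this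
    exact this.mono_left nhdsWithin_le_nhds
  have hev : ∀ᶠ t : ℝ in 𝓝[>] 0, x + t • T.normal i k ∈ ⋃ j : {j // i ≠ j}, T.elem j := by
    filter_upwards [hlim.eventually (D.isOpen.mem_nhds hxD), self_mem_nhdsWithin] with t ht ht0
    obtain ⟨j, hj⟩ := exists_mem_elem T ht
    refine Set.mem_iUnion.2 ⟨⟨j, ?_⟩, hj⟩
    rintro rfl
    have h1 := hN.inner_le (k := k) hj
    have h2 : inner ℝ (T.normal i k) x = _ := hN.facet_subset_plane k hx
    rw [inner_add_right, h2, real_inner_smul_right, real_inner_self_eq_norm_sq, hN.norm_eq] at h1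
    have : (0 : ℝ) < t := ht0
    linarith
  obtain ⟨j, hj⟩ := Set.mem_iUnion.1 (hcl.mem_of_tendsto hlim hev)
  exact ⟨j, j.2, hj⟩

open scoped Classical in
/-- Decomposition of the integral over a facet. -/
lemma setIntegral_facet_eq (i : Fin T.card) (k : Fin 4) {g : E3 → ℝ} (hg : Continuous g) :
    ∫ x in T.facet i k, g x ∂μHE[2] =
      (if T.IsExtFace i k then ∫ x in T.facet i k, g x ∂μHE[2] else 0) +
        ∑ j, if i ≠ j then ∫ x in T.face i k j, g x ∂μHE[2] else 0 := by
  by_cases hext : T.IsExtFace i k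
  · rw [if_pos hext, Finset.sum_eq_zero, add_zero]
    intro j _
    split_ifs with hij
    · exact setIntegral_measure_zero _ (T.area_face_of_isExtFace hij hext)
    · rfl
  · rw [if_neg hext, zero_add]
    -- A facet that is not exterior meets the boundary of the cuboid in a null set, hence is covered
    -- up to a null set by its intersections with other elements; these overlap in null sets only.
    have hnull : ∀ r, (μHE[2] : Measure E3)
        (T.facet i k ∩ plane (Cuboid.sideNormal r) (D.sideOffset r)) = 0 := fun r => by
      by_contra h
      exact hext (T.isExtFace_of_area_pos h)
    have hcover : T.facet i k =ᵐ[μHE[2]] ⋃ j : {j // i ≠ j}, T.face i k j := by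
      refine EventuallyLE.antisymm ?_ (LE.le.eventuallyLE ?_)
      · rw [ae_le_set]
        refine measure_mono_null (fun x hx => ?_) (measure_iUnion_null hnull)
        by_cases hxD : x ∈ D.toSet
        · obtain ⟨j, hj, hxj⟩ := T.mem_elem_of_mem_facet hx.1 hxD
          have hm : x ∈ T.face i k j := ⟨hx.1, hxj⟩
          exact absurd (Set.mem_iUnion.2 ⟨⟨j, hj⟩, hm⟩) hx.2
        · obtain ⟨r, hr⟩ := D.exists_mem_side
            (T.elem_subset_closure i (T.facet_subset_elem i k hx.1)) hxD
          exact Set.mem_iUnion.2 ⟨r, hx.1, hr⟩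
      · exact Set.iUnion_subset fun j => Set.inter_subset_left
    rw [setIntegral_congr_set hcover, integral_iUnion_ae, tsum_fintype, ← Finset.sum_filter]
    · exact (Finset.sum_subtype (Finset.univ.filter fun j => i ≠ j) (by simp)
        (fun j => ∫ x in T.face i k j, g x ∂μHE[2])).symm
    · exact fun j => (isCompact_face T i k j).measurableSet.nullMeasurableSet
    · intro j l hjl
      refine measure_mono_null (t := T.elem i ∩ T.elem j ∩ T.elem l) (fun x hx => ?_)
        (T.area_inter_three j.2 l.2 fun h => hjl (Subtype.ext h))
      exact ⟨⟨T.facet_subset_elem i k hx.1.1, hx.1.2⟩, hx.2.2⟩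
    · exact (integrableOn_of_compact (isCompact_facet T i k) (facet_area_lt_top T i k) hg).mono_set
        (Set.iUnion_subset fun j => Set.inter_subset_left)

end SimplicialMesh

/-! ### Dissipativity of the discrete Maxwell operator -/

/-- The Poynting vector `E × H`. -/
def poynting (p : E3 →ᵃ[ℝ] E6) (x : E3) : E3 := cross (elec p x) (magn p x)

lemma hasFDerivAt_affine_apply (p : E3 →ᵃ[ℝ] E6) (j : Fin 6) (x : E3) :
    HasFDerivAt (fun y => p y j)
      ((EuclideanSpace.proj j : E6 →L[ℝ] ℝ).comp (LinearMap.toContinuousLinearMap p.linear)) x := by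
  have h2 : (fun y => p y j) = fun y =>
      ((EuclideanSpace.proj j : E6 →L[ℝ] ℝ).comp (LinearMap.toContinuousLinearMap p.linear)) y
        + p 0 j := by
    funext y
    have := congrFun p.decomp y
    simp only [Pi.add_apply] at this
    rw [this]
    simp
  rw [h2]
  exact (ContinuousLinearMap.hasFDerivAt _).add_const _

lemma contDiff_affine_apply (p : E3 →ᵃ[ℝ] E6) (j : Fin 6) : ContDiff ℝ 1 (fun y => p y j) := by
  have h : (fun y => p y j) = fun y =>
      ((EuclideanSpace.proj j : E6 →L[ℝ] ℝ).comp (LinearMap.toContinuousLinearMap p.linear)) y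
        + p 0 j := by
    funext y
    have := congrFun p.decomp y
    simp only [Pi.add_apply] at this
    rw [this]
    simp
  rw [h]
  fun_prop

lemma contDiff_poynting_apply (p : E3 →ᵃ[ℝ] E6) (m : Fin 3) :
    ContDiff ℝ 1 (fun y => poynting p y m) := by
  have h := contDiff_affine_apply p
  fin_cases m <;>
  · simp only [poynting, cross, cross_apply, elec, magn]
    simp
    exact ((h _).mul (h _)).sub ((h _).mul (h _))

lemma continuous_poynting (p : E3 →ᵃ[ℝ] E6) : Continuous (poynting p) :=
  (PiLp.continuous_toLp 2 _).comp
    (continuous_pi fun m => (contDiff_poynting_apply p m).continuous)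

lemma pderiv_poynting (p : E3 →ᵃ[ℝ] E6) (m : Fin 3) (i j k l : Fin 6)
    (h : ∀ y, poynting p y m = p y i * p y j - p y k * p y l) (r : Fin 3) (x : E3) :
    fderiv ℝ (fun y => poynting p y m) x (EuclideanSpace.single r 1) =
      p x i * p.linear (EuclideanSpace.single r 1) j + p x j * p.linear (EuclideanSpace.single r 1) i
      - (p x k * p.linear (EuclideanSpace.single r 1) l +
        p x l * p.linear (EuclideanSpace.single r 1) k) := by
  simp only [h]
  have d := fun j => hasFDerivAt_affine_apply p j x
  have e := (((d i).mul (d j)).sub ((d k).mul (d l))).fderiv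
  have e' := congrArg (fun A => A (EuclideanSpace.single r 1)) e
  refine e'.trans ?_
  simp

/-- The identity `div (E × H) = H · curl E - E · curl H`, with both curls constant on the element.
-/
lemma volTerm_self (p : E3 →ᵃ[ℝ] E6) (x : E3) :
    volTerm p p x =
      -∑ m, fderiv ℝ (fun y => poynting p y m) x (EuclideanSpace.single m 1) := by
  rw [Fin.sum_univ_three,
    pderiv_poynting p 0 1 5 2 4 (fun y => by simp [poynting, cross, cross_apply, elec, magn]),
    pderiv_poynting p 1 2 3 0 5 (fun y => by simp [poynting, cross, cross_apply, elec, magn]),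
    pderiv_poynting p 2 0 4 1 3 (fun y => by simp [poynting, cross, cross_apply, elec, magn])]
  simp only [volTerm, curl_elec, curl_magn, PiLp.inner_apply, Fin.sum_univ_three]
  simp [elec, magn]
  ring

/-- The centred terms add up exactly to the difference of the two Poynting fluxes; the upwind terms
are minus half the squared tangential jumps. -/
lemma intTerm_self_le (n : E3) (p p' : E3 →ᵃ[ℝ] E6) (x : E3) :
    1 / 2 * intTerm n p p' p p' x ≤ inner ℝ n (poynting p x) - inner ℝ n (poynting p' x) := by
  have h : 1 / 2 * intTerm n p p' p p' x = inner ℝ n (poynting p x) - inner ℝ n (poynting p' x)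
      - 1 / 2 * inner ℝ (cross n (elec p' x - elec p x)) (cross n (elec p' x - elec p x))
      - 1 / 2 * inner ℝ (cross n (magn p' x - magn p x)) (cross n (magn p' x - magn p x)) := by
    simp only [intTerm, poynting, cross, cross_apply, PiLp.inner_apply, Fin.sum_univ_three]
    simp
    ring
  have h1 := real_inner_self_nonneg (x := cross n (elec p' x - elec p x))
  have h2 := real_inner_self_nonneg (x := cross n (magn p' x - magn p x))
  linarith

/-- Here `⟨n × E, H⟩ = ⟨n, E × H⟩`, and the penalty subtracts `‖n × E‖²`. -/
lemma extTerm_self_le (n : E3) (p : E3 →ᵃ[ℝ] E6) (x : E3) :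
    extTerm n p p x ≤ inner ℝ n (poynting p x) := by
  have h : extTerm n p p x = inner ℝ n (poynting p x)
      - inner ℝ (cross n (elec p x)) (cross n (elec p x)) := by
    simp only [extTerm, poynting, cross, cross_apply, PiLp.inner_apply, Fin.sum_univ_three]
    simp
    ring
  have h1 := real_inner_self_nonneg (x := cross n (elec p x))
  linarith

lemma continuous_flux (n : E3) (p : E3 →ᵃ[ℝ] E6) :
    Continuous fun x => inner ℝ n (poynting p x) :=
  continuous_const.inner (continuous_poynting p)

/-! ### Summation of the Poynting fluxes over the mesh -/

namespace SimplicialMesh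

variable (T : SimplicialMesh D)

lemma face_area_lt_top (i : Fin T.card) (k : Fin 4) (j : Fin T.card) :
    (μHE[2] : Measure E3) (T.face i k j) < ⊤ :=
  (measure_mono Set.inter_subset_left).trans_lt (facet_area_lt_top T i k)

/-- Gauss' theorem for the volume part of the discrete Maxwell form. -/
lemma integral_volTerm_self (i : Fin T.card) (p : E3 →ᵃ[ℝ] E6) :
    ∫ x in T.elem i, volTerm p p x =
      -∑ k, ∫ x in T.facet i k, inner ℝ (T.normal i k) (poynting p x) ∂μHE[2] := by
  have hint : ∀ m : Fin 3, IntegrableOn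
      (fun x => fderiv ℝ (fun y => poynting p y m) x (EuclideanSpace.single m 1)) (T.elem i) :=
    fun m => integrableOn_of_compact (isCompact_elem T i) (isCompact_elem T i).measure_lt_top
      (((contDiff_poynting_apply p m).continuous_fderiv (by simp)).clm_apply continuous_const)
  have hc : ∀ m : Fin 3, Continuous fun x => poynting p x m := fun m =>
    (contDiff_poynting_apply p m).continuous
  simp only [volTerm_self]
  rw [integral_neg, integral_finsetSum _ fun m _ => hint m]
  congr 1
  have h1 : ∀ m : Fin 3,
      ∫ x in T.elem i, fderiv ℝ (fun y => poynting p y m) x (EuclideanSpace.single m 1) =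
        ∑ k, ∫ x in T.facet i k, T.normal i k m * poynting p x m ∂μHE[2] := fun m => by
    have := integral_fderiv_tetrahedron (T.affineIndependent i) (isOutwardNormals_normal T i)
      (EuclideanSpace.single m 1) (contDiff_poynting_apply p m)
    refine this.trans (Finset.sum_congr rfl fun k _ => ?_)
    rw [EuclideanSpace.inner_single_right, integral_const_mul]
    simp [SimplicialMesh.facet]
  simp only [h1]
  rw [Finset.sum_comm]
  refine Finset.sum_congr rfl fun k _ => ?_
  have hint' : ∀ m ∈ Finset.univ, IntegrableOn (fun x => T.normal i k m * poynting p x m)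
      (T.facet i k) μHE[2] := fun m _ => integrableOn_of_compact (isCompact_facet T i k)
    (facet_area_lt_top T i k) (continuous_const.mul (hc m))
  rw [← integral_finsetSum _ hint']
  refine integral_congr_ae (ae_of_all _ fun x => ?_)
  simp [PiLp.inner_apply, mul_comm]

/-- The flux of the Poynting vector of `p` out of `K_i` into `K_j`. -/
def flux (i j : Fin T.card) (p : E3 →ᵃ[ℝ] E6) : ℝ :=
  ∑ k, ∫ x in T.face i k j, inner ℝ (T.normal i k) (poynting p x) ∂μHE[2]

open scoped Classical in
-- The orientation `fwd` selects each pair of neighbours once and yields the flux out of `K_i` minus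
-- the flux of the neighbour's field through the same face. By `sum_flux_face_comm` the latter is
-- the flux out of `K_j` with the opposite sign, so both ordered pairs are recovered.
lemma sum_intTerm_self_le (p : Fin T.card → E3 →ᵃ[ℝ] E6) :
    1 / 2 * (∑ i, ∑ k, ∑ j, if T.IsIntFace i k j then
        ∫ x in T.face i k j, intTerm (T.normal i k) (p i) (p j) (p i) (p j) x ∂μHE[2] else 0) ≤
      ∑ i, ∑ j, if i ≠ j then T.flux i j (p i) else 0 := by
  have h1 : ∀ i k j, 1 / 2 * (if T.IsIntFace i k j then
        ∫ x in T.face i k j, intTerm (T.normal i k) (p i) (p j) (p i) (p j) x ∂μHE[2] else 0) ≤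
      if i ≠ j ∧ T.fwd i j then
        (∫ x in T.face i k j, inner ℝ (T.normal i k) (poynting (p i) x) ∂μHE[2]) -
          ∫ x in T.face i k j, inner ℝ (T.normal i k) (poynting (p j) x) ∂μHE[2] else 0 := by
    intro i k j
    by_cases hij : i ≠ j ∧ T.fwd i j
    · rw [if_pos hij]
      have hint : ∀ {f : E3 → ℝ}, Continuous f → IntegrableOn f (T.face i k j) μHE[2] :=
        fun hf => integrableOn_of_compact (isCompact_face T i k j) (T.face_area_lt_top i k j) hf
      -- Contacts of zero area are excluded from the form but carry no integral, so they may be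
      -- added freely.
      by_cases h0 : (μHE[2] : Measure E3) (T.face i k j) = 0
      · simp [setIntegral_measure_zero _ h0]
      · rw [if_pos ⟨hij.1, hij.2, pos_iff_ne_zero.2 h0⟩,
          ← integral_sub (hint (continuous_flux _ _)) (hint (continuous_flux _ _)),
          ← integral_const_mul]
        exact integral_mono ((hint (continuous_intTerm _ _ _ _ _)).const_mul _)
          ((hint (continuous_flux _ _)).sub (hint (continuous_flux _ _)))
          fun x => intTerm_self_le _ _ _ x
    · rw [if_neg hij, if_neg fun h => hij ⟨h.1, h.2.1⟩, mul_zero]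
  -- The sum over the facets has to be taken before the two sides are compared, since the
  -- antisymmetry of the flux is stated for the whole common boundary.
  have h2 : ∀ i j, (∑ k, if i ≠ j ∧ T.fwd i j then
        (∫ x in T.face i k j, inner ℝ (T.normal i k) (poynting (p i) x) ∂μHE[2]) -
          ∫ x in T.face i k j, inner ℝ (T.normal i k) (poynting (p j) x) ∂μHE[2] else 0) =
      if i ≠ j ∧ T.fwd i j then T.flux i j (p i) + T.flux j i (p j) else 0 := by
    intro i j
    split_ifs with hij
    · rw [Finset.sum_sub_distrib, T.sum_flux_face_comm hij.1 (poynting (p j)), sub_neg_eq_add]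
      rfl
    · simp
  have h3 : ∀ i j, (if i ≠ j ∧ T.fwd i j then T.flux i j (p i) else 0) +
      (if j ≠ i ∧ T.fwd j i then T.flux i j (p i) else 0) =
      if i ≠ j then T.flux i j (p i) else 0 := by
    intro i j
    by_cases hij : i = j
    · simp [hij]
    · have hji : j ≠ i := fun h => hij h.symm
      have := T.fwd_iff i j hij
      by_cases hf : T.fwd i j
      · have h' := this.1 hf
        simp [hij, hf, h']
      · have h' : T.fwd j i := by tauto
        simp [hij, hji, hf, h']
  calc _ = ∑ i, ∑ k, ∑ j, 1 / 2 * (if T.IsIntFace i k j then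
        ∫ x in T.face i k j, intTerm (T.normal i k) (p i) (p j) (p i) (p j) x ∂μHE[2] else 0) := by
        simp only [Finset.mul_sum]
    _ ≤ ∑ i, ∑ k, ∑ j, if i ≠ j ∧ T.fwd i j then
        (∫ x in T.face i k j, inner ℝ (T.normal i k) (poynting (p i) x) ∂μHE[2]) -
          ∫ x in T.face i k j, inner ℝ (T.normal i k) (poynting (p j) x) ∂μHE[2] else 0 :=
        Finset.sum_le_sum fun i _ => Finset.sum_le_sum fun k _ => Finset.sum_le_sum fun j _ =>
          h1 i k j
    _ = ∑ i, ∑ j, if i ≠ j ∧ T.fwd i j then T.flux i j (p i) + T.flux j i (p j) else 0 := by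
        refine Finset.sum_congr rfl fun i _ => ?_
        rw [Finset.sum_comm]
        exact Finset.sum_congr rfl fun j _ => h2 i j
    _ = (∑ i, ∑ j, if i ≠ j ∧ T.fwd i j then T.flux i j (p i) else 0) +
        ∑ i, ∑ j, if i ≠ j ∧ T.fwd i j then T.flux j i (p j) else 0 := by
        simp only [← Finset.sum_add_distrib]
        refine Finset.sum_congr rfl fun i _ => Finset.sum_congr rfl fun j _ => ?_
        split_ifs <;> simp
    _ = _ := by
        rw [Finset.sum_comm (f := fun i j => if i ≠ j ∧ T.fwd i j then T.flux j i (p j) else 0)]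
        simp only [← Finset.sum_add_distrib, h3]

end SimplicialMesh

/-- The Gauss theorem splits the volume part into minus the exterior flux and minus the fluxes
between elements; the exterior and interior face terms are bounded by exactly these quantities. -/
lemma dgForm_self_nonpos (T : SimplicialMesh D) (u : dgSpace T) : dgForm T u u ≤ 0 := by
  classical
  have hvol : ∑ i, ∫ x in T.elem i, volTerm (trace T i u) (trace T i u) x =
      -(∑ i, ∑ k, if T.IsExtFace i k then
        ∫ x in T.facet i k, inner ℝ (T.normal i k) (poynting (trace T i u) x) ∂μHE[2] else 0)
      - ∑ i, ∑ j, if i ≠ j then T.flux i j (trace T i u) else 0 := by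
    rw [← neg_add', ← Finset.sum_add_distrib, ← Finset.sum_neg_distrib]
    refine Finset.sum_congr rfl fun i _ => ?_
    rw [T.integral_volTerm_self]
    congr 1
    rw [Finset.sum_congr rfl fun k _ => T.setIntegral_facet_eq i k (continuous_flux _ _),
      Finset.sum_add_distrib, Finset.sum_comm (γ := Fin 4)]
    congr 1
    refine Finset.sum_congr rfl fun j _ => ?_
    split_ifs <;> simp [SimplicialMesh.flux]
  have hext : (∑ i, ∑ k, if T.IsExtFace i k then
        ∫ x in T.facet i k, extTerm (T.normal i k) (trace T i u) (trace T i u) x ∂μHE[2] else 0) ≤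
      ∑ i, ∑ k, if T.IsExtFace i k then
        ∫ x in T.facet i k, inner ℝ (T.normal i k) (poynting (trace T i u) x) ∂μHE[2] else 0 := by
    refine Finset.sum_le_sum fun i _ => Finset.sum_le_sum fun k _ => ?_
    split_ifs
    · have hint : ∀ {f : E3 → ℝ}, Continuous f → IntegrableOn f (T.facet i k) μHE[2] :=
        fun hf => integrableOn_of_compact (isCompact_facet T i k) (facet_area_lt_top T i k) hf
      exact integral_mono (hint (continuous_extTerm _ _ _)) (hint (continuous_flux _ _))
        fun x => extTerm_self_le _ _ x
    · exact le_rfl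
  have hflux := T.sum_intTerm_self_le fun i => trace T i u
  unfold dgForm
  linarith

lemma inner_maxwell_self_nonpos (T : SimplicialMesh D) (u : dgSpace T) :
    inner ℝ (maxwell T u) u ≤ 0 := by
  rw [inner_maxwell]
  exact dgForm_self_nonpos T u

/-! ### The midpoint step for a dissipative operator -/

section Midpoint

variable {V : Type*} [NormedAddCommGroup V] [InnerProductSpace ℝ V] {A : V →L[ℝ] V}

/-- If `u = A u`, then `‖u‖² = ⟨A u, u⟩ ≤ 0`; in finite dimension injectivity is enough. -/
lemma isUnit_one_sub [FiniteDimensional ℝ V] (hA : ∀ u, inner ℝ (A u) u ≤ 0) :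
    IsUnit (1 - A) := by
  have hinj : Function.Injective (1 - A : V →L[ℝ] V) := by
    refine (injective_iff_map_eq_zero _).2 fun u hu => ?_
    have h1 : u = A u := sub_eq_zero.1 hu
    have h2 := hA u
    rw [← h1] at h2
    rw [real_inner_self_eq_norm_sq] at h2
    exact norm_eq_zero.1 ((pow_eq_zero_iff two_ne_zero).1 (le_antisymm h2 (sq_nonneg _)))
  rw [ContinuousLinearMap.isUnit_iff_bijective]
  exact ⟨hinj, (LinearMap.injective_iff_surjective (f := (1 - A : V →L[ℝ] V).toLinearMap)).1 hinj⟩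

/-- Pairing with `d + z` produces `‖d‖² - ‖z‖² ≤ 0`: the Cayley transform of a dissipative operator
is a contraction. -/
lemma norm_le_of_midpoint (hA : ∀ u, inner ℝ (A u) u ≤ 0) {d z : V} (h : d - z = A (d + z)) :
    ‖d‖ ≤ ‖z‖ := by
  have h1 := hA (d + z)
  rw [← h] at h1
  have h2 : inner ℝ (d - z) (d + z) = ‖d‖ ^ 2 - ‖z‖ ^ 2 := by
    rw [inner_sub_left, inner_add_right, inner_add_right, real_inner_self_eq_norm_sq,
      real_inner_self_eq_norm_sq, real_inner_comm z d]
    ring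
  rw [h2] at h1
  exact (sq_le_sq₀ (norm_nonneg _) (norm_nonneg _)).1 (by linarith)

lemma norm_le_of_sub_eq (hA : ∀ u, inner ℝ (A u) u ≤ 0) {U c : V} (h : U - A U = c) :
    ‖U‖ ≤ ‖c‖ := by
  have h1 : ‖U‖ ^ 2 ≤ ‖c‖ * ‖U‖ := by
    have h2 := real_inner_le_norm c U
    rw [← h, inner_sub_left, real_inner_self_eq_norm_sq] at h2
    have := hA U
    rw [← h]
    linarith
  by_contra! hlt
  nlinarith [norm_nonneg c, norm_nonneg U]

lemma inner_smul_add_smul_nonpos {a c : ℝ} (ha : 0 ≤ a) {x y u : V} (hx : inner ℝ x u ≤ 0)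
    (hy : inner ℝ y u = 0) : inner ℝ (a • x + c • y) u ≤ 0 := by
  rw [inner_add_left, real_inner_smul_left, real_inner_smul_left, hy, mul_zero, add_zero]
  exact mul_nonpos_of_nonneg_of_nonpos ha hx

/-- Inversion is continuous at units, and dissipativity makes every `1 - B y` a unit. This provides
the measurability of the step in the noise. -/
lemma continuous_inverse_one_sub [FiniteDimensional ℝ V] {Y : Type*} [TopologicalSpace Y]
    {B : Y → V →L[ℝ] V} (hB : Continuous B) (hA : ∀ y u, inner ℝ (B y u) u ≤ 0) :
    Continuous fun y => Ring.inverse (1 - B y) := by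
  have : CompleteSpace V := FiniteDimensional.complete ℝ V
  refine continuous_iff_continuousAt.2 fun y => ?_
  obtain ⟨a, ha⟩ := isUnit_one_sub (hA y)
  have h1 := NormedRing.inverse_continuousAt (R := V →L[ℝ] V) a
  rw [ha] at h1
  exact ContinuousAt.comp (f := fun y => 1 - B y) h1 (continuous_const.sub hB).continuousAt

lemma midpoint_iff [FiniteDimensional ℝ V] (hA : ∀ u, inner ℝ (A u) u ≤ 0) (e : ℝ) (u U c : V) :
    U - e • u = A (U + e • u) + c ↔ U = Ring.inverse (1 - A) (e • (u + A u) + c) := by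
  have hunit : IsUnit (1 - A) := isUnit_one_sub hA
  have h2 : U - e • u = A (U + e • u) + c ↔ (1 - A) U = e • (u + A u) + c := by
    have h3 : (1 - A) U = U - A U := rfl
    rw [map_add, map_smul, h3, smul_add, ← sub_eq_zero,
      ← sub_eq_zero (a := U - A U)]
    refine iff_of_eq (congrArg (· = 0) ?_)
    abel
  rw [h2]
  constructor
  · intro h
    have h4 := congrArg (fun L : V →L[ℝ] V => L U) (Ring.inverse_mul_cancel _ hunit)
    rw [← h]
    exact h4.symm
  · intro h
    have h4 := congrArg (fun L : V →L[ℝ] V => L (e • (u + A u) + c))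
      (Ring.mul_inverse_cancel _ hunit)
    rw [h]
    exact h4

end Midpoint

/-! ### The step map -/

instance (D : Cuboid) : MeasurableSpace (L2 D) := borel _
instance (D : Cuboid) : BorelSpace (L2 D) := ⟨rfl⟩

lemma rotJ_add (v w : E6) : rotJ (v + w) = rotJ v + rotJ w := by
  ext i; fin_cases i <;> simp [rotJ, add_comm]

lemma rotJ_smul (c : ℝ) (v : E6) : rotJ (c • v) = c • rotJ v := by
  ext i; fin_cases i <;> simp [rotJ]

lemma inner_rotJ_self (v : E6) : inner ℝ (rotJ v) v = 0 := by
  simp only [rotJ, PiLp.inner_apply, Fin.sum_univ_succ]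
  simp
  ring

lemma coeFn_mulJ (T : SimplicialMesh D) (w : L2 D) (u : dgSpace T) :
    mulJ T w u =ᵐ[D.vol] fun x => w x • rotJ ((u : HH D) x) :=
  (memLp_mulJ T w u).coeFn_toLp

lemma mulJ_add_left (T : SimplicialMesh D) (w w' : L2 D) (u : dgSpace T) :
    mulJ T (w + w') u = mulJ T w u + mulJ T w' u := by
  apply Lp.ext
  filter_upwards [coeFn_mulJ T (w + w') u, coeFn_mulJ T w u, coeFn_mulJ T w' u, Lp.coeFn_add w w',
    Lp.coeFn_add (mulJ T w u) (mulJ T w' u)] with x h1 h2 h3 h4 h5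
  rw [h1, h5, Pi.add_apply, h2, h3, h4, Pi.add_apply, add_smul]

lemma mulJ_add_right (T : SimplicialMesh D) (w : L2 D) (u v : dgSpace T) :
    mulJ T w (u + v) = mulJ T w u + mulJ T w v := by
  apply Lp.ext
  filter_upwards [coeFn_mulJ T w (u + v), coeFn_mulJ T w u, coeFn_mulJ T w v,
    Lp.coeFn_add (u : HH D) (v : HH D),
    Lp.coeFn_add (mulJ T w u) (mulJ T w v)] with x h1 h2 h3 h4 h5
  rw [h1, h5, Pi.add_apply, h2, h3, Submodule.coe_add, h4, Pi.add_apply, rotJ_add, smul_add]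

lemma mulJ_smul_right (T : SimplicialMesh D) (c : ℝ) (w : L2 D) (u : dgSpace T) :
    mulJ T w (c • u) = c • mulJ T w u := by
  apply Lp.ext
  filter_upwards [coeFn_mulJ T w (c • u), coeFn_mulJ T w u, Lp.coeFn_smul c (u : HH D),
    Lp.coeFn_smul c (mulJ T w u)] with x h1 h2 h3 h4
  rw [h1, h4, Pi.smul_apply, h2, Submodule.coe_smul, h3, Pi.smul_apply, rotJ_smul, smul_comm]

lemma continuous_mulJ_left (T : SimplicialMesh D) (u : dgSpace T) :
    Continuous fun w => mulJ T w u := by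
  obtain ⟨C, hC⟩ := dg_bounded T u
  let f : L2 D →+ HH D := AddMonoidHom.mk' (fun w => mulJ T w u) fun w w' => mulJ_add_left T w w' u
  refine AddMonoidHomClass.continuous_of_bound f C fun w => ?_
  refine Lp.norm_le_mul_norm_of_ae_le_mul ?_
  filter_upwards [coeFn_mulJ T w u, hC] with x h1 h2
  show ‖mulJ T w u x‖ ≤ _
  rw [h1, norm_smul, norm_rotJ, mul_comm]
  exact mul_le_mul_of_nonneg_right h2 (norm_nonneg _)

lemma inner_proj_left (T : SimplicialMesh D) (v : HH D) (u : dgSpace T) :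
    inner ℝ (proj T v) u = inner ℝ v (u : HH D) :=
  Submodule.inner_orthogonalProjectionOnto_eq_of_mem_right u v

/-- `J` is skew on `ℝ⁶` at each point, so multiplication by a scalar `w` keeps the pairing zero
whatever the noise is. -/
lemma inner_proj_mulJ_self (T : SimplicialMesh D) (w : L2 D) (u : dgSpace T) :
    inner ℝ (proj T (mulJ T w u)) u = 0 := by
  rw [inner_proj_left, L2.inner_def]
  refine integral_eq_zero_of_ae ?_
  filter_upwards [coeFn_mulJ T w u] with x hx
  rw [hx, real_inner_smul_left, inner_rotJ_self, mul_zero]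
  rfl

/-- The operator `u ↦ π_h (w J u)` on the dG space. -/
def projMulJ (T : SimplicialMesh D) (w : L2 D) : dgSpace T →L[ℝ] dgSpace T :=
  LinearMap.toContinuousLinearMap
    { toFun := fun u => proj T (mulJ T w u)
      map_add' := fun u v => by rw [mulJ_add_right, map_add]
      map_smul' := fun c u => by rw [mulJ_smul_right, map_smul, RingHom.id_apply] }

lemma continuous_projMulJ (T : SimplicialMesh D) : Continuous (projMulJ T) :=
  continuous_clm_apply.2 fun u => (proj T).continuous.comp (continuous_mulJ_left T u)

/-- The operator `(Δt / 2) M_h + (λ₁ / 2) π_h (w J ·)` on the dG space. -/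
def stepOp (T : SimplicialMesh D) (lam1 : ℝ) (dt : ℝ≥0) (w : L2 D) :
    dgSpace T →L[ℝ] dgSpace T :=
  ((dt : ℝ) / 2) • LinearMap.toContinuousLinearMap (maxwell T) + (lam1 / 2) • projMulJ T w

lemma stepOp_apply (T : SimplicialMesh D) (lam1 : ℝ) (dt : ℝ≥0) (w : L2 D) (u : dgSpace T) :
    stepOp T lam1 dt w u =
      ((dt : ℝ) / 2) • maxwell T u + (lam1 / 2) • proj T (mulJ T w u) := rfl

lemma inner_stepOp_self_nonpos (T : SimplicialMesh D) (lam1 : ℝ) (dt : ℝ≥0) (w : L2 D)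
    (u : dgSpace T) : inner ℝ (stepOp T lam1 dt w u) u ≤ 0 := by
  exact inner_smul_add_smul_nonpos (by positivity) (inner_maxwell_self_nonpos T u)
    (inner_proj_mulJ_self T w u)

lemma continuous_stepOp (T : SimplicialMesh D) (lam1 : ℝ) (dt : ℝ≥0) :
    Continuous (stepOp T lam1 dt) :=
  continuous_const.add ((continuous_projMulJ T).const_smul (lam1 / 2))

/-- The solution of one step of the full discretization. -/
def stepMap (T : SimplicialMesh D) (σ₀ lam1 : ℝ) (lam2 : E3) (dt : ℝ≥0) (w : L2 D × L2 D)
    (u : dgSpace T) : dgSpace T :=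
  Ring.inverse (1 - stepOp T lam1 dt w.1)
    (Real.exp (-σ₀ * dt) • (u + stepOp T lam1 dt w.1 u) + proj T (mulConst w.2 (dup lam2)))

lemma isDGStep_iff (T : SimplicialMesh D) (σ₀ lam1 : ℝ) (lam2 : E3) (dt : ℝ≥0) (w₁ w₂ : L2 D)
    (u U : dgSpace T) :
    IsDGStep T σ₀ lam1 lam2 dt w₁ w₂ u U ↔ U = stepMap T σ₀ lam1 lam2 dt (w₁, w₂) u := by
  have h1 : IsDGStep T σ₀ lam1 lam2 dt w₁ w₂ u U ↔ U - Real.exp (-σ₀ * dt) • u =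
      stepOp T lam1 dt w₁ (U + Real.exp (-σ₀ * dt) • u) + proj T (mulConst w₂ (dup lam2)) := by
    unfold IsDGStep
    rw [stepOp_apply, map_add (maxwell T), map_smul (maxwell T)]
  rw [h1]
  exact midpoint_iff (inner_stepOp_self_nonpos T lam1 dt w₁) _ _ _ _

/-- The additive noise cancels in the difference of two steps, and what remains is the midpoint
relation for `U - V` and `e • (u - v)`. -/
lemma norm_stepMap_sub_le (T : SimplicialMesh D) (σ₀ lam1 : ℝ) (lam2 : E3) (dt : ℝ≥0)
    (w : L2 D × L2 D) (u v : dgSpace T) :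
    ‖stepMap T σ₀ lam1 lam2 dt w u - stepMap T σ₀ lam1 lam2 dt w v‖ ≤
      Real.exp (-σ₀ * dt) * ‖u - v‖ := by
  have h1 := (isDGStep_iff T σ₀ lam1 lam2 dt w.1 w.2 u _).2 rfl
  have h2 := (isDGStep_iff T σ₀ lam1 lam2 dt w.1 w.2 v _).2 rfl
  set U := stepMap T σ₀ lam1 lam2 dt w u
  set V := stepMap T σ₀ lam1 lam2 dt w v
  set e := Real.exp (-σ₀ * dt)
  have h3 : (U - V) - e • (u - v) = stepOp T lam1 dt w.1 ((U - V) + e • (u - v)) := by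
    have e1 : U - e • u = stepOp T lam1 dt w.1 (U + e • u) + proj T (mulConst w.2 (dup lam2)) := by
      rw [stepOp_apply, map_add, map_smul]; exact h1
    have e2 : V - e • v = stepOp T lam1 dt w.1 (V + e • v) + proj T (mulConst w.2 (dup lam2)) := by
      rw [stepOp_apply, map_add, map_smul]; exact h2
    have e3 : (U - V) - e • (u - v) = (U - e • u) - (V - e • v) := by rw [smul_sub]; abel
    have e4 : (U - V) + e • (u - v) = (U + e • u) - (V + e • v) := by rw [smul_sub]; abel
    rw [e3, e4, e1, e2, map_sub]
    abel
  have h4 := norm_le_of_midpoint (inner_stepOp_self_nonpos T lam1 dt w.1) h3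
  rwa [norm_smul, Real.norm_eq_abs, abs_of_pos (Real.exp_pos _)] at h4

/-- Started from zero, the step solves `U - A U = π_h (λ̃₂ ΔW₂)`. Dissipativity bounds `U` by the
right side, so only the second noise enters the moment condition. -/
lemma norm_stepMap_zero_le (T : SimplicialMesh D) (σ₀ lam1 : ℝ) (lam2 : E3) (dt : ℝ≥0)
    (w : L2 D × L2 D) :
    ‖stepMap T σ₀ lam1 lam2 dt w 0‖ ≤ ‖dup lam2‖ * ‖w.2‖ := by
  have h1 := (isDGStep_iff T σ₀ lam1 lam2 dt w.1 w.2 0 _).2 rfl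
  set U := stepMap T σ₀ lam1 lam2 dt w 0
  have e1 : U - stepOp T lam1 dt w.1 U = proj T (mulConst w.2 (dup lam2)) := by
    unfold IsDGStep at h1
    simp only [smul_zero, sub_zero, add_zero, map_zero] at h1
    rw [stepOp_apply, sub_eq_iff_eq_add', ← h1]
  refine (norm_le_of_sub_eq (inner_stepOp_self_nonpos T lam1 dt w.1) e1).trans ?_
  refine ((dgSpace T).norm_orthogonalProjectionOnto_apply_le _).trans ?_
  refine (ContinuousLinearMap.norm_compLp_le _ _).trans ?_
  rw [ContinuousLinearMap.norm_toSpanSingleton]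

lemma continuous_mulConst (v : E6) : Continuous fun w : L2 D => mulConst w v :=
  (ContinuousLinearMap.compLpL 2 D.vol (ContinuousLinearMap.toSpanSingleton ℝ v)).continuous

lemma continuous_stepMap (T : SimplicialMesh D) (σ₀ lam1 : ℝ) (lam2 : E3) (dt : ℝ≥0) :
    Continuous fun z : (L2 D × L2 D) × dgSpace T => stepMap T σ₀ lam1 lam2 dt z.1 z.2 := by
  have hA : Continuous fun z : (L2 D × L2 D) × dgSpace T => stepOp T lam1 dt z.1.1 :=
    (continuous_stepOp T lam1 dt).comp (continuous_fst.comp continuous_fst)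
  have hR := continuous_inverse_one_sub hA fun z => inner_stepOp_self_nonpos T lam1 dt z.1.1
  refine hR.clm_apply (Continuous.add ?_ ?_)
  · exact (continuous_snd.add (hA.clm_apply continuous_snd)).const_smul (Real.exp (-σ₀ * dt))
  · exact (proj T).continuous.comp ((continuous_mulConst _).comp
      (continuous_snd.comp continuous_fst))

lemma proj_coe (T : SimplicialMesh D) (u : dgSpace T) : proj T (u : HH D) = u :=
  (dgSpace T).orthogonalProjectionOnto_mem_subspace_eq_self u

/-- The contraction factor of one step. -/
def decay (σ₀ : ℝ) (dt : ℝ≥0) : ℝ≥0 := ⟨Real.exp (-σ₀ * dt), (Real.exp_pos _).le⟩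

/-- The step map as a map on `ℍ`. -/
def stepMapHH (T : SimplicialMesh D) (σ₀ lam1 : ℝ) (lam2 : E3) (dt : ℝ≥0) (w : L2 D × L2 D)
    (x : HH D) : HH D := stepMap T σ₀ lam1 lam2 dt w (proj T x)

lemma continuous_stepMapHH (T : SimplicialMesh D) (σ₀ lam1 : ℝ) (lam2 : E3) (dt : ℝ≥0) :
    Continuous (Function.uncurry (stepMapHH T σ₀ lam1 lam2 dt)) := by
  have h1 : Continuous fun z : (L2 D × L2 D) × HH D => proj T z.2 :=
    (proj T).continuous.comp continuous_snd
  have h2 : Continuous fun z : (L2 D × L2 D) × HH D => (z.1, proj T z.2) :=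
    continuous_fst.prodMk h1
  have h3 := (continuous_stepMap T σ₀ lam1 lam2 dt).comp h2
  exact continuous_subtype_val.comp h3

instance (D : Cuboid) : SecondCountableTopology (L2 D) :=
  haveI : Fact ((2 : ℝ≥0∞) ≠ ∞) := ⟨by simp⟩
  inferInstance

lemma isContractiveIteration_stepMapHH (T : SimplicialMesh D) {σ₀ : ℝ} (hσ₀ : 0 < σ₀) (lam1 : ℝ)
    (lam2 : E3) {dt : ℝ≥0} (hdt : 0 < dt) (ν : Measure (L2 D × L2 D))
    (hν : ∫⁻ w, ‖w.2‖ₑ ^ 2 ∂ν < ⊤) :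
    IsContractiveIteration ν (decay σ₀ dt) (fun x => (proj T x : HH D))
      (stepMapHH T σ₀ lam1 lam2 dt) where
  lt_one := by
    rw [← NNReal.coe_lt_coe]
    show Real.exp (-σ₀ * dt) < 1
    rw [Real.exp_lt_one_iff]
    have : (0 : ℝ) < dt := hdt
    nlinarith
  measurable := by
    exact (continuous_stepMapHH T σ₀ lam1 lam2 dt).measurable
  lipschitz w := LipschitzWith.of_dist_le_mul fun x y => by
    rw [dist_eq_norm, dist_eq_norm]
    refine (norm_stepMap_sub_le T σ₀ lam1 lam2 dt w (proj T x) (proj T y)).trans ?_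
    rw [← map_sub]
    exact mul_le_mul_of_nonneg_left ((dgSpace T).norm_orthogonalProjectionOnto_apply_le _)
      (Real.exp_pos _).le
  moment := by
    have h : ∀ w : L2 D × L2 D, ‖stepMapHH T σ₀ lam1 lam2 dt w 0‖ₑ ^ 2 ≤
        ‖dup lam2‖ₑ ^ 2 * ‖w.2‖ₑ ^ 2 := fun w => by
      rw [← mul_pow]
      refine pow_le_pow_left₀ bot_le ?_ 2
      have := norm_stepMap_zero_le T σ₀ lam1 lam2 dt w
      rw [← map_zero (proj T)] at this
      rw [← ofReal_norm, ← ofReal_norm, ← ofReal_norm, ← ENNReal.ofReal_mul (norm_nonneg _)]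
      exact ENNReal.ofReal_le_ofReal this
    refine (lintegral_mono h).trans_lt ?_
    rw [lintegral_const_mul' _ _ (by simp)]
    exact ENNReal.mul_lt_top (by simp) hν
  lipschitz_proj := LipschitzWith.of_dist_le_mul fun x y => by
    rw [dist_eq_norm, dist_eq_norm, NNReal.coe_one, one_mul, ← Submodule.coe_sub, ← map_sub]
    exact (dgSpace T).norm_orthogonalProjectionOnto_apply_le _
  proj_step w x := by
    show ((proj T ((stepMap T σ₀ lam1 lam2 dt w (proj T x) : dgSpace T) : HH D) : dgSpace T)
      : HH D) = _
    rw [proj_coe]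
    rfl

/-! ### Trace class covariance operators -/

/-- The fundamental lemma of the calculus of variations, applied to `f - g`. -/
lemma ae_eq_of_hasWeakDeriv_zero {f g : E3 → ℝ} (h : HasWeakDeriv D 0 f g) : f =ᵐ[D.vol] g := by
  obtain ⟨hf, hg, hfg⟩ := h
  have hloc : LocallyIntegrable (f - g) D.vol := (hf.sub hg).locallyIntegrable (by norm_num)
  have hz := D.isOpen.ae_eq_zero_of_integral_contDiff_smul_eq_zero (hloc.locallyIntegrableOn _)
    fun φ h1 h2 h3 => by
      have hφ : MemLp φ 2 D.vol := h1.continuous.memLp_of_hasCompactSupport h2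
      have e := hfg φ ⟨h1, h2, h3⟩
      have h4 : multiDeriv 0 φ = φ := rfl
      simp only [h4, Pi.zero_apply, Finset.sum_const_zero, pow_zero, one_mul] at e
      have e1 : ∀ x, φ x • (f - g) x = f x * φ x - g x * φ x := fun x => by
        rw [smul_eq_mul, Pi.sub_apply]; ring
      simp only [e1]
      have e2 : Integrable (fun x => f x * φ x) D.vol := hf.integrable_mul hφ
      have e3 : Integrable (fun x => g x * φ x) D.vol := hg.integrable_mul hφ
      rw [integral_sub e2 e3, e, sub_self]
  filter_upwards [hz, ae_restrict_mem D.isOpen.measurableSet] with x hx hxD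
  exact sub_eq_zero.1 (hx hxD)

/-- The multi-index 0 occurs for every order, and its summand is the `L²` norm of `f` itself. -/
lemma eLpNorm_sq_le_sobolevNormSq (γ : ℝ) (f : E3 → ℝ) :
    eLpNorm f 2 D.vol ^ 2 ≤ sobolevNormSq D γ f := by
  refine le_iInf₂ fun G hG => ?_
  have h0 : (0 : Fin 3 → ℕ) ∈ multiIndices ⌊γ⌋₊ := by simp [multiIndices]
  rw [eLpNorm_congr_ae (ae_eq_of_hasWeakDeriv_zero (hG 0 h0))]
  refine le_trans ?_ le_self_add
  exact Finset.single_le_sum (f := fun α => eLpNorm (G α) 2 D.vol ^ 2)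
    (fun _ _ => bot_le) h0

lemma enorm_sqrtQ_sq (q : HilbertBasis ℕ ℝ (L2 D)) {η : ℕ → ℝ} (hη : ∀ k, 0 ≤ η k) (k : ℕ) :
    ‖sqrtQ q η k‖ₑ ^ 2 = ENNReal.ofReal (η k) := by
  have h : ‖sqrtQ q η k‖ = √(η k) := by
    rw [sqrtQ, norm_smul, q.orthonormal.norm_eq_one, mul_one, Real.norm_eq_abs,
      abs_of_nonneg (Real.sqrt_nonneg _)]
  rw [← ofReal_norm, h, ← ENNReal.ofReal_pow (Real.sqrt_nonneg _), Real.sq_sqrt (hη k)]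

/-- A Hilbert–Schmidt root of the covariance in `H^γ` is Hilbert–Schmidt in `L²`, so the covariance
is of trace class and the noise series converge. -/
lemma tsum_ofReal_lt_top {γ : ℝ} {q : HilbertBasis ℕ ℝ (L2 D)} {η : ℕ → ℝ} (hη : ∀ k, 0 ≤ η k)
    (h : IsHSSobolev D γ q η) : ∑' k, ENNReal.ofReal (η k) < ⊤ := by
  refine lt_of_le_of_lt (ENNReal.tsum_le_tsum fun k => ?_) h
  rw [← enorm_sqrtQ_sq q hη k]
  refine le_trans (le_of_eq ?_) (eLpNorm_sq_le_sobolevNormSq γ _)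
  rw [Lp.enorm_def]

/-! ### Random series in `L²(D)` -/

/-- The series `∑_k c_k Q^{1/2} q_k`. -/
def noiseSeries (q : HilbertBasis ℕ ℝ (L2 D)) (η : ℕ → ℝ) (c : ℕ → ℝ) : L2 D :=
  ∑' k, c k • sqrtQ q η k

/-- The squared norm of `∑_k c_k Q^{1/2} q_k`. -/
def noiseEnergy (η c : ℕ → ℝ) : ℝ≥0∞ := ∑' k, ENNReal.ofReal (η k) * ‖c k‖ₑ ^ 2

lemma measurable_noiseEnergy (η : ℕ → ℝ) : Measurable (noiseEnergy η) :=
  Measurable.tsum fun k => by fun_prop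

lemma ofReal_sq_sqrt_mul {η : ℝ} (hη : 0 ≤ η) (c : ℝ) :
    ENNReal.ofReal ((c * √η) ^ 2) = ENNReal.ofReal η * ‖c‖ₑ ^ 2 := by
  rw [mul_pow, Real.sq_sqrt hη, mul_comm, ENNReal.ofReal_mul hη, ← sq_abs c,
    ENNReal.ofReal_pow (abs_nonneg _), ← Real.norm_eq_abs, ofReal_norm]

/-- Pythagoras: a series of orthogonal terms converges exactly when the squared norms are summable.
-/
lemma summable_noise_iff (q : HilbertBasis ℕ ℝ (L2 D)) {η : ℕ → ℝ} (hη : ∀ k, 0 ≤ η k)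
    (c : ℕ → ℝ) : Summable (fun k => c k • sqrtQ q η k) ↔ noiseEnergy η c ≠ ⊤ := by
  have h := q.orthonormal.orthogonalFamily.summable_iff_norm_sq_summable fun k => c k * √(η k)
  have h1 : (fun k => c k • sqrtQ q η k) =
      fun k => LinearIsometry.toSpanSingleton ℝ (L2 D) (q.orthonormal.1 k) (c k * √(η k)) := by
    funext k
    simp [sqrtQ, smul_smul]
  have h2 : ∀ k, ENNReal.ofReal (η k) * ‖c k‖ₑ ^ 2 =
      ENNReal.ofReal (‖c k * √(η k)‖ ^ 2) := fun k => by
    rw [Real.norm_eq_abs, sq_abs, ofReal_sq_sqrt_mul (hη k)]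
  rw [h1, h, noiseEnergy]
  simp only [h2]
  constructor
  · intro hs
    exact hs.tsum_ofReal_ne_top
  · intro hs
    have := ENNReal.summable_toReal hs
    simpa [ENNReal.toReal_ofReal (sq_nonneg _)] using this

/-- Partial sums obey the bound by Pythagoras. A divergent series has the default value 0, so the
estimate holds for all coefficients and no null set has to be removed. -/
lemma enorm_noiseSeries_sq_le (q : HilbertBasis ℕ ℝ (L2 D)) {η : ℕ → ℝ} (hη : ∀ k, 0 ≤ η k)
    (c : ℕ → ℝ) : ‖noiseSeries q η c‖ₑ ^ 2 ≤ noiseEnergy η c := by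
  by_cases hs : Summable fun k => c k • sqrtQ q η k
  · have hlim : Tendsto (fun n => ‖∑ k ∈ Finset.range n, c k • sqrtQ q η k‖ₑ ^ 2) atTop
        (𝓝 (‖noiseSeries q η c‖ₑ ^ 2)) :=
      ((ENNReal.continuous_pow 2).tendsto _).comp
        ((continuous_enorm.tendsto _).comp hs.hasSum.tendsto_sum_nat)
    refine le_of_tendsto' hlim fun n => ?_
    have h := q.orthonormal.orthogonalFamily.norm_sum (fun k => c k * √(η k)) (Finset.range n)
    have h1 : ∀ k, LinearIsometry.toSpanSingleton ℝ (L2 D) (q.orthonormal.1 k) (c k * √(η k)) =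
        c k • sqrtQ q η k := fun k => by simp [sqrtQ, smul_smul]
    simp only [h1] at h
    rw [← ofReal_norm, ← ENNReal.ofReal_pow (norm_nonneg _), h,
      ENNReal.ofReal_sum_of_nonneg fun _ _ => sq_nonneg _]
    refine le_trans (le_of_eq (Finset.sum_congr rfl fun k _ => ?_)) (ENNReal.sum_le_tsum _)
    rw [Real.norm_eq_abs, sq_abs, ofReal_sq_sqrt_mul (hη k)]
  · rw [noiseSeries, tsum_eq_zero_of_not_summable hs]
    simp

lemma measurable_noiseSeries (q : HilbertBasis ℕ ℝ (L2 D)) (η : ℕ → ℝ) :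
    Measurable (noiseSeries q η) := by
  refine Measurable.tsum fun k => ?_
  have hc : Continuous fun c : ℕ → ℝ => c k • sqrtQ q η k := by fun_prop
  exact hc.measurable

lemma lintegral_enorm_sq_gaussianReal (v : ℝ≥0) :
    ∫⁻ x, ‖x‖ₑ ^ 2 ∂(gaussianReal 0 v) = v := by
  have h := ofReal_variance (memLp_id_gaussianReal (μ := 0) (v := v) 2)
  rw [variance_id_gaussianReal, evariance] at h
  simpa using h.symm

lemma lintegral_noiseEnergy_lt_top {Ω : Type*} {mΩ : MeasurableSpace Ω} {P : Measure Ω}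
    {η : ℕ → ℝ} (hs : ∑' k, ENNReal.ofReal (η k) < ⊤) {z : ℕ → Ω → ℝ} {v : ℝ≥0}
    (hz : ∀ k, HasLaw (z k) (gaussianReal 0 v) P) :
    ∫⁻ ω, noiseEnergy η (fun k => z k ω) ∂P < ⊤ := by
  have h1 : ∀ k, ∫⁻ ω, ‖z k ω‖ₑ ^ 2 ∂P = v := fun k => by
    rw [← lintegral_enorm_sq_gaussianReal v, ← (hz k).map_eq,
      lintegral_map' (by fun_prop) (hz k).aemeasurable]
  have h2 : ∀ k, AEMeasurable (fun ω => ‖z k ω‖ₑ ^ 2) P := fun k =>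
    ((hz k).aemeasurable.enorm).pow_const 2
  unfold noiseEnergy
  rw [lintegral_tsum fun k => (h2 k).const_mul _]
  simp only [lintegral_const_mul'' _ (h2 _), h1]
  rw [ENNReal.tsum_mul_right]
  exact ENNReal.mul_lt_top hs ENNReal.coe_lt_top

/-! ### The driving noise of one step -/

/-- The noise `(Δ\overline W_1, ΔW_2)` of one step as a function of the Brownian increments. -/
def stepNoise (q : HilbertBasis ℕ ℝ (L2 D)) (η : Fin 2 → ℕ → ℝ) (b : ℝ) (dt : ℝ≥0)
    (z : Fin 2 × ℕ → ℝ) : L2 D × L2 D :=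
  (√(dt : ℝ) • noiseSeries q (η 0) fun k =>
      max (-truncLevel b dt) (min (truncLevel b dt) (z (0, k) / √(dt : ℝ))),
    noiseSeries q (η 1) fun k => z (1, k))

lemma measurable_stepNoise (q : HilbertBasis ℕ ℝ (L2 D)) (η : Fin 2 → ℕ → ℝ) (b : ℝ)
    (dt : ℝ≥0) : Measurable (stepNoise q η b dt) := by
  refine Measurable.prodMk ?_ ?_
  · have hc : Continuous fun w : L2 D => √(dt : ℝ) • w := continuous_const_smul _
    refine hc.measurable.comp ((measurable_noiseSeries q (η 0)).comp ?_)
    exact measurable_pi_lambda _ fun k => by fun_prop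
  · exact (measurable_noiseSeries q (η 1)).comp
      (measurable_pi_lambda _ fun k => measurable_pi_apply _)

/-- The law of the noise of one step. -/
def stepNoiseLaw (q : HilbertBasis ℕ ℝ (L2 D)) (η : Fin 2 → ℕ → ℝ) (b : ℝ) (dt : ℝ≥0) :
    Measure (L2 D × L2 D) :=
  (Measure.infinitePi fun _ : Fin 2 × ℕ => gaussianReal 0 dt).map (stepNoise q η b dt)

instance (q : HilbertBasis ℕ ℝ (L2 D)) (η : Fin 2 → ℕ → ℝ) (b : ℝ) (dt : ℝ≥0) :
    IsProbabilityMeasure (stepNoiseLaw q η b dt) :=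
  Measure.isProbabilityMeasure_map (measurable_stepNoise q η b dt).aemeasurable

lemma lintegral_stepNoiseLaw_lt_top (q : HilbertBasis ℕ ℝ (L2 D)) {η : Fin 2 → ℕ → ℝ}
    (hη : ∀ i k, 0 ≤ η i k) (hs : ∑' k, ENNReal.ofReal (η 1 k) < ⊤) (b : ℝ) (dt : ℝ≥0) :
    ∫⁻ w, ‖w.2‖ₑ ^ 2 ∂(stepNoiseLaw q η b dt) < ⊤ := by
  rw [stepNoiseLaw, lintegral_map (by fun_prop) (measurable_stepNoise q η b dt)]
  refine (lintegral_mono fun z => enorm_noiseSeries_sq_le q (hη 1) _).trans_lt ?_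
  exact lintegral_noiseEnergy_lt_top (v := dt)
    (z := fun k (z : Fin 2 × ℕ → ℝ) => z (1, k)) hs fun k =>
    (measurePreserving_eval_infinitePi (fun _ : Fin 2 × ℕ => gaussianReal 0 dt) (1, k)).hasLaw

section Brownian

variable {Ω : Type*} {mΩ : MeasurableSpace Ω} {Pr : Measure Ω} {ℱ : Filtration ℝ≥0 mΩ}
  {β : Fin 2 × ℕ → ℝ≥0 → Ω → ℝ}

/-- The Brownian increments over the `n`-th time step. -/
def brownianIncr (β : Fin 2 × ℕ → ℝ≥0 → Ω → ℝ) (dt : ℝ≥0) (n : ℕ) (ω : Ω) (j : Fin 2 × ℕ) : ℝ :=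
  β j ((n + 1 : ℕ) * dt) ω - β j (n * dt) ω

lemma time_le_succ (dt : ℝ≥0) (n : ℕ) : (n : ℝ≥0) * dt ≤ (n + 1 : ℕ) * dt := by
  push_cast
  gcongr
  simp

lemma truncIncr_eq (dt : ℝ≥0) (n : ℕ) (q : HilbertBasis ℕ ℝ (L2 D)) (η : Fin 2 → ℕ → ℝ)
    (b : ℝ) (ω : Ω) :
    truncIncr q (η 0) (fun k => β (0, k)) b dt n ω =
      (stepNoise q η b dt (brownianIncr β dt n ω)).1 := rfl

namespace IsBrownianFamily

variable (h : IsBrownianFamily ℱ β Pr) (dt : ℝ≥0) (n : ℕ)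

include h

lemma measurable_brownianIncr : Measurable[ℱ ((n + 1 : ℕ) * dt)] (brownianIncr β dt n) :=
  @measurable_pi_lambda _ _ _ (ℱ _) _ _ fun j => (h.adapted j _).sub
    ((h.adapted j _).mono (ℱ.mono (time_le_succ dt n)) le_rfl)

lemma measurable_brownianIncr' : Measurable (brownianIncr β dt n) :=
  (h.measurable_brownianIncr dt n).mono (ℱ.le _) le_rfl

/-- Each increment is centred Gaussian with variance the length `dt` of the time step; independence
of the Brownian motions makes the joint law a product, the same for every step. -/
lemma hasLaw_brownianIncr :
    HasLaw (brownianIncr β dt n) (Measure.infinitePi fun _ : Fin 2 × ℕ => gaussianReal 0 dt)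
      Pr := by
  have hlaw : ∀ j, HasLaw (fun ω => brownianIncr β dt n ω j) (gaussianReal 0 dt) Pr := fun j => by
    have h1 := (h.brownian j).toIsPreBrownianReal.hasLaw_sub ((n + 1 : ℕ) * dt) (n * dt)
    have h2 : nndist (((n + 1 : ℕ) * dt : ℝ≥0) : ℝ) ((n * dt : ℝ≥0) : ℝ) = dt := by
      ext
      rw [coe_nndist, Real.dist_eq]
      push_cast
      rw [show ((n : ℝ) + 1) * dt - n * dt = dt by ring, abs_of_nonneg dt.coe_nonneg]
    have h3 : gaussianReal 0 (nndist (((n + 1 : ℕ) * dt : ℝ≥0) : ℝ) ((n * dt : ℝ≥0) : ℝ)) =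
        gaussianReal 0 dt := by rw [h2]
    exact h3 ▸ h1
  have hind : iIndepFun (fun j ω => brownianIncr β dt n ω j) Pr :=
    h.indep.comp (fun _ f => f ((n + 1 : ℕ) * dt) - f (n * dt)) fun _ =>
      (measurable_pi_apply _).sub (measurable_pi_apply _)
  exact hind.hasLaw_infinitePi hlaw (h.measurable_brownianIncr' dt n).aemeasurable

lemma indepFun_brownianIncr {X : Type*} [MeasurableSpace X] {Y : Ω → X}
    (hY : Measurable[ℱ (n * dt)] Y) : IndepFun (brownianIncr β dt n) Y Pr := by
  have h1 := h.indep_past _ _ (time_le_succ dt n)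
  rw [IndepFun_iff_Indep]
  refine indep_of_indep_of_le_left (indep_of_indep_of_le_right h1 hY.comap_le) ?_
  rw [MeasurableSpace.pi, MeasurableSpace.comap_iSup]
  refine iSup_mono fun j => ?_
  rw [MeasurableSpace.comap_comp]
  exact le_rfl

/-- Subtracting termwise requires both series to converge, which holds almost surely because their
expected energies are finite. Elsewhere the default value 0 of a divergent series may break the
identity. -/
lemma wiener_sub_ae_eq (q : HilbertBasis ℕ ℝ (L2 D)) {η : Fin 2 → ℕ → ℝ} (hη : ∀ i k, 0 ≤ η i k)
    (hs : ∑' k, ENNReal.ofReal (η 1 k) < ⊤) (b : ℝ) : ∀ᵐ ω ∂Pr,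
    wiener q (η 1) (fun k => β (1, k)) ((n + 1 : ℕ) * dt) ω -
        wiener q (η 1) (fun k => β (1, k)) (n * dt) ω =
      (stepNoise q η b dt (brownianIncr β dt n ω)).2 := by
  have hsum : ∀ t, ∀ᵐ ω ∂Pr, Summable fun k => β (1, k) t ω • sqrtQ q (η 1) k := fun t => by
    have h1 := lintegral_noiseEnergy_lt_top hs (z := fun k => β (1, k) t) fun k =>
      (h.brownian (1, k)).toIsPreBrownianReal.hasLaw_eval t
    have hm : AEMeasurable (fun ω => noiseEnergy (η 1) fun k => β (1, k) t ω) Pr :=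
      ((measurable_noiseEnergy (η 1)).comp (measurable_pi_lambda _ fun k =>
        (h.adapted (1, k) t).mono (ℱ.le t) le_rfl)).aemeasurable
    filter_upwards [ae_lt_top' hm h1.ne] with ω hω
    exact (summable_noise_iff q (hη 1) _).2 hω.ne
  filter_upwards [hsum ((n + 1 : ℕ) * dt), hsum (n * dt)] with ω h1 h2
  show (∑' k, _) - (∑' k, _) = ∑' k, _
  rw [← h1.tsum_sub h2]
  refine tsum_congr fun k => ?_
  rw [← sub_smul]
  rfl

end IsBrownianFamily

end Brownian

/-! ### Well-posedness and the Markov transition semigroup -/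

instance (D : Cuboid) : SecondCountableTopology (HH D) :=
  haveI : Fact ((2 : ℝ≥0∞) ≠ ∞) := ⟨by simp⟩
  inferInstance

section Solution

variable {Ω : Type*} {mΩ : MeasurableSpace Ω} {Pr : Measure Ω}
  {ℱ : Filtration ℝ≥0 mΩ} {β : Fin 2 × ℕ → ℝ≥0 → Ω → ℝ}
  {q : HilbertBasis ℕ ℝ (L2 D)} {η : Fin 2 → ℕ → ℝ} {σ₀ lam1 : ℝ} {lam2 : E3} {b : ℝ} {dt : ℝ≥0}
  {T : SimplicialMesh D}

/-- The solution of the full discretization. -/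
def dgSolution (β : Fin 2 × ℕ → ℝ≥0 → Ω → ℝ) (q : HilbertBasis ℕ ℝ (L2 D)) (η : Fin 2 → ℕ → ℝ)
    (σ₀ lam1 : ℝ) (lam2 : E3) (b : ℝ) (dt : ℝ≥0) (T : SimplicialMesh D) (u₀ : Ω → HH D) :
    ℕ → Ω → dgSpace T
  | 0, ω => proj T (u₀ ω)
  | n + 1, ω => stepMap T σ₀ lam1 lam2 dt (stepNoise q η b dt (brownianIncr β dt n ω))
      (dgSolution β q η σ₀ lam1 lam2 b dt T u₀ n ω)

/-- Turns the implicit scheme into an explicit recursion in the Brownian increments, up to null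
sets; existence, uniqueness and the law of the solution are read off from it. -/
lemma isDGSolution_iff (h : IsBrownianFamily ℱ β Pr) (hη : ∀ i k, 0 ≤ η i k)
    (hs : ∑' k, ENNReal.ofReal (η 1 k) < ⊤) {u₀ : Ω → HH D} {u : ℕ → Ω → dgSpace T} :
    IsDGSolution Pr ℱ β q η σ₀ lam1 lam2 b dt T u₀ u ↔
      (∀ n : ℕ, Measurable[ℱ (n * dt)] (fun ω => (u n ω : HH D))) ∧
      (∀ᵐ ω ∂Pr, u 0 ω = proj T (u₀ ω)) ∧
      ∀ n : ℕ, ∀ᵐ ω ∂Pr, u (n + 1) ω = stepMap T σ₀ lam1 lam2 dt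
        (stepNoise q η b dt (brownianIncr β dt n ω)) (u n ω) := by
  have key : ∀ n, ∀ᵐ ω ∂Pr, (IsDGStep T σ₀ lam1 lam2 dt
      (truncIncr q (η 0) (fun k => β (0, k)) b dt n ω)
      (wiener q (η 1) (fun k => β (1, k)) ((n + 1 : ℕ) * dt) ω -
        wiener q (η 1) (fun k => β (1, k)) (n * dt) ω) (u n ω) (u (n + 1) ω) ↔
      u (n + 1) ω = stepMap T σ₀ lam1 lam2 dt
        (stepNoise q η b dt (brownianIncr β dt n ω)) (u n ω)) := fun n => by
    filter_upwards [h.wiener_sub_ae_eq dt n q hη hs b] with ω hω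
    rw [hω, truncIncr_eq, isDGStep_iff]
  constructor
  · rintro ⟨h1, h2, h3⟩
    refine ⟨h1, h2, fun n => ?_⟩
    filter_upwards [key n, h3 n] with ω e1 e2 using e1.1 e2
  · rintro ⟨h1, h2, h3⟩
    refine ⟨h1, h2, fun n => ?_⟩
    filter_upwards [key n, h3 n] with ω e1 e2 using e1.2 e2

lemma coe_stepMap (w : L2 D × L2 D) (u : dgSpace T) :
    (stepMap T σ₀ lam1 lam2 dt w u : HH D) = stepMapHH T σ₀ lam1 lam2 dt w u := by
  rw [stepMapHH, proj_coe]

lemma isDGSolution_dgSolution (h : IsBrownianFamily ℱ β Pr) (hη : ∀ i k, 0 ≤ η i k)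
    (hs : ∑' k, ENNReal.ofReal (η 1 k) < ⊤) {u₀ : Ω → HH D} (hu₀ : Measurable[ℱ 0] u₀) :
    IsDGSolution Pr ℱ β q η σ₀ lam1 lam2 b dt T u₀
      (dgSolution β q η σ₀ lam1 lam2 b dt T u₀) := by
  refine (isDGSolution_iff h hη hs).2 ⟨fun n => ?_, ae_of_all _ fun ω => rfl,
    fun n => ae_of_all _ fun ω => rfl⟩
  induction n with
  | zero =>
    have hp : Measurable fun x : HH D => (proj T x : HH D) :=
      (continuous_subtype_val.comp (proj T).continuous).measurable
    have h0 : ((0 : ℕ) : ℝ≥0) * dt = 0 := by simp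
    rw [h0]
    exact hp.comp hu₀
  | succ n ih =>
    have h1 : (fun ω => (dgSolution β q η σ₀ lam1 lam2 b dt T u₀ (n + 1) ω : HH D)) =
        fun ω => Function.uncurry (stepMapHH T σ₀ lam1 lam2 dt)
          (stepNoise q η b dt (brownianIncr β dt n ω),
            (dgSolution β q η σ₀ lam1 lam2 b dt T u₀ n ω : HH D)) :=
      funext fun ω => coe_stepMap _ _
    rw [h1]
    have h2 : Measurable[ℱ ((n + 1 : ℕ) * dt)]
        fun ω => stepNoise q η b dt (brownianIncr β dt n ω) :=
      (measurable_stepNoise q η b dt).comp (h.measurable_brownianIncr dt n)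
    have h3 := ih.mono (ℱ.mono (time_le_succ dt n)) le_rfl
    exact (continuous_stepMapHH T σ₀ lam1 lam2 dt).measurable.comp
      (h2.prodMk h3)

lemma IsDGSolution.ae_eq (h : IsBrownianFamily ℱ β Pr) (hη : ∀ i k, 0 ≤ η i k)
    (hs : ∑' k, ENNReal.ofReal (η 1 k) < ⊤) {u₀ : Ω → HH D} {u u' : ℕ → Ω → dgSpace T}
    (hu : IsDGSolution Pr ℱ β q η σ₀ lam1 lam2 b dt T u₀ u)
    (hu' : IsDGSolution Pr ℱ β q η σ₀ lam1 lam2 b dt T u₀ u') (n : ℕ) : u n =ᵐ[Pr] u' n := by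
  obtain ⟨-, h0, h1⟩ := (isDGSolution_iff h hη hs).1 hu
  obtain ⟨-, h0', h1'⟩ := (isDGSolution_iff h hη hs).1 hu'
  induction n with
  | zero =>
    filter_upwards [h0, h0'] with ω e1 e2
    rw [e1, e2]
  | succ n ih =>
    filter_upwards [ih, h1 n, h1' n] with ω e1 e2 e3
    rw [e2, e3, e1]

/-- The noise of step `n` is independent of the adapted state `u n` and has law `stepNoiseLaw`, so
the laws satisfy the same recursion as the semigroup in `bind_semigroup_succ`. -/
lemma IsDGSolution.map_eq [IsProbabilityMeasure Pr] (h : IsBrownianFamily ℱ β Pr)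
    (hη : ∀ i k, 0 ≤ η i k) (hs : ∑' k, ENNReal.ofReal (η 1 k) < ⊤) {κ : ℝ≥0}
    (hS : IsContractiveIteration (stepNoiseLaw q η b dt) κ (fun x => (proj T x : HH D))
      (stepMapHH T σ₀ lam1 lam2 dt))
    {u₀ : Ω → HH D} (hu₀ : Measurable[ℱ 0] u₀) {u : ℕ → Ω → dgSpace T}
    (hu : IsDGSolution Pr ℱ β q η σ₀ lam1 lam2 b dt T u₀ u) (n : ℕ) :
    Pr.map (fun ω => (u n ω : HH D)) = (Pr.map u₀).bind (hS.semigroup n) := by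
  obtain ⟨had, h0, h1⟩ := (isDGSolution_iff h hη hs).1 hu
  have hu₀' : Measurable u₀ := hu₀.mono (ℱ.le 0) le_rfl
  have := Measure.isProbabilityMeasure_map (μ := Pr) hu₀'.aemeasurable
  induction n with
  | zero =>
    rw [hS.bind_semigroup_zero, Measure.map_map hS.lipschitz_proj.continuous.measurable hu₀']
    refine Measure.map_congr ?_
    filter_upwards [h0] with ω hω
    rw [hω]
    rfl
  | succ n ih =>
    have hm : Measurable fun ω => (u n ω : HH D) := (had n).mono (ℱ.le _) le_rfl
    have hN := (measurable_stepNoise q η b dt).comp (h.measurable_brownianIncr' dt n)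
    have hlaw : Pr.map (stepNoise q η b dt ∘ brownianIncr β dt n) = stepNoiseLaw q η b dt := by
      rw [← Measure.map_map (measurable_stepNoise q η b dt) (h.measurable_brownianIncr' dt n),
        (h.hasLaw_brownianIncr dt n).map_eq]
      rfl
    have hind : IndepFun (stepNoise q η b dt ∘ brownianIncr β dt n) (fun ω => (u n ω : HH D)) Pr :=
      (h.indepFun_brownianIncr dt n (had n)).comp (measurable_stepNoise q η b dt) measurable_id
    rw [hS.bind_semigroup_succ, ← ih, ← hlaw,
      ← (indepFun_iff_map_prod_eq_prod_map_map hN.aemeasurable hm.aemeasurable).1 hind,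
      Measure.map_map hS.measurable (hN.prodMk hm)]
    refine Measure.map_congr ?_
    filter_upwards [h1 n] with ω hω
    rw [hω, coe_stepMap]
    rfl

end Solution

end StochMaxwell

end

/-! ### Well-posedness and long-time behaviour of the full discretization -/

theorem mainTheorem5
    (D : Cuboid) (σ₀ : ℝ) (hσ₀ : 0 < σ₀) (lam1 : ℝ) (lam2 : E3)
    (q : HilbertBasis ℕ ℝ (L2 D)) (η : Fin 2 → ℕ → ℝ) (hη : ∀ i k, 0 ≤ η i k)
    (γ₁ γ₂ : ℝ) (hγ₁ : 1 ≤ γ₁) (hγ₂ : 1 ≤ γ₂)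
    (hQ₁ : IsHSSobolev D γ₁ q (η 0)) (hQ₂ : IsHSSobolevZero D γ₂ q (η 1))
    (b : ℝ) (hb : 4 ≤ b)
    {Ω : Type*} [mΩ : MeasurableSpace Ω] (Pr : Measure Ω) [IsProbabilityMeasure Pr]
    (ℱ : Filtration ℝ≥0 mΩ) (β : Fin 2 × ℕ → ℝ≥0 → Ω → ℝ) (hβ : IsBrownianFamily ℱ β Pr) :
    ∃ dt₀ : ℝ≥0, 0 < dt₀ ∧ ∀ dt : ℝ≥0, 0 < dt → dt < dt₀ → ∀ T : SimplicialMesh D,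
      -- well-posedness for square integrable initial values
      (∀ u₀ : Ω → HH D, Measurable[ℱ 0] u₀ → ∫⁻ ω, ‖u₀ ω‖ₑ ^ 2 ∂Pr < ⊤ →
        (∃ u, IsDGSolution Pr ℱ β q η σ₀ lam1 lam2 b dt T u₀ u) ∧
        ∀ u u', IsDGSolution Pr ℱ β q η σ₀ lam1 lam2 b dt T u₀ u →
          IsDGSolution Pr ℱ β q η σ₀ lam1 lam2 b dt T u₀ u' → ∀ n, u n =ᵐ[Pr] u' n) ∧
      -- `P n` is the Markov transition semigroup of the solutions
      ∃ P : ℕ → Kernel (HH D) (HH D), (∀ n, IsMarkovKernel (P n)) ∧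
        (∀ (u₀ : Ω → HH D) (u : ℕ → Ω → dgSpace T), Measurable[ℱ 0] u₀ →
          IsDGSolution Pr ℱ β q η σ₀ lam1 lam2 b dt T u₀ u →
          ∀ n, Pr.map (fun ω => (u n ω : HH D)) = (Pr.map u₀).bind (P n)) ∧
        ∃ π : Measure (HH D), π ∈ P2 (HH D) ∧ IsInvariantMeasure P π ∧
          (∀ μ : Measure (HH D), IsProbabilityMeasure μ → IsInvariantMeasure P μ → μ = π) ∧
          IsErgodicFor P π ∧ IsExpMixing P π dt ∧
          ∀ μ ∈ P2 (HH D), ∀ n : ℕ,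
            W2 (μ.bind (P n)) π ≤ ENNReal.ofReal (Real.exp (-σ₀ * (n * dt))) * W2 μ π := by
  have hs := tsum_ofReal_lt_top (hη 1) hQ₂.2
  -- The step is solvable and contractive for every positive step size, so the threshold 1 is an
  -- arbitrary choice and does not involve the mesh.
  refine ⟨1, one_pos, fun dt hdt _ T => ⟨fun u₀ hu₀ _ =>
    ⟨⟨_, isDGSolution_dgSolution hβ hη hs hu₀⟩, fun u u' hu hu' n => hu.ae_eq hβ hη hs hu' n⟩, ?_⟩⟩
  have hS := isContractiveIteration_stepMapHH T hσ₀ lam1 lam2 hdt (stepNoiseLaw q η b dt)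
    (lintegral_stepNoiseLaw_lt_top q hη hs b dt)
  obtain ⟨π, hP, hπ⟩ := hS.exists_invariant
  have := hP.1
  have hκ : ((decay σ₀ dt : ℝ≥0) : ℝ) = Real.exp (-σ₀ * dt) := rfl
  refine ⟨hS.semigroup, fun n => inferInstance, fun u₀ u hu₀ hu n => hu.map_eq hβ hη hs hS hu₀ n,
    π, hP, hS.isInvariant_of_bind_eq hπ, fun μ hμ hi => hS.eq_of_isInvariant hP hπ hi,
    hS.isErgodicFor hP hπ, hS.isExpMixing hP hπ hσ₀ hκ, fun μ hμ n => ?_⟩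
  have hμ' := hμ.1
  have hne : decay σ₀ dt ≠ 0 := fun h0 => (Real.exp_pos (-σ₀ * dt)).ne' (by rw [← hκ, h0]; rfl)
  refine (hS.W2_bind_le hne hπ μ n).trans (le_of_eq ?_)
  congr 1
  rw [show -σ₀ * (n * dt) = n * (-σ₀ * dt) by ring, Real.exp_nat_mul, ← hκ,
    ENNReal.ofReal_pow (NNReal.coe_nonneg _), ENNReal.ofReal_coe_nnreal]
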